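/- **Notation.** Let $E$ be a complex Banach space and $A$ a closed (not necessarily densely defined) linear operator in $E$; $\rho(-A)$ is the set of $z\in\mathbb C$ for which $A+z$ has a bounded inverse. $A\in\mathcal P(0)$ means $[0,\infty)\subset\rho(-A)$ and $(1+s)\|(A+s)^{-1}\|\le K$ for all $s\ge 0$ and some $K\ge1$. For such $A$ let $A^{-1/2}=\frac1\pi\int_0^\infty s^{-1/2}(A+s)^{-1}ds$, $\sqrt A=(A^{-1/2})^{-1}$ and $A^{-3/2}=A^{-1}A^{-1/2}$. For $a>0$, $A\in\mathcal Q(a)$ means that $A\in\mathcal P(0)$, that $$\Pi_a=\{z\in\mathbb C: \mathrm{Re}\,z\ge a-\tfrac{(\mathrm{Im}\,z)^2}{4a}\}\subset\rho(-A),$$ and that $\|(A+z)^{-1}\|\to0$ and $|z|^{1/2}\|(A+z)^{-1}A^{-1/2}\|\to0$ as $|z|\to\infty$, $z\in\Pi_a$. Let $1<p<\infty$, $0<T<\infty$. In $L^p(0,T;E)$ let $B=\partial_t$ with $\mathcal D(B)=\{f\in W^{1,p}(0,T;E): f(0)=0\}$; then $((B+z)^{-1}g)(t)=\int_0^te^{z(x-t)}g(x)\,dx$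 for every $z\in\mathbb C$. $A$ and bounded operators on $E$ act on $L^p(0,T;E)$ pointwise in $t$. Put $W_0^{k,p}(0,T;\mathcal D(A^\alpha))=B^{-k}A^{-\alpha}L^p(0,T;E)$ and $L^p(0,T;\mathcal D(A^{\alpha}))=A^{-\alpha}L^p(0,T;E)$. Contour integrals over vertical lines are oriented upwards and are improper integrals. For $h\in L^p(0,T;E)$ let $$y_{\lambda,z}(h)=(i\sqrt A-z)^{-1}(-i\sqrt A-\lambda)^{-1}(B+z)^{-1}(B+\lambda)^{-1}h .$$ **Theorem.** Let $c>0$, $A\in\mathcal Q(c^2)$, and let $X=L^p(0,T;\mathcal D(A^{3/2}))\cap W_0^{2,p}(0,T;\mathcal D(\sqrt A))$. (i) For all $u\in X$ and $c'>c$, $\ u\in\mathcal D(B^2)\cap L^p(0,T;\mathcal D(A))$ and $$\frac1{(2\pi i)^2}\int_{i\mathbb R-c'}\int_{i\mathbb R-c}y_{\lambda,z}\big((B^2+A)u\big)\,d\lambda\,dz=u .$$ (ii) For all $w\in W_0^{1,p}(0,T;\mathcal D(\sqrt A))$ and $c'>c$, $$\frac1{2\pi i}\int_{i\mathbb R-c}(A+z^2)^{-1}(B+z)^{-1}w\,dz=\frac1{(2\pi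 i)^2}\int_{i\mathbb R-c'}\int_{i\mathbb R-c}y_{\lambda,z}(w)\,d\lambda\,dz ,$$ both sides being convergent in $L^p(0,T;E)$. (iii) For every $g\in X$ the Cauchy problem $$f''(t)+Af(t)=g(t),\qquad f(0)=f'(0)=0,\qquad\text{in } L^p(0,T;E),$$ has a unique solution $f$ in the sense of (i) and (ii), that is, $f=\mathcal Kg$ with $\mathcal K=\frac1{(2\pi i)^2}\int_{i\mathbb R-c'}\int_{i\mathbb R-c}y_{\lambda,z}(\cdot)\,d\lambda\,dz$ for every $c'>c$, where $\mathcal K(B^2+A)g=g$. It satisfies $f\in W^{1,p}(0,T;E)$, $f$ and $f'$ have continuous representatives with $f(0)=f'(0)=0$, and, for the continuous representative of $f$, $$f(t)=\frac1{2\pi i}\int_{i\mathbb R-c}\int_0^t(A+z^2)^{-1}e^{z(x-t)}g(x)\,dx\,dz,\qquad t\in[0,T];$$ this contour integral also converges to $f$ in $L^p(0,T;E)$. Moreover $f$ is the unique element of $L^p(0,T;E)$ for which $A^{-1}f\in\mathcal D(B^2)\cap L^p(0,T;\mathcal D(A))$ and $(B^2+A)A^{-1}f=A^{-1}g$; in particular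 every strong solution $u\in\mathcal D(B^2)\cap L^p(0,T;\mathcal D(A))$ of $(B^2+A)u=g$ equals $f$. -/

import Mathlib

open MeasureTheory Set Filter Topology
open scoped ENNReal ContDiff

noncomputable section

/-! ### Unbounded operators, resolvents, fractional powers -/

section Operators

variable {E : Type*} [NormedAddCommGroup E] [NormedSpace ℂ E]

/-- The bounded operator `R` is the (two-sided) inverse of `P + z : D(P) → E`. -/
def IsShiftInverse (P : E →ₗ.[ℂ] E) (z : ℂ) (R : E →L[ℂ] E) : Prop :=
  ∀ x y : E, R y = x ↔ ∃ hx : x ∈ P.domain, P ⟨x, hx⟩ + z • x = y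

/-- The resolvent set `ρ(-P)`: all `z` such that `P + z` has a bounded everywhere defined inverse. -/
def resolventSetNeg (P : E →ₗ.[ℂ] E) : Set ℂ :=
  {z | ∃ R : E →L[ℂ] E, IsShiftInverse P z R}

open Classical in
/-- `shiftInv P z = (P + z)⁻¹` for `z ∈ ρ(-P)` (and `0` otherwise). -/
def shiftInv (P : E →ₗ.[ℂ] E) (z : ℂ) : E →L[ℂ] E :=
  if h : ∃ R : E →L[ℂ] E, IsShiftInverse P z R then h.choose else 0

/-- The closed sector `{z ≠ 0 : |arg z| ≤ θ} ∪ {0}`. -/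
def sector (θ : ℝ) : Set ℂ := {z | |Complex.arg z| ≤ θ} ∪ {0}

/-- Sectorial operators, the class `𝒫(θ) = ⋃_{K ≥ 1} 𝒫_K(θ)`; `D(A)` need not be dense. -/
def IsSectorial (A : E →ₗ.[ℂ] E) (θ : ℝ) : Prop :=
  A.IsClosed ∧ sector θ ⊆ resolventSetNeg A ∧
    ∃ K : ℝ, 1 ≤ K ∧ ∀ z ∈ sector θ, (1 + ‖z‖) * ‖shiftInv A z‖ ≤ K

/-- `A^{-1/2} = (1/π) ∫_0^∞ s^{-1/2} (A + s)⁻¹ ds`, an absolutely convergent integral in operator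
norm if `A` is sectorial. -/
def invSqrt (A : E →ₗ.[ℂ] E) : E →L[ℂ] E :=
  (1 / Real.pi) • ∫ s in Ioi (0 : ℝ), (s ^ (-(1 / 2 : ℝ))) • shiftInv A (s : ℂ)

/-- `√A = (A^{-1/2})⁻¹`, with domain the range of the injective operator `A^{-1/2}`. -/
def sqrtOp (A : E →ₗ.[ℂ] E) : E →ₗ.[ℂ] E :=
  ((invSqrt A : E →ₗ[ℂ] E).toPMap ⊤).inverse

/-- `A^{-3/2} = A⁻¹ A^{-1/2}`; its range is `D(A^{3/2})`. -/
def invThreeHalves (A : E →ₗ.[ℂ] E) : E →L[ℂ] E :=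
  (shiftInv A 0).comp (invSqrt A)

/-- The region `Π_a = {z : Re z ≥ a - (Im z)² / (4a)}` to the right of a parabola. -/
def parabolicRegion (a : ℝ) : Set ℂ := {z | a - z.im ^ 2 / (4 * a) ≤ z.re}

/-- The class `𝒬(a)`. The `o(1)` conditions are for `|z| → ∞` inside `Π_a`. -/
structure IsParabolicClass (A : E →ₗ.[ℂ] E) (a : ℝ) : Prop where
  sectorial : IsSectorial A 0
  subset_resolventSet : parabolicRegion a ⊆ resolventSetNeg A
  resolvent_decay :
    Tendsto (fun z : ℂ => ‖shiftInv A z‖) (Bornology.cobounded ℂ ⊓ 𝓟 (parabolicRegion a)) (𝓝 0)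
  weighted_decay :
    Tendsto (fun z : ℂ => ‖z‖ ^ (1 / 2 : ℝ) * ‖(shiftInv A z).comp (invSqrt A)‖)
      (Bornology.cobounded ℂ ⊓ 𝓟 (parabolicRegion a)) (𝓝 0)

end Operators

/-! ### Contour integrals over vertical lines -/

section Contour

variable {V : Type*} [NormedAddCommGroup V] [NormedSpace ℂ V]

/-- `(1/2πi) ∫_{iℝ-c} F(z) dz = v`: the (upward oriented) contour integral over the line
`Re z = -c` converges as an improper Bochner integral. -/
def HasContourIntegral (c : ℝ) (F : ℂ → V) (v : V) : Prop :=
  (∀ a b : ℝ, IntervalIntegrable (fun s : ℝ => F (-(c : ℂ) + s * Complex.I)) volume a b) ∧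
  Tendsto
    (fun r : ℝ × ℝ => (1 / (2 * (Real.pi : ℂ) * Complex.I)) •
      ∫ s in r.1..r.2, Complex.I • F (-(c : ℂ) + s * Complex.I))
    (atBot ×ˢ atTop) (𝓝 v)

/-- `(1/(2πi)²) ∫_{iℝ-c'} ∫_{iℝ-c} F(λ, z) dλ dz = v`, as an iterated integral; the first argument
of `F` is `λ ∈ iℝ - c`, the second is `z ∈ iℝ - c'`. -/
def HasDoubleContourIntegral (c' c : ℝ) (F : ℂ → ℂ → V) (v : V) : Prop :=
  ∃ G : ℂ → V, (∀ z : ℂ, z.re = -c' → HasContourIntegral c (fun l => F l z) (G z)) ∧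
    HasContourIntegral c' G v

end Contour

/-! ### The space `L^p(0,T;E)` and the operators on it -/

section Bochner

variable {E : Type*} [NormedAddCommGroup E] [NormedSpace ℂ E]

/-- Lebesgue measure on `(0,T)`. -/
abbrev timeMeasure (T : ℝ) : Measure ℝ := volume.restrict (Ioo 0 T)

/-- `L^p(0,T;E)`. -/
abbrev LpT (E : Type*) [NormedAddCommGroup E] (p : ℝ≥0∞) (T : ℝ) : Type _ :=
  Lp E p (timeMeasure T)

/-- `h` is the weak derivative of `f` on `(0,T)`. -/
def HasWeakDeriv (T : ℝ) (f h : ℝ → E) : Prop :=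
  ∀ φ : ℝ → ℝ, ContDiff ℝ ∞ φ → HasCompactSupport φ → tsupport φ ⊆ Ioo 0 T →
    ∫ t in Ioo 0 T, deriv φ t • f t = - ∫ t in Ioo 0 T, φ t • h t

/-- `f ∈ W^{1,p}(0,T;E)`. -/
def MemW1p {p : ℝ≥0∞} {T : ℝ} (f : LpT E p T) : Prop :=
  ∃ h : LpT E p T, HasWeakDeriv T f h

/-- `f(0) = 0` for the continuous representative of `f` on `[0,T]` (which is required to exist). -/
def StartsAtZero {p : ℝ≥0∞} {T : ℝ} (f : LpT E p T) : Prop :=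
  ∃ F : ℝ → E, ContinuousOn F (Icc 0 T) ∧ F =ᵐ[timeMeasure T] f ∧ F 0 = 0

/-- `f ∈ D(B)` and `B f = h`, where `B = ∂_t` has domain `{f ∈ W^{1,p}(0,T;E) : f(0) = 0}`. -/
def IsTimeDeriv {p : ℝ≥0∞} {T : ℝ} (f h : LpT E p T) : Prop :=
  HasWeakDeriv T f h ∧ StartsAtZero f

/-- `f(t) ∈ D(A)` and `A f(t) = h(t)` for almost every `t`. -/
def IsPointwiseApply (A : E →ₗ.[ℂ] E) {p : ℝ≥0∞} {T : ℝ} (f h : LpT E p T) : Prop :=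
  ∀ᵐ t ∂(timeMeasure T), ∃ hx : f t ∈ A.domain, A ⟨f t, hx⟩ = h t

/-- `u ∈ D(B²) ∩ L^p(0,T;D(A))` and `(B² + A) u = h`, i.e. `u` is a strong solution of
`u'' + A u = h`, `u(0) = u'(0) = 0`. -/
def IsHyperbolicApply (A : E →ₗ.[ℂ] E) {p : ℝ≥0∞} {T : ℝ} (u h : LpT E p T) : Prop :=
  ∃ u₁ u₂ v : LpT E p T, IsTimeDeriv u u₁ ∧ IsTimeDeriv u₁ u₂ ∧ IsPointwiseApply A u v ∧
    u₂ + v = h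

theorem memLp_duhamel {p : ℝ≥0∞} [Fact (1 ≤ p)] {T : ℝ} (z : ℂ) (g : LpT E p T) :
    MemLp (fun t : ℝ => ∫ x in (0 : ℝ)..t, Complex.exp (z * ((x : ℂ) - t)) • g x) p
      (timeMeasure T) := by
  have hg : IntegrableOn (fun x => g x) (Icc 0 T) volume := by
    rw [integrableOn_Icc_iff_integrableOn_Ioo]
    exact (Lp.memLp g).integrable Fact.out
  have hk : IntegrableOn (fun x : ℝ => Complex.exp (z * (x : ℂ)) • g x) (Icc 0 T) volume :=
    hg.continuousOn_smul (by fun_prop) isCompact_Icc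
  have hcont : ContinuousOn
      (fun t : ℝ => ∫ x in (0 : ℝ)..t, Complex.exp (z * ((x : ℂ) - t)) • g x) (Icc 0 T) := by
    have h1 : ContinuousOn (fun t : ℝ => Complex.exp (-(z * (t : ℂ))) •
        ∫ x in Ioc (0 : ℝ) t, Complex.exp (z * (x : ℂ)) • g x) (Icc 0 T) :=
      (by fun_prop : Continuous fun t : ℝ => Complex.exp (-(z * (t : ℂ)))).continuousOn.smul
        (intervalIntegral.continuousOn_primitive hk)
    refine h1.congr fun t ht => ?_
    simp only
    rw [intervalIntegral.integral_of_le ht.1, ← integral_smul]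
    refine integral_congr_ae (Eventually.of_forall fun x => ?_)
    simp only [smul_smul, ← Complex.exp_add]
    congr 2
    ring
  obtain ⟨C, hC⟩ := isCompact_Icc.exists_bound_of_continuousOn hcont
  refine MemLp.of_bound
    ((hcont.mono Ioo_subset_Icc_self).aestronglyMeasurable measurableSet_Ioo) C ?_
  exact (ae_restrict_iff' measurableSet_Ioo).2
    (Eventually.of_forall fun t ht => hC t (Ioo_subset_Icc_self ht))

/-- `((B + z)⁻¹ g)(t) = ∫_0^t e^{z(x-t)} g(x) dx`. -/
def derivInv {p : ℝ≥0∞} [Fact (1 ≤ p)] {T : ℝ} (z : ℂ) (g : LpT E p T) : LpT E p T :=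
  (memLp_duhamel z g).toLp _

/-- The action `(S f)(t) = S (f(t))` of a bounded operator `S` on `L^p(0,T;E)`. -/
def liftOp {p : ℝ≥0∞} [Fact (1 ≤ p)] {T : ℝ} (S : E →L[ℂ] E) (f : LpT E p T) : LpT E p T :=
  S.compLp f

/-- `W_0^{k,p}(0,T;S E) = B^{-k} S L^p(0,T;E)`. For `S = A^{-α}` this is
`W_0^{k,p}(0,T;D(A^α))`, and for `k = 0` it is `L^p(0,T;D(A^α))`. -/
def W0 (k : ℕ) (p : ℝ≥0∞) [Fact (1 ≤ p)] (T : ℝ) (S : E →L[ℂ] E) : Set (LpT E p T) :=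
  {f | ∃ k' : LpT E p T, f = (derivInv 0)^[k] (liftOp S k')}

/-- The space of data `L^p(0,T;D(A^{3/2})) ∩ W_0^{2,p}(0,T;D(√A))`. -/
def dataSpace (A : E →ₗ.[ℂ] E) (p : ℝ≥0∞) [Fact (1 ≤ p)] (T : ℝ) : Set (LpT E p T) :=
  W0 0 p T (invThreeHalves A) ∩ W0 2 p T (invSqrt A)

/-- `y_{λ,z}(h) = (i√A - z)⁻¹ (-i√A - λ)⁻¹ (B + z)⁻¹ (B + λ)⁻¹ h`. -/
def doubleKernel (A : E →ₗ.[ℂ] E) {p : ℝ≥0∞} [Fact (1 ≤ p)] {T : ℝ} (h : LpT E p T)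
    (l z : ℂ) : LpT E p T :=
  liftOp (shiftInv (Complex.I • sqrtOp A) (-z))
    (liftOp (shiftInv ((-Complex.I) • sqrtOp A) (-l))
      (derivInv z (derivInv l h)))

/-- The first double contour identity at `u`: `(B² + A) u` is defined and
`(1/(2πi)²) ∫_{iℝ-c'} ∫_{iℝ-c} y_{λ,z}((B² + A) u) dλ dz = u` for every `c' > c`. -/
def InversionIdentity (A : E →ₗ.[ℂ] E) (c : ℝ) {p : ℝ≥0∞} [Fact (1 ≤ p)] {T : ℝ}
    (u : LpT E p T) : Prop :=
  ∃ h : LpT E p T, IsHyperbolicApply A u h ∧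
    ∀ c' : ℝ, c < c' → HasDoubleContourIntegral c' c (doubleKernel A h) u

/-- The second double contour identity at `w`: for every `c' > c`,
`(1/2πi) ∫_{iℝ-c} (A + z²)⁻¹ (B + z)⁻¹ w dz = (1/(2πi)²) ∫_{iℝ-c'} ∫_{iℝ-c} y_{λ,z}(w) dλ dz`,
both sides being convergent in `L^p(0,T;E)`. -/
def ReductionIdentity (A : E →ₗ.[ℂ] E) (c : ℝ) {p : ℝ≥0∞} [Fact (1 ≤ p)] {T : ℝ}
    (w : LpT E p T) : Prop :=
  ∃ v : LpT E p T,
    HasContourIntegral c (fun z => liftOp (shiftInv A (z ^ 2)) (derivInv z w)) v ∧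
    ∀ c' : ℝ, c < c' → HasDoubleContourIntegral c' c (doubleKernel A w) v

/-- `f` solves `f'' + A f = g`, `f(0) = f'(0) = 0` in the double contour sense: the operator
`𝒦 = (1/(2πi)²) ∫_{iℝ-c'} ∫_{iℝ-c} y_{λ,z}(·) dλ dz` satisfies `𝒦 (B² + A) g = g`, and
`f = 𝒦 g` (for every `c' > c`). -/
def IsContourSolution (A : E →ₗ.[ℂ] E) (c : ℝ) {p : ℝ≥0∞} [Fact (1 ≤ p)] {T : ℝ}
    (g f : LpT E p T) : Prop :=
  InversionIdentity A c g ∧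
    ∀ c' : ℝ, c < c' → HasDoubleContourIntegral c' c (doubleKernel A g) f

/-- `f` is a generalized solution of `f'' + A f = g`, `f(0) = f'(0) = 0`: `A⁻¹ f` is a strong
solution for the right-hand side `A⁻¹ g`. Every strong solution is a generalized one. -/
def IsGeneralizedSolution (A : E →ₗ.[ℂ] E) {p : ℝ≥0∞} [Fact (1 ≤ p)] {T : ℝ}
    (g f : LpT E p T) : Prop :=
  IsHyperbolicApply A (liftOp (shiftInv A 0) f) (liftOp (shiftInv A 0) g)

end Bochner

end

/-!
The wave operator factors as `B² + A = (B + i√A) (B - i√A)`. Squaring maps the line `iℝ - c` onto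
the parabola bounding `Π_{c²}`, so that for `A ∈ 𝒬(c²)` the operators `(A + z²)⁻¹` and
`z (A + z²)⁻¹ A^{-1/2}` are holomorphic to the left of that line and vanish at infinity there; the
resolvents `(±i√A - z)⁻¹` are built from them. Partial fractions and closing the contour to the left
invert each of the two first-order factors, which gives (i).

For (ii), the resolvent identity splits `(B + z)⁻¹ (B + λ)⁻¹` into a term with `(B + z)⁻¹` and a
term with `(B + λ)⁻¹`. In the first, closing the `λ`-contour picks up the pole at `λ = z`, where
`(i√A - z)⁻¹ (-i√A - z)⁻¹ = (A + z²)⁻¹`. The second is absolutely integrable in `(λ, z)`, and after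
exchanging the integrals its `z`-contour can be closed without meeting a pole.

In (iii), a solution of the homogeneous generalized equation is zero because `A^{-3/2} B⁻²` maps it
to a homogeneous solution to which (i) applies.
-/

open Complex (I)

noncomputable section

/-! ### Calculus of contour integrals -/

section ContourIntegral

variable {V : Type*} [NormedAddCommGroup V] [NormedSpace ℂ V]
variable {W : Type*} [NormedAddCommGroup W] [NormedSpace ℂ W]
variable {c : ℝ} {F G : ℂ → V} {v w : V}

namespace HasContourIntegral

lemma unique (hv : HasContourIntegral c F v) (hw : HasContourIntegral c F w) : v = w :=
  tendsto_nhds_unique hv.2 hw.2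

lemma congr (hv : HasContourIntegral c F v) (h : ∀ z : ℂ, z.re = -c → F z = G z) :
    HasContourIntegral c G v := by
  have h' (s : ℝ) : G (-(c : ℂ) + s * I) = F (-(c : ℂ) + s * I) := (h _ (by simp)).symm
  exact ⟨fun a b => by simpa only [h'] using hv.1 a b, by simpa only [h'] using hv.2⟩

lemma map [CompleteSpace V] [CompleteSpace W] (hv : HasContourIntegral c F v) (L : V →L[ℂ] W) :
    HasContourIntegral c (fun z => L (F z)) (L v) := by
  refine ⟨fun a b => ⟨L.integrable_comp (hv.1 a b).1, L.integrable_comp (hv.1 a b).2⟩,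
    ((L.continuous.tendsto v).comp hv.2).congr fun r => ?_⟩
  have hL := L.intervalIntegral_comp_comm ((hv.1 r.1 r.2).smul I)
  simp only [Pi.smul_apply, map_smul] at hL
  simp only [Function.comp, map_smul, hL]

lemma add (hv : HasContourIntegral c F v) (hw : HasContourIntegral c G w) :
    HasContourIntegral c (fun z => F z + G z) (v + w) := by
  refine ⟨fun a b => (hv.1 a b).add (hw.1 a b), (hv.2.add hw.2).congr fun r => ?_⟩
  have hadd := intervalIntegral.integral_add ((hv.1 r.1 r.2).smul I) ((hw.1 r.1 r.2).smul I)
  simp only [Pi.smul_apply] at hadd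
  simp only [← smul_add, ← hadd]

lemma neg (hv : HasContourIntegral c F v) : HasContourIntegral c (fun z => -F z) (-v) :=
  ⟨fun a b => (hv.1 a b).neg, hv.2.neg.congr fun r => by simp⟩

lemma sub (hv : HasContourIntegral c F v) (hw : HasContourIntegral c G w) :
    HasContourIntegral c (fun z => F z - G z) (v - w) := by
  simpa only [sub_eq_add_neg] using hv.add hw.neg

lemma of_reflect (h : HasContourIntegral (-c) (fun z => F (-z)) v) : HasContourIntegral c F v := by
  have reflect (s : ℝ) :
      -(-((-c : ℝ) : ℂ) + ((-s : ℝ) : ℂ) * I) = -(c : ℂ) + s * I := by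
    push_cast; ring
  refine ⟨fun a b => ?_, ?_⟩
  · have hab := (h.1 (-a) (-b)).comp_sub_left 0
    simp only [zero_sub, sub_neg_eq_add, zero_add] at hab
    simpa only [reflect] using hab
  · have hswap : Tendsto (fun r : ℝ × ℝ => (-r.2, -r.1)) (atBot ×ˢ atTop) (atBot ×ˢ atTop) :=
      (tendsto_neg_atTop_atBot.comp tendsto_snd).prodMk (tendsto_neg_atBot_atTop.comp tendsto_fst)
    refine (h.2.comp hswap).congr fun r => ?_
    simp only [Function.comp, ← intervalIntegral.integral_comp_neg, reflect]

lemma eq_zero_of_forall (hv : HasContourIntegral c F v) (hF : ∀ z, F z = 0) : v = 0 :=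
  hv.unique (by simp [HasContourIntegral, hF])

end HasContourIntegral

lemma hasContourIntegral_of_integrable (h : Integrable fun s : ℝ => F (-(c : ℂ) + s * I)) :
    HasContourIntegral c F ((1 / (2 * (Real.pi : ℂ) * I)) • ∫ s : ℝ, I • F (-(c : ℂ) + s * I)) :=
  ⟨fun _ _ => h.intervalIntegrable, Tendsto.const_smul
    (intervalIntegral_tendsto_integral (h.smul I) tendsto_fst tendsto_snd) _⟩

lemma tendsto_sub_of_tendsto_cobounded {X : Type*} [AddGroup X] [TopologicalSpace X]
    [IsTopologicalAddGroup X] {Φ : ℝ → X} {x : X} (h : Tendsto Φ (Bornology.cobounded ℝ) (𝓝 x)) :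
    Tendsto (fun r : ℝ × ℝ => Φ r.2 - Φ r.1) (atBot ×ˢ atTop) (𝓝 0) := by
  rw [IsOrderBornology.cobounded_eq, tendsto_sup] at h
  simpa using (h.2.comp tendsto_snd).sub (h.1.comp tendsto_fst)

lemma hasContourIntegral_zero_of_tendsto (hF : Continuous fun s : ℝ => F (-(c : ℂ) + s * I))
    (h : Tendsto (fun b : ℝ => ∫ s in (0 : ℝ)..b, I • F (-(c : ℂ) + s * I))
      (Bornology.cobounded ℝ) (𝓝 v)) : HasContourIntegral c F 0 := by
  refine ⟨fun a b => hF.intervalIntegrable a b, ?_⟩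
  have hlim := (tendsto_sub_of_tendsto_cobounded h).const_smul (1 / (2 * (Real.pi : ℂ) * I))
  rw [smul_zero] at hlim
  refine hlim.congr fun r => ?_
  rw [intervalIntegral.integral_interval_sub_left] <;>
    exact (hF.const_smul I).intervalIntegrable _ _

lemma hasContourIntegral_zero_of_integral_swap [CompleteSpace V] {c' : ℝ} {g : ℂ → ℂ → V}
    (hg : Integrable (fun q : ℝ × ℝ => g (-(c : ℂ) + q.1 * I) (-(c' : ℂ) + q.2 * I))
      (volume.prod volume))
    (hzero : ∀ l : ℂ, l.re = -c → HasContourIntegral c' (g l) 0) :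
    HasContourIntegral c' (fun z => (1 / (2 * (Real.pi : ℂ) * I)) •
      ∫ s : ℝ, I • g (-(c : ℂ) + s * I) z) 0 := by
  have inner : Integrable (fun y : ℝ => (1 / (2 * (Real.pi : ℂ) * I)) •
      ∫ s : ℝ, I • g (-(c : ℂ) + s * I) (-(c' : ℂ) + y * I)) :=
    (hg.smul I).integral_prod_right.smul _
  have swapped : ∫ y : ℝ, ∫ s : ℝ, g (-(c : ℂ) + s * I) (-(c' : ℂ) + y * I) = 0 := by
    rw [← integral_integral_swap hg]
    refine integral_eq_zero_of_ae ?_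
    filter_upwards [hg.prod_right_ae] with s hs
    have hs0 := (hasContourIntegral_of_integrable hs).unique (hzero _ (by simp))
    rw [integral_smul, smul_smul, smul_eq_zero] at hs0
    exact hs0.resolve_left (by simp [Complex.I_ne_zero, Real.pi_ne_zero])
  convert hasContourIntegral_of_integrable (F := fun z => (1 / (2 * (Real.pi : ℂ) * I)) •
    ∫ s : ℝ, I • g (-(c : ℂ) + s * I) z) inner using 1
  simp only [integral_smul, swapped, smul_zero]

end ContourIntegral

/-! ### Closing a contour to the left -/

section LeftHalfPlane

/-- The closed half-plane to the left of the contour `iℝ - c`. -/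
def leftHalfPlane (c : ℝ) : Set ℂ := {z | z.re ≤ -c}

/-- The filter `|z| → ∞` within the closed half-plane to the left of the contour `iℝ - c`. -/
def leftInfty (c : ℝ) : Filter ℂ := Bornology.cobounded ℂ ⊓ 𝓟 (leftHalfPlane c)

variable {c c' : ℝ} {U : Type*} [TopologicalSpace U]

lemma leftHalfPlane_anti (h : c ≤ c') : leftHalfPlane c' ⊆ leftHalfPlane c :=
  fun z (hz : z.re ≤ -c') => show z.re ≤ -c by linarith

lemma leftInfty_anti (h : c ≤ c') : leftInfty c' ≤ leftInfty c :=
  inf_le_inf_left _ (principal_mono.2 (leftHalfPlane_anti h))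

lemma isClosed_leftHalfPlane (c : ℝ) : IsClosed (leftHalfPlane c) :=
  isClosed_Iic.preimage Complex.continuous_re

lemma vertical_mem_leftHalfPlane (c s : ℝ) : -(c : ℂ) + s * I ∈ leftHalfPlane c := by
  simp [leftHalfPlane]

lemma eventually_mem_leftHalfPlane : ∀ᶠ z in leftInfty c, z ∈ leftHalfPlane c :=
  mem_inf_of_right (mem_principal_self _)

lemma eventually_leftInfty {P : ℂ → Prop} :
    (∀ᶠ z in leftInfty c, P z) ↔ ∃ N : ℝ, 0 < N ∧ ∀ z ∈ leftHalfPlane c, N ≤ ‖z‖ → P z := by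
  rw [leftInfty, ← comap_norm_atTop,
    ((atTop_basis' (1 : ℝ)).comap _).inf_principal _ |>.eventually_iff]
  constructor
  · rintro ⟨N, hN, h⟩
    exact ⟨N, one_pos.trans_le hN, fun z hz hNz => h ⟨hNz, hz⟩⟩
  · rintro ⟨N, -, h⟩
    exact ⟨max 1 N, le_max_left _ _, fun z hz => h z hz.2 ((le_max_right _ _).trans hz.1)⟩

lemma tendsto_norm_leftInfty (c : ℝ) : Tendsto (fun z : ℂ => ‖z‖) (leftInfty c) atTop :=
  tendsto_norm_cobounded_atTop.mono_left inf_le_left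

lemma sub_abs_le_norm_neg_sub (c x : ℝ) : x - |c| ≤ ‖-(c : ℂ) - x‖ := by
  have hre := Complex.abs_re_le_norm (-(c : ℂ) - x)
  simp only [Complex.sub_re, Complex.neg_re, Complex.ofReal_re] at hre
  linarith [neg_abs_le (-c - x), neg_abs_le c]

lemma tendsto_ray_leftInfty (c : ℝ) : Tendsto (fun x : ℝ => -(c : ℂ) - x) atTop (leftInfty c) := by
  refine tendsto_inf.2 ⟨?_, tendsto_principal.2 ?_⟩
  · rw [← tendsto_norm_atTop_iff_cobounded]
    exact tendsto_atTop_mono (sub_abs_le_norm_neg_sub c)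
      (tendsto_atTop_add_const_right _ (-|c|) tendsto_id)
  · filter_upwards [eventually_ge_atTop 0] with x hx
    simpa [leftHalfPlane] using hx

lemma continuous_vertical {F : ℂ → U} (h : ContinuousOn F (leftHalfPlane c)) :
    Continuous fun s : ℝ => F (-(c : ℂ) + s * I) :=
  h.comp_continuous (by fun_prop) fun s => vertical_mem_leftHalfPlane c s

lemma continuousOn_ray {F : ℂ → U} (h : ContinuousOn F (leftHalfPlane c)) :
    ContinuousOn (fun x : ℝ => F (-(c : ℂ) - x)) (Ici 0) :=
  h.comp (by fun_prop) fun x hx => by simpa [leftHalfPlane] using hx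

lemma differentiableOn_inv_sub {z : ℂ} (hz : -c < z.re) :
    DifferentiableOn ℂ (fun l => (z - l)⁻¹) (leftHalfPlane c) := by
  refine DifferentiableOn.inv (by fun_prop) fun l hl hzl => ?_
  exact hz.not_ge (sub_eq_zero.1 hzl ▸ hl)

lemma eventually_norm_inv_sub_le (c : ℝ) (z : ℂ) :
    ∀ᶠ l in leftInfty c, ‖(z - l)⁻¹‖ ≤ 2 / ‖l‖ := by
  filter_upwards [(tendsto_norm_leftInfty c).eventually_ge_atTop (2 * ‖z‖ + 1)] with l hl
  have hz := norm_nonneg z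
  have hlz : ‖l‖ / 2 ≤ ‖z - l‖ := by linarith [norm_sub_norm_le l z, norm_sub_rev l z]
  calc ‖(z - l)⁻¹‖ = ‖z - l‖⁻¹ := norm_inv _
    _ ≤ (‖l‖ / 2)⁻¹ := inv_anti₀ (by linarith) hlz
    _ = 2 / ‖l‖ := inv_div _ _

end LeftHalfPlane

section Closing

variable {V : Type*} [NormedAddCommGroup V] [NormedSpace ℂ V]
variable {c : ℝ} {F : ℂ → V} {v : V}

lemma integral_vertical_eq_rect (hF : DifferentiableOn ℂ F (leftHalfPlane c)) {r : ℝ}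
    (hr : 0 ≤ r) (a b : ℝ) :
    (∫ s in a..b, I • F (-(c : ℂ) + s * I)) =
      (∫ x in (-c - r)..(-c), F (x + b * I)) - (∫ x in (-c - r)..(-c), F (x + a * I)) +
      ∫ s in a..b, I • F (-(c : ℂ) - r + s * I) := by
  have hle : -c - r ≤ -c := by linarith
  have hrect := Complex.integral_boundary_rect_eq_zero_of_continuousOn_of_differentiableOn F
    (-(c : ℂ) - r + a * I) (-(c : ℂ) + b * I)
    (hF.continuousOn.mono ?_) (hF.mono ?_)
  · simp only [Complex.add_re, Complex.sub_re, Complex.neg_re, Complex.ofReal_re, Complex.mul_re,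
      Complex.I_re, mul_zero, Complex.ofReal_im, Complex.I_im, mul_one, sub_self, add_zero,
      Complex.add_im, Complex.sub_im, Complex.neg_im, neg_zero, Complex.mul_im, zero_add] at hrect
    rw [intervalIntegral.integral_smul, intervalIntegral.integral_smul, ← sub_eq_zero]
    push_cast at hrect
    rw [← hrect]
    abel
  · intro x hx
    have hre := hx.1
    simp only [Complex.add_re, Complex.sub_re, Complex.neg_re, Complex.ofReal_re, Complex.mul_re,
      Complex.I_re, mul_zero, Complex.ofReal_im, Complex.I_im, mul_one, sub_self, add_zero,
      mem_preimage, uIcc_of_le hle] at hre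
    exact hre.2
  · intro x hx
    have hre := hx.1
    simp only [Complex.add_re, Complex.sub_re, Complex.neg_re, Complex.ofReal_re, Complex.mul_re,
      Complex.I_re, mul_zero, Complex.ofReal_im, Complex.I_im, mul_one, sub_self, add_zero,
      mem_preimage, max_eq_right hle] at hre
    exact hre.2.le

lemma norm_vertical_add_ray_le (hF : DifferentiableOn ℂ F (leftHalfPlane c)) {b M : ℝ}
    (hb : 2 * |c| ≤ |b|) (hM : ∀ z ∈ leftHalfPlane c, |b| / 2 ≤ ‖z‖ → ‖F z‖ ≤ M) :
    ‖(∫ s in (0 : ℝ)..b, I • F (-(c : ℂ) + s * I)) + ∫ x in (-c - |b|)..(-c), F x‖ ≤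
      2 * (M * |b|) := by
  have hb0 := abs_nonneg b
  have horizontal : ‖∫ x in (-c - |b|)..(-c), F (x + b * I)‖ ≤ M * |b| := by
    refine (intervalIntegral.norm_integral_le_of_norm_le_const fun x hx => hM _ ?_ ?_).trans
      (by simp)
    · rw [uIoc_of_le (by linarith)] at hx
      simpa [leftHalfPlane] using hx.2
    · have him : |b| ≤ ‖(x : ℂ) + b * I‖ := by
        simpa using Complex.abs_im_le_norm ((x : ℂ) + b * I)
      linarith
  have vertical : ‖∫ s in (0 : ℝ)..b, I • F (-(c : ℂ) - |b| + s * I)‖ ≤ M * |b| := by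
    refine (intervalIntegral.norm_integral_le_of_norm_le_const (C := M) fun s _ => ?_).trans
      (by simp)
    rw [norm_smul, Complex.norm_I, one_mul]
    refine hM _ (by simp [leftHalfPlane]) ?_
    have hre : |(-c - |b|)| ≤ ‖-(c : ℂ) - |b| + s * I‖ := by
      simpa using Complex.abs_re_le_norm (-(c : ℂ) - |b| + s * I)
    linarith [neg_abs_le (-c - |b|), neg_abs_le c]
  have hrect := integral_vertical_eq_rect hF hb0 0 b
  simp only [Complex.ofReal_zero, zero_mul, add_zero] at hrect
  rw [hrect]
  calc _ = ‖(∫ x in (-c - |b|)..(-c), F (x + b * I)) +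
          ∫ s in (0 : ℝ)..b, I • F (-(c : ℂ) - |b| + s * I)‖ := by congr 1; abel
    _ ≤ 2 * (M * |b|) := by linarith [norm_add_le_of_le horizontal vertical]

lemma tendsto_vertical_add_ray (hF : DifferentiableOn ℂ F (leftHalfPlane c))
    (ho : Tendsto (fun z => ‖z‖ * ‖F z‖) (leftInfty c) (𝓝 0)) :
    Tendsto (fun b : ℝ => (∫ s in (0 : ℝ)..b, I • F (-(c : ℂ) + s * I)) +
      ∫ x in (-c - |b|)..(-c), F x) (Bornology.cobounded ℝ) (𝓝 0) := by
  rw [Metric.tendsto_nhds]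
  intro ε hε
  obtain ⟨N, hN, hsmall⟩ :=
    eventually_leftInfty.1 (Metric.tendsto_nhds.1 ho (ε / 5) (by positivity))
  have hlarge : ∀ᶠ b : ℝ in Bornology.cobounded ℝ, 2 * N + 2 * |c| ≤ ‖b‖ :=
    (tendsto_norm_cobounded_atTop (E := ℝ)).eventually_ge_atTop _
  filter_upwards [hlarge] with b hb
  rw [Real.norm_eq_abs] at hb
  have hc := abs_nonneg c
  have hb0 : 0 < |b| := by linarith
  have hM : ∀ z ∈ leftHalfPlane c, |b| / 2 ≤ ‖z‖ → ‖F z‖ ≤ ε / 5 / (|b| / 2) := by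
    intro z hz hbz
    have hFz := hsmall z hz (by linarith)
    rw [dist_zero_right, norm_mul, norm_norm, norm_norm] at hFz
    rw [le_div_iff₀ (by positivity)]
    nlinarith [norm_nonneg (F z)]
  rw [dist_zero_right]
  calc _ ≤ 2 * (ε / 5 / (|b| / 2) * |b|) := norm_vertical_add_ray_le hF (by linarith) hM
    _ = 4 / 5 * ε := by field_simp; norm_num
    _ < ε := by linarith

lemma tendsto_ray_integral (hray : IntegrableOn (fun x : ℝ => F (-(c : ℂ) - x)) (Ioi 0)) :
    Tendsto (fun b : ℝ => ∫ x in (-c - |b|)..(-c), F x) (Bornology.cobounded ℝ)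
      (𝓝 (∫ x in Ioi (0 : ℝ), F (-(c : ℂ) - x))) := by
  have habs : Tendsto (fun b : ℝ => |b|) (Bornology.cobounded ℝ) atTop :=
    tendsto_norm_cobounded_atTop (E := ℝ)
  refine ((intervalIntegral_tendsto_integral_Ioi 0 hray tendsto_id).comp habs).congr fun b => ?_
  have hsub := intervalIntegral.integral_comp_sub_left (a := 0) (b := |b|) (fun x : ℝ => F x) (-c)
  simp only [sub_zero, Complex.ofReal_sub, Complex.ofReal_neg] at hsub
  exact hsub

lemma hasContourIntegral_zero_of_decay (hF : DifferentiableOn ℂ F (leftHalfPlane c))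
    (ho : Tendsto (fun z => ‖z‖ * ‖F z‖) (leftInfty c) (𝓝 0))
    (hray : IntegrableOn (fun x : ℝ => F (-(c : ℂ) - x)) (Ioi 0)) :
    HasContourIntegral c F 0 :=
  hasContourIntegral_zero_of_tendsto (continuous_vertical hF.continuousOn)
    (by simpa using (tendsto_vertical_add_ray hF ho).sub (tendsto_ray_integral hray))

lemma tendsto_integral_horizontal {c' : ℝ} (hcc : c ≤ c')
    (hF : Tendsto F (leftInfty c ⊓ 𝓟 {z | -c' ≤ z.re}) (𝓝 0)) :
    Tendsto (fun y : ℝ => ∫ x in (-c')..(-c), F (x + y * I)) (Bornology.cobounded ℝ) (𝓝 0) := by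
  rw [Metric.tendsto_nhds]
  intro ε hε
  have hsmall := Metric.tendsto_nhds.1 hF (ε / (c' - c + 1)) (div_pos hε (by linarith))
  rw [eventually_inf_principal] at hsmall
  obtain ⟨N, -, hsmall⟩ := eventually_leftInfty.1 hsmall
  filter_upwards [(tendsto_norm_cobounded_atTop (E := ℝ)).eventually_ge_atTop N] with y hy
  have hFy : ∀ x ∈ uIoc (-c') (-c), ‖F (x + y * I)‖ ≤ ε / (c' - c + 1) := by
    intro x hx
    rw [uIoc_of_le (by linarith)] at hx
    have him : ‖y‖ ≤ ‖(x : ℂ) + y * I‖ := by simpa using Complex.abs_im_le_norm (x + y * I)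
    simpa using (hsmall (x + y * I) (by simpa [leftHalfPlane] using hx.2) (hy.trans him)
      (by simpa using hx.1.le)).le
  rw [dist_zero_right]
  calc _ ≤ ε / (c' - c + 1) * |-c - -c'| :=
      intervalIntegral.norm_integral_le_of_norm_le_const hFy
    _ < ε := by
      rw [abs_of_nonneg (by linarith), div_mul_eq_mul_div, div_lt_iff₀ (by linarith)]
      nlinarith

lemma HasContourIntegral.shift {c' : ℝ} (hcc : c ≤ c') (hv : HasContourIntegral c F v)
    (hF : DifferentiableOn ℂ F (leftHalfPlane c))
    (ho : Tendsto F (leftInfty c ⊓ 𝓟 {z | -c' ≤ z.re}) (𝓝 0)) : HasContourIntegral c' F v := by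
  have hcont := continuous_vertical (hF.mono (leftHalfPlane_anti hcc)).continuousOn
  refine ⟨fun a b => hcont.intervalIntegrable a b, ?_⟩
  have hsides := (tendsto_sub_of_tendsto_cobounded (tendsto_integral_horizontal hcc ho)).const_smul
    (1 / (2 * (Real.pi : ℂ) * I))
  have hdiff := hv.2.sub hsides
  rw [smul_zero, sub_zero] at hdiff
  refine hdiff.congr fun r => ?_
  have hre : -c - (c' - c) = -c' := by ring
  have hre' : -(c : ℂ) - ((c' - c : ℝ) : ℂ) = -(c' : ℂ) := by push_cast; ring
  rw [← smul_sub, integral_vertical_eq_rect hF (sub_nonneg.2 hcc), hre, hre', add_sub_cancel_left]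

end Closing

section DecaysLeft

variable {V : Type*} [NormedAddCommGroup V] [NormedSpace ℂ V]
variable {W : Type*} [NormedAddCommGroup W] [NormedSpace ℂ W]

/-- Holomorphic functions on the half-plane left of `iℝ - c` that vanish at infinity there, and with
rate `1 / x` along the negative real axis. These are the functions `f` for which the contour of
`f(l) / (z - l)` can be closed to the left. -/
structure DecaysLeft (c : ℝ) (f : ℂ → V) : Prop where
  differentiableOn : DifferentiableOn ℂ f (leftHalfPlane c)
  tendsto : Tendsto f (leftInfty c) (𝓝 0)
  ray : ∃ C : ℝ, ∀ᶠ x : ℝ in atTop, ‖f (-(x : ℂ))‖ ≤ C / x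

variable {c : ℝ} {f : ℂ → V} {z : ℂ}

namespace DecaysLeft

lemma mono {c' : ℝ} (hf : DecaysLeft c f) (h : c ≤ c') : DecaysLeft c' f :=
  ⟨hf.differentiableOn.mono (leftHalfPlane_anti h), hf.tendsto.mono_left (leftInfty_anti h), hf.ray⟩

lemma map (hf : DecaysLeft c f) (L : V →L[ℂ] W) : DecaysLeft c (fun z => L (f z)) := by
  refine ⟨L.differentiable.comp_differentiableOn hf.differentiableOn, ?_, ?_⟩
  · simpa [Function.comp_def] using (L.continuous.tendsto 0).comp hf.tendsto
  · obtain ⟨C, hC⟩ := hf.ray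
    refine ⟨‖L‖ * C, hC.mono fun x hx => (L.le_opNorm _).trans ?_⟩
    rw [mul_div_assoc]
    gcongr

lemma add {g : ℂ → V} (hf : DecaysLeft c f) (hg : DecaysLeft c g) :
    DecaysLeft c (fun z => f z + g z) := by
  refine ⟨hf.differentiableOn.add hg.differentiableOn, by simpa using hf.tendsto.add hg.tendsto, ?_⟩
  obtain ⟨C, hC⟩ := hf.ray
  obtain ⟨D, hD⟩ := hg.ray
  refine ⟨C + D, ?_⟩
  filter_upwards [hC, hD] with x hx hy
  rw [add_div]
  exact norm_add_le_of_le hx hy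

lemma congr {g : ℂ → V} (hf : DecaysLeft c f) (h : ∀ z ∈ leftHalfPlane c, f z = g z) :
    DecaysLeft c g := by
  refine ⟨hf.differentiableOn.congr fun z hz => (h z hz).symm,
    hf.tendsto.congr' (eventually_mem_leftHalfPlane.mono h), ?_⟩
  obtain ⟨C, hC⟩ := hf.ray
  refine ⟨C, ?_⟩
  filter_upwards [hC, eventually_ge_atTop c] with x hx hcx
  rwa [← h _ (by simpa [leftHalfPlane] using hcx)]

lemma exists_bound (hf : DecaysLeft c f) :
    ∃ M : ℝ, 0 ≤ M ∧ ∀ z ∈ leftHalfPlane c, ‖f z‖ ≤ M := by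
  obtain ⟨N, -, hN⟩ := eventually_leftInfty.1 (Metric.tendsto_nhds.1 hf.tendsto 1 one_pos)
  obtain ⟨M, hM⟩ := ((isCompact_closedBall (0 : ℂ) N).inter_right
    (isClosed_leftHalfPlane c)).exists_bound_of_continuousOn
    (hf.differentiableOn.continuousOn.mono inter_subset_right)
  refine ⟨max 1 M, by positivity, fun z hz => ?_⟩
  rcases le_total N ‖z‖ with hNz | hzN
  · have hz1 := hN z hz hNz
    rw [dist_zero_right] at hz1
    exact hz1.le.trans (le_max_left _ _)
  · exact (hM z ⟨by simpa using hzN, hz⟩).trans (le_max_right _ _)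

lemma norm_ray_le (hf : DecaysLeft c f) :
    ∃ C : ℝ, 0 ≤ C ∧ ∀ᶠ x : ℝ in atTop, ‖f (-(c : ℂ) - x)‖ ≤ C / (x / 2) := by
  obtain ⟨C, hC⟩ := hf.ray
  refine ⟨|C|, abs_nonneg C, ?_⟩
  filter_upwards [(tendsto_atTop_add_const_left _ c tendsto_id).eventually hC,
    eventually_ge_atTop (2 * |c|), eventually_gt_atTop 0] with x hx hcx hx0
  have hneg : -(((c + id x : ℝ)) : ℂ) = -(c : ℂ) - x := by simp only [id]; push_cast; ring
  have hhalf : x / 2 ≤ c + id x := by simp only [id]; linarith [neg_abs_le c]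
  rw [hneg] at hx
  calc _ ≤ C / (c + id x) := hx
    _ ≤ |C| / (x / 2) := by gcongr; exact le_abs_self C

end DecaysLeft

lemma integrableOn_Ioi_of_norm_le_div_sq {X : Type*} [NormedAddCommGroup X] {φ : ℝ → X} {C : ℝ}
    (hφ : ContinuousOn φ (Ici 0)) (hC : ∀ᶠ x in atTop, ‖φ x‖ ≤ C / x ^ 2) :
    IntegrableOn φ (Ioi 0) := by
  rw [← integrableOn_Ici_iff_integrableOn_Ioi]
  refine (hφ.locallyIntegrableOn measurableSet_Ici).integrableOn_of_isBigO_atTop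
    (g := fun x : ℝ => x ^ (-2 : ℝ)) (Asymptotics.IsBigO.of_bound C ?_)
    ⟨Ioi 1, Ioi_mem_atTop 1, integrableOn_Ioi_rpow_of_lt (by norm_num) one_pos⟩
  filter_upwards [hC, eventually_gt_atTop 0] with x hx hx0
  rwa [Real.rpow_neg hx0.le, Real.norm_of_nonneg (by positivity), Real.rpow_two, ← div_eq_mul_inv]

namespace DecaysLeft

lemma integrableOn_ray_of_le (hf : DecaysLeft c f) {M : ℝ} {G : ℂ → V}
    (hG : ContinuousOn G (leftHalfPlane c))
    (hle : ∀ᶠ l in leftInfty c, ‖G l‖ ≤ M * (‖f l‖ / ‖l‖ + 1 / ‖l‖ ^ 2)) :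
    IntegrableOn (fun x : ℝ => G (-(c : ℂ) - x)) (Ioi 0) := by
  obtain ⟨C, hC, hfC⟩ := hf.norm_ray_le
  refine integrableOn_Ioi_of_norm_le_div_sq (C := |M| * (4 * C + 4)) (continuousOn_ray hG) ?_
  filter_upwards [(tendsto_ray_leftInfty c).eventually hle, hfC, eventually_gt_atTop 0,
    eventually_ge_atTop (2 * |c|)] with x hGx hfx hx0 hcx
  have hnorm : x / 2 ≤ ‖-(c : ℂ) - x‖ := by linarith [sub_abs_le_norm_neg_sub c x]
  calc _ ≤ M * (‖f (-(c : ℂ) - x)‖ / ‖-(c : ℂ) - x‖ + 1 / ‖-(c : ℂ) - x‖ ^ 2) := hGx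
    _ ≤ |M| * (C / (x / 2) / (x / 2) + 1 / (x / 2) ^ 2) := by gcongr; exact le_abs_self M
    _ = _ := by field_simp; ring

lemma hasContourIntegral_zero_of_le (hf : DecaysLeft c f) {M : ℝ} {G : ℂ → V}
    (hG : DifferentiableOn ℂ G (leftHalfPlane c))
    (hle : ∀ᶠ l in leftInfty c, ‖G l‖ ≤ M * (‖f l‖ / ‖l‖ + 1 / ‖l‖ ^ 2)) :
    HasContourIntegral c G 0 := by
  refine hasContourIntegral_zero_of_decay hG ?_ (hf.integrableOn_ray_of_le hG.continuousOn hle)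
  have hlim : Tendsto (fun l => M * (‖f l‖ + ‖l‖⁻¹)) (leftInfty c) (𝓝 0) := by
    simpa using ((hf.tendsto.norm).add (tendsto_norm_leftInfty c).inv_tendsto_atTop).const_mul M
  refine squeeze_zero' (Eventually.of_forall fun l => by positivity) ?_ hlim
  filter_upwards [hle, (tendsto_norm_leftInfty c).eventually_gt_atTop 0] with l hl hl0
  calc ‖l‖ * ‖G l‖ ≤ ‖l‖ * (M * (‖f l‖ / ‖l‖ + 1 / ‖l‖ ^ 2)) := by gcongr
    _ = M * (‖f l‖ + ‖l‖⁻¹) := by field_simp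

lemma hasContourIntegral_cauchy_of_right (hf : DecaysLeft c f) (hz : -c < z.re) :
    HasContourIntegral c (fun l => (z - l)⁻¹ • f l) 0 := by
  refine hf.hasContourIntegral_zero_of_le (M := 2)
    ((differentiableOn_inv_sub hz).smul hf.differentiableOn) ?_
  filter_upwards [eventually_norm_inv_sub_le c z] with l hl
  calc ‖(z - l)⁻¹ • f l‖ ≤ 2 / ‖l‖ * ‖f l‖ := by rw [norm_smul]; gcongr
    _ = 2 * (‖f l‖ / ‖l‖ + 0) := by ring
    _ ≤ 2 * (‖f l‖ / ‖l‖ + 1 / ‖l‖ ^ 2) := by gcongr; positivity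

lemma hasContourIntegral_inv_smul (hc : 0 < c) (hf : DecaysLeft c f) :
    HasContourIntegral c (fun z => z⁻¹ • f z) 0 := by
  have hpole := (hf.hasContourIntegral_cauchy_of_right (z := 0) (by simpa using hc)).neg
  rw [neg_zero] at hpole
  refine hpole.congr fun l _ => ?_
  rw [zero_sub, inv_neg, neg_smul, neg_neg]

end DecaysLeft

lemma inv_sub_inv_mirror_eq (c y s : ℝ) {d : ℝ} (hd : 0 < d) :
    ((-c - d + y * I : ℂ) - (-(c : ℂ) + s * I))⁻¹ -
      ((-c + d + y * I : ℂ) - (-(c : ℂ) + s * I))⁻¹ =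
      (((-2 / d) * (1 + ((y - s) / d) ^ 2)⁻¹ : ℝ) : ℂ) := by
  have left_ne : (-c - d + y * I : ℂ) - (-(c : ℂ) + s * I) ≠ 0 := fun h => by
    have hre : -c - d - -c = 0 := by simpa using congrArg Complex.re h
    linarith
  have right_ne : (-c + d + y * I : ℂ) - (-(c : ℂ) + s * I) ≠ 0 := fun h => by
    have hre : -c + d - -c = 0 := by simpa using congrArg Complex.re h
    linarith
  have poisson_ne : (1 + (((y : ℂ) - s) / d) ^ 2) ≠ 0 := by
    have : (1 + ((y - s) / d) ^ 2 : ℝ) ≠ 0 := by positivity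
    exact_mod_cast this
  have hd' : (d : ℂ) ≠ 0 := by exact_mod_cast hd.ne'
  push_cast
  rw [inv_sub_inv left_ne right_ne, eq_comm, ← div_eq_mul_inv, div_div,
    div_eq_div_iff (mul_ne_zero hd' poisson_ne) (mul_ne_zero left_ne right_ne)]
  field_simp
  ring_nf
  simp only [Complex.I_sq]
  ring

/- A single Cauchy kernel is only conditionally integrable on the contour; its difference with the
kernel of the mirror image of the pole is a Poisson kernel. -/
lemma hasContourIntegral_inv_sub_inv_mirror (c y : ℝ) {d : ℝ} (hd : 0 < d) :
    HasContourIntegral c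
      (fun l : ℂ => ((-c - d + y * I : ℂ) - l)⁻¹ - ((-c + d + y * I : ℂ) - l)⁻¹) (-1) := by
  have hint : Integrable fun s : ℝ => (-2 / d) * (1 + ((y - s) / d) ^ 2)⁻¹ :=
    ((integrable_inv_one_add_sq.comp_div hd.ne').comp_sub_left y).const_mul _
  convert hasContourIntegral_of_integrable (c := c)
    (F := fun l : ℂ => ((-c - d + y * I : ℂ) - l)⁻¹ - ((-c + d + y * I : ℂ) - l)⁻¹)
    (by simp only [inv_sub_inv_mirror_eq c y _ hd]; exact hint.ofReal) using 1
  simp only [inv_sub_inv_mirror_eq c y _ hd, integral_smul]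
  rw [integral_complex_ofReal, integral_const_mul,
    integral_sub_left_eq_self (fun u : ℝ => (1 + (u / d) ^ 2)⁻¹) volume y,
    Measure.integral_comp_div (fun u : ℝ => (1 + u ^ 2)⁻¹) d, integral_univ_inv_one_add_sq,
    abs_of_pos hd]
  have hd' : (d : ℂ) ≠ 0 := by exact_mod_cast hd.ne'
  have hpi : (Real.pi : ℂ) ≠ 0 := by exact_mod_cast Real.pi_ne_zero
  simp only [smul_eq_mul]
  push_cast
  field_simp [Complex.I_ne_zero]

lemma neg_dslope_eq_inv_sub_smul (f : ℂ → V) {l : ℂ} (hl : l ≠ z) :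
    -dslope f z l = (z - l)⁻¹ • (f l - f z) := by
  rw [dslope_of_ne _ hl, slope_def_module, ← neg_sub z l, inv_neg, neg_smul, neg_neg]

lemma hasContourIntegral_dslope_zero [CompleteSpace V] (hf : DecaysLeft c f) (hz : z.re < -c)
    {m : ℂ} (hm : -c < m.re) :
    HasContourIntegral c (fun l => -dslope f z l + (m - l)⁻¹ • f z) 0 := by
  have hmem : leftHalfPlane c ∈ 𝓝 z :=
    mem_of_superset ((isOpen_Iio.preimage Complex.continuous_re).mem_nhds hz)
      fun w (hw : w.re < -c) => hw.le
  refine hf.hasContourIntegral_zero_of_le (M := 2 + 4 * ‖z - m‖ * ‖f z‖)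
    (((Complex.differentiableOn_dslope hmem).2 hf.differentiableOn).neg.add
      ((differentiableOn_inv_sub hm).smul_const _)) ?_
  filter_upwards [eventually_norm_inv_sub_le c z, eventually_norm_inv_sub_le c m,
    (tendsto_norm_leftInfty c).eventually_gt_atTop (‖z‖ + ‖m‖)] with l hlz hlm hl
  have hzl : z - l ≠ 0 := fun h => by
    rw [← sub_eq_zero.1 h] at hl
    linarith [norm_nonneg m]
  have hml : m - l ≠ 0 := fun h => by
    rw [← sub_eq_zero.1 h] at hl
    linarith [norm_nonneg z]
  have split : -dslope f z l + (m - l)⁻¹ • f z =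
      (z - l)⁻¹ • f l + ((z - m) * (m - l)⁻¹ * (z - l)⁻¹) • f z := by
    rw [neg_dslope_eq_inv_sub_smul f (sub_ne_zero.1 hzl).symm]
    match_scalars <;> field_simp
    ring
  calc _ ≤ 2 / ‖l‖ * ‖f l‖ + ‖z - m‖ * (2 / ‖l‖) * (2 / ‖l‖) * ‖f z‖ := by
        rw [split]
        refine norm_add_le_of_le ?_ ?_
        · rw [norm_smul]; gcongr
        · rw [norm_smul, norm_mul, norm_mul]; gcongr
    _ = 2 * (‖f l‖ / ‖l‖) + 4 * ‖z - m‖ * ‖f z‖ * (1 / ‖l‖ ^ 2) := by ring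
    _ ≤ (2 + 4 * ‖z - m‖ * ‖f z‖) * (‖f l‖ / ‖l‖) +
        (2 + 4 * ‖z - m‖ * ‖f z‖) * (1 / ‖l‖ ^ 2) := by
      gcongr
      · exact le_add_of_nonneg_right (by positivity)
      · exact le_add_of_nonneg_left (by positivity)
    _ = _ := (mul_add _ _ _).symm

lemma DecaysLeft.hasContourIntegral_cauchy_of_left [CompleteSpace V] (hf : DecaysLeft c f)
    (hz : z.re < -c) : HasContourIntegral c (fun l => (z - l)⁻¹ • f l) (-f z) := by
  set d : ℝ := -c - z.re with hd
  have hd0 : 0 < d := by linarith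
  have hzd : (-c - d + z.im * I : ℂ) = z := by
    conv_rhs => rw [← Complex.re_add_im z]
    rw [hd]; push_cast; ring
  have hmirror := (hasContourIntegral_inv_sub_inv_mirror c z.im hd0).map
    (ContinuousLinearMap.toSpanSingleton ℂ (f z))
  have hsum := (hasContourIntegral_dslope_zero hf hz (m := -c + d + z.im * I)
    (by simpa using hd0)).add hmirror
  simp only [hzd, ContinuousLinearMap.toSpanSingleton_apply, zero_add, neg_smul, one_smul] at hsum
  refine hsum.congr fun l hl => ?_
  rw [neg_dslope_eq_inv_sub_smul f (by rintro rfl; linarith)]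
  module

end DecaysLeft

/-! ### Integrable majorants -/

section Majorants

lemma integrable_vertical_of_norm_le {V : Type*} [NormedAddCommGroup V] {c C : ℝ} {F : ℂ → V}
    (hF : Continuous fun s : ℝ => F (-(c : ℂ) + s * I))
    (hC : ∀ s : ℝ, ‖F (-(c : ℂ) + s * I)‖ ≤ C * (1 + s ^ 2)⁻¹) :
    Integrable fun s : ℝ => F (-(c : ℂ) + s * I) :=
  (integrable_inv_one_add_sq.const_mul C).mono' hF.aestronglyMeasurable (Eventually.of_forall hC)

lemma integrable_inv_one_add_abs_mul_sqrt :
    Integrable fun x : ℝ => ((1 + |x|) * √(1 + |x|))⁻¹ := by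
  refine (integrable_one_add_norm (E := ℝ) (μ := volume) (r := 3 / 2) (by norm_num)).congr
    (Eventually.of_forall fun x => ?_)
  have hx : 0 < 1 + |x| := by positivity
  simp only [Real.norm_eq_abs]
  rw [Real.rpow_neg hx.le, show (3 / 2 : ℝ) = 1 + 1 / 2 by norm_num, Real.rpow_add hx,
    Real.rpow_one, Real.sqrt_eq_rpow]

lemma inv_mul_mul_le_inv_mul_sqrt {p a b : ℝ} (hp : 0 < p) (ha : 0 < a) (hab : a ≤ b)
    (hpb : p ≤ b) : (p * a * b)⁻¹ ≤ (p * √p)⁻¹ * (a * √a)⁻¹ := by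
  have hsqrt : √p * √a ≤ b :=
    calc √p * √a ≤ √b * √b := by gcongr
      _ = b := Real.mul_self_sqrt (hp.le.trans hpb)
  rw [← mul_inv]
  refine inv_anti₀ (by positivity) ?_
  calc p * √p * (a * √a) = p * a * (√p * √a) := by ring
    _ ≤ p * a * b := by gcongr

lemma two_mul_abs_le_abs_sub_add_abs_add (s y : ℝ) : 2 * |s| ≤ |y - s| + |y + s| := by
  calc 2 * |s| = |(y + s) - (y - s)| := by
        rw [show y + s - (y - s) = 2 * s by ring, abs_mul, abs_two]
    _ ≤ |y - s| + |y + s| := by linarith [abs_sub (y + s) (y - s)]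

lemma inv_one_add_abs_mul_sub_mul_add_le (s y : ℝ) :
    ((1 + |s|) * (1 + |y - s|) * (1 + |y + s|))⁻¹ ≤ (1 + s ^ 2)⁻¹ := by
  have hprod : 1 + |s| ≤ (1 + |y - s|) * (1 + |y + s|) := by
    nlinarith [two_mul_abs_le_abs_sub_add_abs_add s y, abs_nonneg (y - s), abs_nonneg (y + s),
      abs_nonneg s]
  refine inv_anti₀ (by positivity) ?_
  calc 1 + s ^ 2 ≤ (1 + |s|) * (1 + |s|) := by nlinarith [abs_nonneg s, sq_abs s]
    _ ≤ (1 + |s|) * ((1 + |y - s|) * (1 + |y + s|)) := by gcongr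
    _ = _ := (mul_assoc _ _ _).symm

lemma integrable_inv_one_add_abs_mul_sub_mul_add :
    Integrable (fun q : ℝ × ℝ => ((1 + |q.1|) * (1 + |q.2 - q.1|) * (1 + |q.2 + q.1|))⁻¹)
      (volume.prod volume) := by
  set φ : ℝ → ℝ := fun x => ((1 + |x|) * √(1 + |x|))⁻¹ with hφ
  have hφφ := integrable_inv_one_add_abs_mul_sqrt.mul_prod integrable_inv_one_add_abs_mul_sqrt
  have hsub : Integrable (fun q : ℝ × ℝ => φ q.1 * φ (q.2 - q.1)) (volume.prod volume) :=
    (measurePreserving_prod_sub volume volume).integrable_comp_of_integrable hφφ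
  have hadd : Integrable (fun q : ℝ × ℝ => φ q.1 * φ (q.2 + q.1)) (volume.prod volume) :=
    (measurePreserving_prod_add_right volume volume).integrable_comp_of_integrable hφφ
  refine (hsub.add hadd).mono' (by fun_prop) (Eventually.of_forall fun ⟨s, y⟩ => ?_)
  simp only [Pi.add_apply, hφ]
  rw [Real.norm_of_nonneg (by positivity)]
  -- The larger of `|y - s|` and `|y + s|` is at least `|s|`, so it pays half a power to each of the
  -- other two factors.
  have hs := two_mul_abs_le_abs_sub_add_abs_add s y
  rcases le_total |y - s| |y + s| with hle | hle
  · refine (inv_mul_mul_le_inv_mul_sqrt (by positivity) (by positivity) (by linarith)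
      (by linarith)).trans (le_add_of_nonneg_right (by positivity))
  · rw [mul_right_comm]
    refine (inv_mul_mul_le_inv_mul_sqrt (by positivity) (by positivity) (by linarith)
      (by linarith)).trans (le_add_of_nonneg_left (by positivity))

end Majorants

/-! ### Resolvents of the two first-order factors -/

section AbstractWave

variable {Y : Type*} [NormedAddCommGroup Y] [NormedSpace ℂ Y]

/-- `(ε √A - z)⁻¹` for `ε = ±i`, expressed by `J = A^{-1/2}` and `S z = (A + z²)⁻¹`. -/
def halfResolvent (J : Y →L[ℂ] Y) (S : ℂ → Y →L[ℂ] Y) (ε z : ℂ) : Y →L[ℂ] Y :=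
  -(ε • (J - z ^ 2 • (J * S z)) + z • S z)

section Algebra

variable {J : Y →L[ℂ] Y} {S : ℂ → Y →L[ℂ] Y} {ε z : ℂ}

lemma halfResolvent_apply (ε z : ℂ) (y : Y) :
    halfResolvent J S ε z y = -(ε • (J y - z ^ 2 • J (S z y)) + z • S z y) := by
  simp [halfResolvent]

lemma halfResolvent_mul_sub (hε : ε * ε = -1) (hc : S z * J = J * S z)
    (hS : S z = J * J - z ^ 2 • (J * (J * S z))) :
    halfResolvent J S ε z * (ε • 1 - z • J) = J := by
  simp only [halfResolvent, sub_mul, add_mul, mul_sub, neg_mul, mul_one, smul_mul_assoc,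
    mul_smul_comm, mul_assoc, hc]
  linear_combination (norm := module) (-(ε * z)) • hS - hε • (J - z ^ 2 • (J * S z))

lemma halfResolvent_mul_eq (hc : S z * J = J * S z)
    (hS : S z = J * J - z ^ 2 • (J * (J * S z))) :
    halfResolvent J S ε z * J = -(ε • S z) - z • (S z * J) := by
  simp only [halfResolvent, sub_mul, add_mul, neg_mul, smul_mul_assoc, mul_assoc, hc]
  linear_combination (norm := module) ε • hS

lemma halfResolvent_eq_mul (hS : S z = J * J - z ^ 2 • (J * (J * S z))) :
    halfResolvent J S ε z =
      J * (-(ε • (1 - z ^ 2 • S z) + z • (J - z ^ 2 • (J * S z)))) := by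
  simp only [halfResolvent, mul_sub, mul_add, mul_neg, mul_one, mul_smul_comm]
  linear_combination (norm := module) (-z) • hS

lemma halfResolvent_mul_neg (hε : ε * ε = -1) (hc : S z * J = J * S z)
    (hS : S z = J * J - z ^ 2 • (J * (J * S z))) :
    halfResolvent J S ε z * halfResolvent J S (-ε) z = S z := by
  have hS2 : S z * S z = J * (J * S z) - z ^ 2 • (J * (J * (S z * S z))) := by
    conv_lhs => rw [hS]
    simp only [sub_mul, smul_mul_assoc, mul_assoc]
    rw [← hS]
  have hcl (X : Y →L[ℂ] Y) : S z * (J * X) = J * (S z * X) := by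
    rw [← mul_assoc, hc, mul_assoc]
  simp only [halfResolvent, mul_sub, sub_mul, add_mul, mul_add, mul_neg, neg_mul, mul_smul_comm,
    smul_mul_assoc, mul_assoc, hc, hcl]
  linear_combination (norm := module) z ^ 2 • hS2 - hS -
    hε • (J * J - (2 * z ^ 2) • (J * (J * S z)) + z ^ 4 • (J * (J * (S z * S z))))

end Algebra

/-- Commuting families in a Banach space with the properties of `J = A^{-1/2}`,
`S z = (A + z²)⁻¹` for `Re z ≤ -c`, and `b z = (B + z)⁻¹`. -/
structure WaveResolvents (c : ℝ) (J : Y →L[ℂ] Y) (S b : ℂ → Y →L[ℂ] Y) : Prop where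
  pos : 0 < c
  J_injective : Function.Injective J
  S_eq : ∀ z ∈ leftHalfPlane c, S z = J * J - z ^ 2 • (J * (J * S z))
  S_mul_J : ∀ z ∈ leftHalfPlane c, S z * J = J * S z
  S_comm : ∀ z ∈ leftHalfPlane c, ∀ w ∈ leftHalfPlane c, S z * S w = S w * S z
  S_decays : DecaysLeft c S
  SJ_decays : DecaysLeft c (fun z => z • (S z * J))
  b_mul_J : ∀ z, b z * J = J * b z
  b_mul_S : ∀ z, ∀ w ∈ leftHalfPlane c, b z * S w = S w * b z
  b_resolvent : ∀ z w, b z - b w = (w - z) • (b z * b w)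
  b_differentiable : Differentiable ℂ b
  b_bound : ∀ r : ℝ, ∃ M : ℝ, 0 ≤ M ∧ ∀ z : ℂ, -r ≤ z.re → ‖b z‖ ≤ M

namespace WaveResolvents

variable {c : ℝ} {J : Y →L[ℂ] Y} {S b : ℂ → Y →L[ℂ] Y}

lemma mono {c' : ℝ} (h : WaveResolvents c J S b) (hc : c ≤ c') : WaveResolvents c' J S b where
  __ := h
  pos := h.pos.trans_le hc
  S_eq z hz := h.S_eq z (leftHalfPlane_anti hc hz)
  S_mul_J z hz := h.S_mul_J z (leftHalfPlane_anti hc hz)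
  S_comm z hz w hw := h.S_comm z (leftHalfPlane_anti hc hz) w (leftHalfPlane_anti hc hw)
  S_decays := h.S_decays.mono hc
  SJ_decays := h.SJ_decays.mono hc
  b_mul_S z w hw := h.b_mul_S z w (leftHalfPlane_anti hc hw)

variable (h : WaveResolvents c J S b)
include h

lemma ne_zero {z : ℂ} (hz : z ∈ leftHalfPlane c) : z ≠ 0 := by
  rintro rfl
  have hc : (0 : ℝ) ≤ -c := hz
  linarith [h.pos]

lemma add_ne_zero {z l : ℂ} (hz : z ∈ leftHalfPlane c) (hl : l ∈ leftHalfPlane c) :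
    z + l ≠ 0 := fun h0 => by
  have hre : z.re + l.re = 0 := congrArg Complex.re h0
  have hz' : z.re ≤ -c := hz
  have hl' : l.re ≤ -c := hl
  linarith [h.pos]

lemma b_comm_apply (z w : ℂ) (y : Y) : b z (b w y) = b w (b z y) := by
  rcases eq_or_ne z w with rfl | hne
  · rfl
  · refine smul_right_injective Y (sub_ne_zero.2 hne.symm) ?_
    have hzw : b z y - b w y = (w - z) • b z (b w y) := DFunLike.congr_fun (h.b_resolvent z w) y
    have hwz : b w y - b z y = (z - w) • b w (b z y) := DFunLike.congr_fun (h.b_resolvent w z) y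
    linear_combination (norm := module) -hzw - hwz

lemma smul_b_zero (z : ℂ) (y : Y) : z • b z (b 0 y) = b 0 y - b z y := by
  have hres : b z y - b 0 y = (0 - z) • b z (b 0 y) := DFunLike.congr_fun (h.b_resolvent z 0) y
  linear_combination (norm := module) hres

lemma b_b_zero {z : ℂ} (hz : z ≠ 0) (y : Y) : b z (b 0 y) = z⁻¹ • (b 0 y - b z y) := by
  rw [← h.smul_b_zero, inv_smul_smul₀ hz]

lemma b_zero_sub (z : ℂ) (y : Y) : b 0 (y - z • b z y) = b z y := by
  rw [map_sub, map_smul, ← h.b_comm_apply z 0, h.smul_b_zero, sub_sub_cancel]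

lemma b_zero_eq_sub (z : ℂ) {x xB : Y} (hB : x = b 0 (b 0 xB)) :
    b z (b 0 xB) = x - z • b z x := by
  rw [hB, h.smul_b_zero z (b 0 xB), sub_sub_cancel]

lemma b_J_apply (z : ℂ) (y : Y) : b z (J y) = J (b z y) := DFunLike.congr_fun (h.b_mul_J z) y

lemma S_J_apply {z : ℂ} (hz : z ∈ leftHalfPlane c) (y : Y) : S z (J y) = J (S z y) :=
  DFunLike.congr_fun (h.S_mul_J z hz) y

lemma b_S_apply (z : ℂ) {w : ℂ} (hw : w ∈ leftHalfPlane c) (y : Y) :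
    b z (S w y) = S w (b z y) :=
  DFunLike.congr_fun (h.b_mul_S z w hw) y

lemma b_halfResolvent (ε w : ℂ) {z : ℂ} (hz : z ∈ leftHalfPlane c) (y : Y) :
    b w (halfResolvent J S ε z y) = halfResolvent J S ε z (b w y) := by
  simp only [halfResolvent_apply, map_neg, map_add, map_sub, map_smul, h.b_J_apply,
    h.b_S_apply w hz]

lemma halfResolvent_J (ε : ℂ) {z : ℂ} (hz : z ∈ leftHalfPlane c) (y : Y) :
    halfResolvent J S ε z (J y) = J (halfResolvent J S ε z y) := by
  simp only [halfResolvent_apply, map_neg, map_add, map_sub, map_smul, h.S_J_apply hz]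

lemma halfResolvent_comm (ε δ : ℂ) {z w : ℂ} (hz : z ∈ leftHalfPlane c)
    (hw : w ∈ leftHalfPlane c) (y : Y) : halfResolvent J S ε z (halfResolvent J S δ w y) =
      halfResolvent J S δ w (halfResolvent J S ε z y) := by
  have hS (y : Y) : S z (S w y) = S w (S z y) := DFunLike.congr_fun (h.S_comm z hz w hw) y
  simp only [halfResolvent_apply, map_neg, map_add, map_sub, map_smul, h.S_J_apply hz,
    h.S_J_apply hw, hS]
  module

lemma halfResolvent_smul {ε : ℂ} (hε : ε * ε = -1) {z : ℂ} (hz : z ∈ leftHalfPlane c) (y : Y) :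
    halfResolvent J S ε z (ε • y) = J y + z • J (halfResolvent J S ε z y) := by
  have happly : halfResolvent J S ε z (ε • y - z • J y) = J y :=
    DFunLike.congr_fun (halfResolvent_mul_sub hε (h.S_mul_J z hz) (h.S_eq z hz)) y
  rw [← happly, map_sub, map_smul _ z, h.halfResolvent_J ε hz, sub_add_cancel]

lemma halfResolvent_neg {ε : ℂ} (hε : ε * ε = -1) {z : ℂ} (hz : z ∈ leftHalfPlane c) (y : Y) :
    halfResolvent J S ε z (halfResolvent J S (-ε) z y) = S z y :=
  DFunLike.congr_fun (halfResolvent_mul_neg hε (h.S_mul_J z hz) (h.S_eq z hz)) y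

lemma halfResolvent_resolvent {ε : ℂ} (hε : ε * ε = -1) {z l : ℂ} (hz : z ∈ leftHalfPlane c)
    (hl : l ∈ leftHalfPlane c) (y : Y) :
    halfResolvent J S ε z (halfResolvent J S (-ε) l y) =
      -(z + l)⁻¹ • (halfResolvent J S ε z y + halfResolvent J S (-ε) l y) := by
  have hεz := congrArg (halfResolvent J S (-ε) l) (h.halfResolvent_smul hε hz y)
  have hεl := congrArg (halfResolvent J S ε z)
    (h.halfResolvent_smul (ε := -ε) (by rwa [neg_mul_neg]) hl y)
  have hsum : -(z + l) • halfResolvent J S ε z (halfResolvent J S (-ε) l y) =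
      halfResolvent J S ε z y + halfResolvent J S (-ε) l y := by
    refine h.J_injective ?_
    simp only [map_add, map_smul, h.halfResolvent_J ε hz, h.halfResolvent_J (-ε) hl,
      h.halfResolvent_comm (-ε) ε hl hz] at hεz hεl ⊢
    linear_combination (norm := module) hεz + hεl
  rw [← hsum, smul_smul, neg_mul_neg, inv_mul_cancel₀ (h.add_ne_zero hz hl), one_smul]

lemma halfResolvent_mul_J_decays (ε : ℂ) :
    DecaysLeft c (fun z => halfResolvent J S ε z * J) := by
  have hS := h.S_decays.map ((-ε) • ContinuousLinearMap.id ℂ (Y →L[ℂ] Y))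
  have hSJ := h.SJ_decays.map (-ContinuousLinearMap.id ℂ (Y →L[ℂ] Y))
  refine (hS.add hSJ).congr fun z hz => ?_
  rw [halfResolvent_mul_eq (h.S_mul_J z hz) (h.S_eq z hz)]
  simp [sub_eq_add_neg]

lemma halfResolvent_J_decays (ε : ℂ) (y : Y) :
    DecaysLeft c (fun z => halfResolvent J S ε z (J y)) :=
  (h.halfResolvent_mul_J_decays ε).map (ContinuousLinearMap.apply ℂ Y y)

lemma S_decays_apply (y : Y) : DecaysLeft c (fun z => S z y) :=
  h.S_decays.map (ContinuousLinearMap.apply ℂ Y y)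

lemma norm_b_b_zero_le {r M : ℝ} (hM : ∀ z : ℂ, -r ≤ z.re → ‖b z‖ ≤ M) (q : Y) {z : ℂ}
    (hz : z ≠ 0) (hzr : -r ≤ z.re) : ‖b z (b 0 q)‖ ≤ (‖b 0 q‖ + M * ‖q‖) * ‖z‖⁻¹ := by
  rw [h.b_b_zero hz, norm_smul, norm_inv, mul_comm]
  gcongr
  exact norm_sub_le_of_le le_rfl ((b z).le_of_opNorm_le (hM z hzr) q)

lemma b_decays (r : ℝ) (q : Y) : DecaysLeft (-r) (fun z => b (-z) (b 0 q)) := by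
  obtain ⟨M, -, hM⟩ := h.b_bound r
  set C : ℝ := ‖b 0 q‖ + M * ‖q‖
  have hle (z : ℂ) (hz : z ∈ leftHalfPlane (-r)) (hz0 : z ≠ 0) :
      ‖b (-z) (b 0 q)‖ ≤ C * ‖z‖⁻¹ := by
    have hre : -r ≤ (-z).re := neg_le_neg (by simpa [leftHalfPlane] using hz)
    simpa only [norm_neg] using h.norm_b_b_zero_le hM q (neg_ne_zero.2 hz0) hre
  refine ⟨?_, ?_, C, ?_⟩
  · have hb : Differentiable ℂ fun z => b (-z) := h.b_differentiable.comp differentiable_neg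
    exact (hb.clm_apply (differentiable_const _)).differentiableOn
  · have hlim : Tendsto (fun z : ℂ => C * ‖z‖⁻¹) (leftInfty (-r)) (𝓝 0) := by
      simpa using (tendsto_norm_leftInfty (-r)).inv_tendsto_atTop.const_mul C
    refine squeeze_zero_norm' ?_ hlim
    filter_upwards [(tendsto_norm_leftInfty (-r)).eventually_gt_atTop 0,
      eventually_mem_leftHalfPlane] with z hz hzr
    exact hle z hzr (norm_pos_iff.1 hz)
  · filter_upwards [eventually_gt_atTop 0, eventually_ge_atTop (-r)] with x hx hxr
    have hmem : -(x : ℂ) ∈ leftHalfPlane (-r) := by simpa [leftHalfPlane, neg_le] using hxr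
    simpa [abs_of_pos hx, div_eq_mul_inv] using hle (-(x : ℂ)) hmem (by simpa using hx.ne')

lemma hasContourIntegral_inv_smul_b [CompleteSpace Y] (q : Y) :
    HasContourIntegral c (fun l => l⁻¹ • b l (b 0 q)) (-b 0 (b 0 q)) := by
  refine HasContourIntegral.of_reflect ?_
  have hpole := (h.b_decays c q).hasContourIntegral_cauchy_of_left (z := 0) (by simpa using h.pos)
  rw [neg_zero] at hpole
  refine hpole.congr fun z _ => ?_
  rw [zero_sub]

/-! ### Inversion of the wave operator by contour integrals -/

lemma halfResolvent_eq_add {ε l : ℂ} (hε : ε * ε = -1) (hl : l ∈ leftHalfPlane c) {x xA : Y}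
    (hA : x = J (J xA)) :
    halfResolvent J S ε l (ε • J xA) = x + l • halfResolvent J S ε l x := by
  rw [h.halfResolvent_smul hε hl, ← h.halfResolvent_J ε hl, ← hA]

/- Here `x = B⁻² xB = A⁻¹ xA`, so that `b 0 xB + ε • J xA` stands for `(B + ε √A) x` and the
identity is the partial fraction decomposition of `(ε √A - l)⁻¹ (B + l)⁻¹`. -/
lemma halfResolvent_b_apply_add {ε l : ℂ} (hε : ε * ε = -1) (hl : l ∈ leftHalfPlane c)
    {x xB xA : Y} (hB : x = b 0 (b 0 xB)) (hA : x = J (J xA)) :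
    halfResolvent J S ε l (b l (b 0 xB + ε • J xA)) = halfResolvent J S ε l x + b l x := by
  have hspace : halfResolvent J S ε l (b l (ε • J xA)) =
      b l x + l • halfResolvent J S ε l (b l x) := by
    rw [← h.b_halfResolvent ε l hl, h.halfResolvent_eq_add hε hl hA, map_add, map_smul,
      h.b_halfResolvent ε l hl]
  rw [map_add, map_add, hspace, h.b_zero_eq_sub l hB, map_sub, map_smul]
  abel

lemma hasContourIntegral_first_order [CompleteSpace Y] {ε : ℂ} (hε : ε * ε = -1) {x xB xA : Y}
    (hB : x = b 0 (b 0 xB)) (hA : x = J (J xA)) :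
    HasContourIntegral c (fun l => halfResolvent J S ε l (b l (b 0 xB + ε • J xA))) x := by
  have hspace := (h.halfResolvent_J_decays ε (ε • xA)).hasContourIntegral_inv_smul h.pos
  have hsum := hspace.sub (h.hasContourIntegral_inv_smul_b xB)
  rw [zero_sub, neg_neg, ← hB] at hsum
  refine hsum.congr fun l hl => ?_
  have hl' : l ∈ leftHalfPlane c := hl.le
  rw [h.halfResolvent_b_apply_add hε hl' hB hA, map_smul J, h.halfResolvent_eq_add hε hl' hA,
    h.b_zero_eq_sub l hB, smul_add, smul_sub, inv_smul_smul₀ (h.ne_zero hl'),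
    inv_smul_smul₀ (h.ne_zero hl')]
  abel

lemma hasContourIntegral_inner [CompleteSpace Y] {ε z : ℂ} (hε : ε * ε = -1)
    (hz : z ∈ leftHalfPlane c) {g w : Y} (hgw : b 0 g = J w) :
    HasContourIntegral c
      (fun l => halfResolvent J S ε z (halfResolvent J S (-ε) l (b z (b l (g - ε • w)))))
      (halfResolvent J S ε z (b z (b 0 g))) := by
  set R := halfResolvent J S ε z
  set P : Y →L[ℂ] Y := -(ε • (1 - z ^ 2 • S z) + z • (J - z ^ 2 • (J * S z)))
  have hRP (y : Y) : R y = J (P y) := DFunLike.congr_fun (halfResolvent_eq_mul (h.S_eq z hz)) y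
  have hB : R (b z (b 0 g)) = b 0 (b 0 (R (g - z • b z g))) := by
    rw [h.b_halfResolvent ε 0 hz, h.b_zero_sub, h.b_halfResolvent ε 0 hz, h.b_comm_apply]
  have hA : R (b z (b 0 g)) = J (J (P (b z w))) := by
    rw [hgw, h.b_J_apply, h.halfResolvent_J ε hz, ← hRP]
  refine (h.hasContourIntegral_first_order (ε := -ε) (by rwa [neg_mul_neg]) hB hA).congr
    fun l hl => ?_
  rw [h.b_halfResolvent ε 0 hz, h.b_zero_sub, ← hRP, neg_smul, ← map_smul R, ← map_smul (b z),
    ← sub_eq_add_neg, ← map_sub, ← map_sub, h.b_halfResolvent ε l hz,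
    ← h.halfResolvent_comm _ _ hz hl.le, h.b_comm_apply l z]

/- Here `u = B⁻² A^{-1/2} k = A^{-3/2} v`, so that `J k + J v` stands for `(B² + A) u`. -/
lemma hasDoubleContourIntegral_inversion [CompleteSpace Y] {c' : ℝ} (hc : c < c') {u k v : Y}
    (hu : u = b 0 (b 0 (J k))) (hv : u = J (J (J v))) :
    HasDoubleContourIntegral c' c (fun l z => halfResolvent J S I z
      (halfResolvent J S (-I) l (b z (b l (J k + J v))))) u := by
  have hk : b 0 (b 0 k) = J (J v) :=
    h.J_injective (by rw [← h.b_J_apply, ← h.b_J_apply, ← hu, hv])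
  have hgw : b 0 (J k + I • b 0 k) = J (b 0 k + I • J v) := by
    rw [map_add, map_smul, hk, h.b_J_apply, map_add, map_smul]
  have hsub : J k + I • b 0 k - I • (b 0 k + I • J v) = J k + J v := by
    linear_combination (norm := module) -(Complex.I_mul_I • J v)
  refine ⟨fun z => halfResolvent J S I z (b z (b 0 (J k) + I • J (J v))), fun z hz => ?_,
    (h.mono hc.le).hasContourIntegral_first_order Complex.I_mul_I hu hv⟩
  have hz' : z ∈ leftHalfPlane c := show z.re ≤ -c by linarith
  have hinner := h.hasContourIntegral_inner Complex.I_mul_I hz' hgw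
  rwa [hsub, map_add, map_smul, hk] at hinner

end WaveResolvents

end AbstractWave

/-! ### Reduction of the double contour integral to a single one -/

section AbstractReduction

lemma inv_norm_le_inv_one_add_abs_im {w : ℂ} {δ : ℝ} (hδ : 0 < δ) (hw : δ ≤ |w.re|) :
    ‖w‖⁻¹ ≤ (δ⁻¹ + 1) * (1 + |w.im|)⁻¹ := by
  have hδw : δ ≤ ‖w‖ := hw.trans (Complex.abs_re_le_norm w)
  have hone : 1 ≤ δ⁻¹ * ‖w‖ := by rwa [inv_mul_eq_div, one_le_div hδ]
  rw [← div_eq_mul_inv, le_div_iff₀ (by positivity), inv_mul_le_iff₀ (hδ.trans_le hδw)]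
  linarith [Complex.abs_im_le_norm w]

lemma integrable_vertical_of_norm_le_inv_sq {U : Type*} [NormedAddCommGroup U] {c C : ℝ}
    (hc : 0 < c) (hC0 : 0 ≤ C) {F : ℂ → U} (hF : Continuous fun s : ℝ => F (-(c : ℂ) + s * I))
    (hC : ∀ z : ℂ, z.re = -c → ‖F z‖ ≤ C * (‖z‖⁻¹ * ‖z‖⁻¹)) :
    Integrable fun s : ℝ => F (-(c : ℂ) + s * I) := by
  refine integrable_vertical_of_norm_le (C := C * ((c⁻¹ + 1) * (c⁻¹ + 1))) hF fun s => ?_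
  have hinv := inv_norm_le_inv_one_add_abs_im (w := -(c : ℂ) + s * I) hc (by simp [abs_of_pos hc])
  rw [show (-(c : ℂ) + s * I).im = s by simp] at hinv
  calc _ ≤ C * (‖-(c : ℂ) + s * I‖⁻¹ * ‖-(c : ℂ) + s * I‖⁻¹) := hC _ (by simp)
    _ ≤ C * (((c⁻¹ + 1) * (1 + |s|)⁻¹) * ((c⁻¹ + 1) * (1 + |s|)⁻¹)) := by gcongr
    _ = C * ((c⁻¹ + 1) * (c⁻¹ + 1)) * ((1 + |s|) ^ 2)⁻¹ := by field_simp
    _ ≤ _ := by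
      gcongr
      nlinarith [abs_nonneg s, sq_abs s]

lemma DecaysLeft.inv_smul {V : Type*} [NormedAddCommGroup V] [NormedSpace ℂ V] {c M : ℝ}
    (hc : 0 < c) {f : ℂ → V} (hf : DifferentiableOn ℂ f (leftHalfPlane c))
    (hM : ∀ z ∈ leftHalfPlane c, ‖f z‖ ≤ M) : DecaysLeft c fun z => z⁻¹ • f z := by
  have hle (z : ℂ) (hz : z ∈ leftHalfPlane c) : ‖z⁻¹ • f z‖ ≤ M * ‖z‖⁻¹ := by
    rw [norm_smul, norm_inv, mul_comm]
    gcongr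
    exact hM z hz
  refine ⟨(differentiableOn_id.inv fun z hz hz0 => ?_).smul hf, ?_, M, ?_⟩
  · have hre : (0 : ℂ).re ≤ -c := hz0 ▸ hz
    simp only [Complex.zero_re] at hre
    linarith
  · have hlim : Tendsto (fun z : ℂ => M * ‖z‖⁻¹) (leftInfty c) (𝓝 0) := by
      simpa using (tendsto_norm_leftInfty c).inv_tendsto_atTop.const_mul M
    exact squeeze_zero_norm' (eventually_mem_leftHalfPlane.mono hle) hlim
  · filter_upwards [eventually_ge_atTop c] with x hx
    refine (hle _ (by simpa [leftHalfPlane] using hx)).trans_eq ?_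
    simp [abs_of_pos (hc.trans_le hx), div_eq_mul_inv]

namespace WaveResolvents

variable {Y : Type*} [NormedAddCommGroup Y] [NormedSpace ℂ Y]
variable {c : ℝ} {J : Y →L[ℂ] Y} {S b : ℂ → Y →L[ℂ] Y} (h : WaveResolvents c J S b)
include h

lemma differentiableOn_halfResolvent (ε : ℂ) :
    DifferentiableOn ℂ (fun z => halfResolvent J S ε z) (leftHalfPlane c) := by
  have hS := h.S_decays.differentiableOn
  have hsq : DifferentiableOn ℂ (fun z : ℂ => z ^ 2) (leftHalfPlane c) := by fun_prop
  exact (((differentiableOn_const J).sub (hsq.smul (hS.const_mul J))).const_smul ε |>.add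
    (differentiableOn_id.smul hS)).neg

lemma exists_norm_b_le (r : ℝ) (k : Y) : ∃ M : ℝ, 0 ≤ M ∧
    ∀ z : ℂ, -r ≤ z.re → z ≠ 0 → ‖b z (b 0 k)‖ ≤ M * ‖z‖⁻¹ := by
  obtain ⟨M, hM0, hM⟩ := h.b_bound r
  exact ⟨_, by positivity, fun z hz hz0 => h.norm_b_b_zero_le hM k hz0 hz⟩

lemma differentiableOn_S_b (w : Y) :
    DifferentiableOn ℂ (fun z => S z (b z w)) (leftHalfPlane c) :=
  h.S_decays.differentiableOn.clm_apply
    (h.b_differentiable.clm_apply (differentiable_const w)).differentiableOn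

lemma exists_norm_S_b_le (r : ℝ) (k : Y) : ∃ M : ℝ, 0 ≤ M ∧ ∀ z ∈ leftHalfPlane c, -r ≤ z.re →
    ‖S z (b z (b 0 (J k)))‖ ≤ M * (‖z‖⁻¹ * ‖z‖⁻¹) := by
  obtain ⟨M, hM0, hM⟩ := h.exists_norm_b_le r k
  obtain ⟨N, hN0, hN⟩ := h.SJ_decays.exists_bound
  refine ⟨N * M, by positivity, fun z hz hzr => ?_⟩
  have hz0 := h.ne_zero hz
  have hSJ : ‖S z * J‖ ≤ N * ‖z‖⁻¹ := by
    rw [← div_eq_mul_inv, le_div_iff₀ (norm_pos_iff.2 hz0), mul_comm, ← norm_smul]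
    exact hN z hz
  rw [h.b_J_apply, h.b_J_apply]
  calc ‖S z (J (b z (b 0 k)))‖ ≤ ‖S z * J‖ * ‖b z (b 0 k)‖ := (S z * J).le_opNorm _
    _ ≤ (N * ‖z‖⁻¹) * (M * ‖z‖⁻¹) := by gcongr; exact hM z hzr hz0
    _ = _ := by ring

lemma hasContourIntegral_S_b_shift [CompleteSpace Y] {c' : ℝ} (hc : c ≤ c') {k v : Y}
    (hv : HasContourIntegral c (fun z => S z (b z (b 0 (J k)))) v) :
    HasContourIntegral c' (fun z => S z (b z (b 0 (J k)))) v := by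
  refine hv.shift hc (h.differentiableOn_S_b _) ?_
  obtain ⟨M, -, hM⟩ := h.exists_norm_S_b_le c' k
  have hinv : Tendsto (fun z : ℂ => ‖z‖⁻¹) (leftInfty c ⊓ 𝓟 {z | -c' ≤ z.re}) (𝓝 0) :=
    (tendsto_norm_leftInfty c).inv_tendsto_atTop.mono_left inf_le_left
  refine squeeze_zero_norm' ?_ (by simpa using (hinv.mul hinv).const_mul M)
  filter_upwards [mem_inf_of_right (mem_principal_self _),
    mem_inf_of_left (mem_inf_of_right (mem_principal_self _))] with z hzr hz
  exact hM z hz hzr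

end WaveResolvents

/-- The part of the kernel `y_{l,z}(w)` that carries `(B + l)⁻¹` after splitting
`(B + z)⁻¹ (B + l)⁻¹` by the resolvent identity; it is absolutely integrable in `(l, z)`. -/
def splitKernel {Y : Type*} [NormedAddCommGroup Y] [NormedSpace ℂ Y] (J : Y →L[ℂ] Y)
    (S b : ℂ → Y →L[ℂ] Y) (w : Y) (l z : ℂ) : Y :=
  (z - l)⁻¹ • halfResolvent J S I z (halfResolvent J S (-I) l (b l w))

namespace WaveResolvents

variable {Y : Type*} [NormedAddCommGroup Y] [NormedSpace ℂ Y]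
variable {c c' : ℝ} {J : Y →L[ℂ] Y} {S b : ℂ → Y →L[ℂ] Y} (h : WaveResolvents c J S b)
include h

lemma continuous_splitKernel (hc : c < c') (w : Y) :
    Continuous fun q : ℝ × ℝ =>
      splitKernel J S b w (-(c : ℂ) + q.1 * I) (-(c' : ℂ) + q.2 * I) := by
  have hz : Continuous fun q : ℝ × ℝ => halfResolvent J S I (-(c' : ℂ) + q.2 * I) :=
    (continuous_vertical
      ((h.mono hc.le).differentiableOn_halfResolvent I).continuousOn).comp continuous_snd
  have hl : Continuous fun q : ℝ × ℝ => halfResolvent J S (-I) (-(c : ℂ) + q.1 * I) :=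
    (continuous_vertical (h.differentiableOn_halfResolvent (-I)).continuousOn).comp continuous_fst
  have hb : Continuous fun q : ℝ × ℝ => b (-(c : ℂ) + q.1 * I) :=
    h.b_differentiable.continuous.comp (by fun_prop)
  refine Continuous.smul (Continuous.inv₀ (by fun_prop) fun q hq => ?_)
    (hz.clm_apply (hl.clm_apply (hb.clm_apply continuous_const)))
  have hre : -c' - -c = 0 := by simpa using congrArg Complex.re hq
  linarith

lemma exists_norm_halfResolvent_b_le (ε : ℂ) (k : Y) : ∃ M : ℝ, 0 ≤ M ∧ ∀ z ∈ leftHalfPlane c,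
    ∀ l : ℂ, l.re = -c → ‖halfResolvent J S ε z (b l (b 0 (J k)))‖ ≤ M * ‖l‖⁻¹ := by
  obtain ⟨M, hM0, hM⟩ := h.exists_norm_b_le c k
  obtain ⟨N, hN0, hN⟩ := (h.halfResolvent_mul_J_decays ε).exists_bound
  refine ⟨N * M, by positivity, fun z hz l hl => ?_⟩
  rw [h.b_J_apply, h.b_J_apply, mul_assoc]
  calc _ ≤ ‖halfResolvent J S ε z * J‖ * ‖b l (b 0 k)‖ :=
        (halfResolvent J S ε z * J).le_opNorm _
    _ ≤ N * (M * ‖l‖⁻¹) := by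
      gcongr
      · exact hN z hz
      · exact hM l hl.ge (h.ne_zero hl.le)

/- The factor `(z + l)⁻¹` gained from the resolvent identity makes the kernel integrable. -/
lemma exists_norm_splitKernel_le (hc : c < c') (k : Y) : ∃ C : ℝ, ∀ l z : ℂ, l.re = -c →
    z.re = -c' → ‖splitKernel J S b (b 0 (J k)) l z‖ ≤
      C * ((1 + |l.im|) * (1 + |z.im - l.im|) * (1 + |z.im + l.im|))⁻¹ := by
  obtain ⟨M, hM0, hM⟩ := h.exists_norm_halfResolvent_b_le I k
  obtain ⟨N, hN0, hN⟩ := h.exists_norm_halfResolvent_b_le (-I) k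
  have hpos := h.pos
  have hsub : 0 < c' - c := by linarith
  have hadd : 0 < c + c' := by linarith
  refine ⟨((c' - c)⁻¹ + 1) * (((c + c')⁻¹ + 1) * ((M + N) * (c⁻¹ + 1))), fun l z hl hz => ?_⟩
  have hlm : l ∈ leftHalfPlane c := hl.le
  have hzm : z ∈ leftHalfPlane c := show z.re ≤ -c by linarith
  have hl_le := inv_norm_le_inv_one_add_abs_im (w := l) hpos (by rw [hl, abs_neg, abs_of_pos hpos])
  have hsub_le := inv_norm_le_inv_one_add_abs_im (w := z - l) hsub
    (by rw [Complex.sub_re, hl, hz, abs_sub_comm, abs_of_pos] <;> linarith)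
  have hadd_le := inv_norm_le_inv_one_add_abs_im (w := z + l) hadd
    (by rw [Complex.add_re, hl, hz, ← abs_neg, abs_of_pos] <;> linarith)
  rw [splitKernel, h.halfResolvent_resolvent Complex.I_mul_I hzm hlm, norm_smul, neg_smul, norm_neg,
    norm_smul, norm_inv, norm_inv]
  calc _ ≤ ‖z - l‖⁻¹ * (‖z + l‖⁻¹ * ((M + N) * ‖l‖⁻¹)) := by
        rw [add_mul]
        gcongr
        exact norm_add_le_of_le (hM z hzm l hl) (hN l hlm l hl)
    _ ≤ ((c' - c)⁻¹ + 1) * (1 + |(z - l).im|)⁻¹ * (((c + c')⁻¹ + 1) * (1 + |(z + l).im|)⁻¹ *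
        ((M + N) * ((c⁻¹ + 1) * (1 + |l.im|)⁻¹))) := by gcongr
    _ = _ := by rw [Complex.sub_im, Complex.add_im, mul_inv, mul_inv]; ring

lemma integrable_splitKernel (hc : c < c') (k : Y) :
    Integrable (fun q : ℝ × ℝ =>
      splitKernel J S b (b 0 (J k)) (-(c : ℂ) + q.1 * I) (-(c' : ℂ) + q.2 * I))
      (volume.prod volume) := by
  obtain ⟨C, hC⟩ := h.exists_norm_splitKernel_le hc k
  refine (integrable_inv_one_add_abs_mul_sub_mul_add.const_mul C).mono'
    (h.continuous_splitKernel hc _).aestronglyMeasurable (Eventually.of_forall fun q => ?_)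
  simpa using hC (-(c : ℂ) + q.1 * I) (-(c' : ℂ) + q.2 * I) (by simp) (by simp)

lemma hasContourIntegral_splitKernel_left (hc : c < c') (k : Y) {z : ℂ} (hz : z.re = -c') :
    HasContourIntegral c (fun l => splitKernel J S b (b 0 (J k)) l z)
      ((1 / (2 * (Real.pi : ℂ) * I)) •
        ∫ s : ℝ, I • splitKernel J S b (b 0 (J k)) (-(c : ℂ) + s * I) z) := by
  obtain ⟨C, hC⟩ := h.exists_norm_splitKernel_le hc k
  have hzy : -(c' : ℂ) + z.im * I = z := by
    conv_rhs => rw [← Complex.re_add_im z, hz]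
    push_cast; ring
  refine hasContourIntegral_of_integrable
    (F := fun l => splitKernel J S b (b 0 (J k)) l z) ?_
  refine integrable_vertical_of_norm_le (C := |C|)
    (F := fun l => splitKernel J S b (b 0 (J k)) l z) ?_ fun s => ?_
  · simpa only [hzy, Function.comp_def] using
      (h.continuous_splitKernel hc (b 0 (J k))).comp (Continuous.prodMk_left z.im)
  · have hbound := hC (-(c : ℂ) + s * I) z (by simp) hz
    rw [show (-(c : ℂ) + s * I).im = s by simp] at hbound
    exact hbound.trans (mul_le_mul (le_abs_self C) (inv_one_add_abs_mul_sub_mul_add_le s z.im)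
      (by positivity) (abs_nonneg C))

lemma hasContourIntegral_splitKernel_right (hc : c < c') (k : Y) {l : ℂ} (hl : l.re = -c) :
    HasContourIntegral c' (splitKernel J S b (b 0 (J k)) l) 0 := by
  have hpole := ((h.mono hc.le).halfResolvent_J_decays I
    (halfResolvent J S (-I) l (b l (b 0 k)))).hasContourIntegral_cauchy_of_right (z := l)
    (by linarith)
  rw [← h.halfResolvent_J _ hl.le, ← h.b_J_apply, ← h.b_J_apply] at hpole
  have hneg := hpole.neg
  rw [neg_zero] at hneg
  refine hneg.congr fun z _ => ?_
  rw [splitKernel, ← neg_smul, ← inv_neg, neg_sub]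

lemma b_b_apply_of_ne {z l : ℂ} (hzl : z - l ≠ 0) (w : Y) :
    b z (b l w) = (z - l)⁻¹ • (b l w - b z w) := by
  have hres : b l w - b z w = (z - l) • b l (b z w) := DFunLike.congr_fun (h.b_resolvent l z) w
  rw [hres, inv_smul_smul₀ hzl, h.b_comm_apply]

variable [CompleteSpace Y]

lemma hasContourIntegral_kernel_left (hc : c < c') (k : Y) {z : ℂ} (hz : z.re = -c') :
    HasContourIntegral c (fun l => halfResolvent J S I z
      (halfResolvent J S (-I) l (b z (b l (b 0 (J k))))))
      ((1 / (2 * (Real.pi : ℂ) * I)) •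
        (∫ s : ℝ, I • splitKernel J S b (b 0 (J k)) (-(c : ℂ) + s * I) z) +
        S z (b z (b 0 (J k)))) := by
  have hzm : z ∈ leftHalfPlane c := show z.re ≤ -c by linarith
  have hpole := ((h.halfResolvent_J_decays (-I) (b z (b 0 k))).hasContourIntegral_cauchy_of_left
    (z := z) (by linarith)).map (halfResolvent J S I z)
  have hsplit := (h.hasContourIntegral_splitKernel_left hc k hz).sub hpole
  rw [map_neg, sub_neg_eq_add, ← h.b_J_apply, ← h.b_J_apply,
    h.halfResolvent_neg Complex.I_mul_I hzm] at hsplit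
  refine hsplit.congr fun l hl => ?_
  have hzl : z - l ≠ 0 := fun h0 => by
    have hre : z.re - l.re = 0 := congrArg Complex.re h0
    linarith
  simp only [splitKernel, h.b_b_apply_of_ne hzl, map_smul, map_sub, smul_sub]

lemma hasDoubleContourIntegral_of_hasContourIntegral (hc : c < c') {k v : Y}
    (hv : HasContourIntegral c (fun z => S z (b z (b 0 (J k)))) v) :
    HasDoubleContourIntegral c' c (fun l z => halfResolvent J S I z
      (halfResolvent J S (-I) l (b z (b l (b 0 (J k)))))) v := by
  have hsplit := hasContourIntegral_zero_of_integral_swap (h.integrable_splitKernel hc k)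
    fun l hl => h.hasContourIntegral_splitKernel_right hc k hl
  have hsum := hsplit.add (h.hasContourIntegral_S_b_shift hc.le hv)
  rw [zero_add] at hsum
  exact ⟨_, fun z hz => h.hasContourIntegral_kernel_left hc k hz, hsum⟩

omit [CompleteSpace Y] in
lemma J_J_S_b_add_b_b_S_b {z : ℂ} (hz : z ∈ leftHalfPlane c) (g : Y) :
    J (J (S z (b z g))) + b 0 (b 0 (S z (b z g))) =
      J (J (z⁻¹ • z⁻¹ • b 0 g - z⁻¹ • b z (b 0 g))) +
        (z⁻¹ • S z (b 0 (b 0 g)) - z⁻¹ • z⁻¹ • S z (b 0 g)) := by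
  have hz0 := h.ne_zero hz
  have hspace : J (J (S z (b z g))) = (z ^ 2)⁻¹ • (J (J (b z g)) - S z (b z g)) := by
    have hS : S z (b z g) = J (J (b z g)) - z ^ 2 • J (J (S z (b z g))) :=
      DFunLike.congr_fun (h.S_eq z hz) (b z g)
    rw [eq_inv_smul_iff₀ (pow_ne_zero 2 hz0), eq_sub_iff_add_eq, add_comm, ← eq_sub_iff_add_eq,
      ← hS]
  have htime : b 0 (b 0 (S z (b z g))) =
      S z (z⁻¹ • b 0 (b 0 g) - z⁻¹ • z⁻¹ • (b 0 g - b z g)) := by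
    rw [h.b_S_apply 0 hz, h.b_S_apply 0 hz, ← h.b_comm_apply z 0, ← h.b_comm_apply z 0,
      h.b_b_zero hz0, ← h.b_b_zero hz0 g, ← smul_sub]
  simp only [hspace, htime, h.b_b_zero hz0, map_sub, map_smul, smul_sub]
  match_scalars <;> field_simp <;> ring

lemma generalized_equation_of_hasContourIntegral {g v : Y}
    (hv : HasContourIntegral c (fun z => S z (b z g)) v) :
    J (J v) + b 0 (b 0 v) = J (J (b 0 (b 0 g))) := by
  have hSg := h.S_decays_apply (b 0 g)
  obtain ⟨M, -, hM⟩ := hSg.exists_bound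
  have htime := ((DecaysLeft.inv_smul h.pos (differentiableOn_const (b 0 g))
    fun _ _ => le_rfl).hasContourIntegral_inv_smul h.pos).sub (h.hasContourIntegral_inv_smul_b g)
  have hspace := ((h.S_decays_apply (b 0 (b 0 g))).hasContourIntegral_inv_smul h.pos).sub
    ((DecaysLeft.inv_smul h.pos hSg.differentiableOn hM).hasContourIntegral_inv_smul h.pos)
  have hsum := (htime.map (J * J)).add hspace
  have heq := (hv.map (J * J + b 0 * b 0)).unique
    (hsum.congr fun z hz => (h.J_J_S_b_add_b_b_S_b hz.le g).symm)
  simpa using heq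

end WaveResolvents

end AbstractReduction

/-! ### Resolvent families and their square roots -/

section ResolventFamily

variable {𝕜 𝒜 : Type*} [NontriviallyNormedField 𝕜] [NormedRing 𝒜] [NormedAlgebra 𝕜 𝒜]
  {R : 𝕜 → 𝒜} {D : Set 𝕜}

lemma tendsto_norm_sub_mul_nhdsWithin (w : 𝕜) (C : ℝ) :
    Tendsto (fun z => ‖w - z‖ * C) (𝓝[D] w) (𝓝 0) := by
  have hcont : Continuous fun z : 𝕜 => ‖w - z‖ * C := by fun_prop
  simpa using (hcont.tendsto w).mono_left nhdsWithin_le_nhds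

lemma eventually_norm_le_of_resolvent
    (h : ∀ z ∈ D, ∀ w ∈ D, R z - R w = (w - z) • (R z * R w)) {w : 𝕜} (hw : w ∈ D) :
    ∀ᶠ z in 𝓝[D] w, ‖R z‖ ≤ 2 * ‖R w‖ := by
  filter_upwards [(tendsto_norm_sub_mul_nhdsWithin w ‖R w‖).eventually_le_const one_half_pos,
    self_mem_nhdsWithin] with z hz hzD
  have hRz : ‖R z‖ ≤ ‖R w‖ + ‖w - z‖ * (‖R z‖ * ‖R w‖) :=
    calc ‖R z‖ = ‖R w + (w - z) • (R z * R w)‖ := by rw [← h z hzD w hw, add_sub_cancel]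
      _ ≤ ‖R w‖ + ‖w - z‖ * ‖R z * R w‖ := norm_smul (w - z) (R z * R w) ▸ norm_add_le _ _
      _ ≤ _ := by gcongr; exact norm_mul_le _ _
  have hhalf : ‖R z‖ * (‖w - z‖ * ‖R w‖) ≤ ‖R z‖ * (1 / 2) := by gcongr
  linarith

lemma continuousOn_of_resolvent
    (h : ∀ z ∈ D, ∀ w ∈ D, R z - R w = (w - z) • (R z * R w)) : ContinuousOn R D := by
  intro w hw
  rw [ContinuousWithinAt, tendsto_iff_norm_sub_tendsto_zero]
  refine squeeze_zero' (Eventually.of_forall fun z => norm_nonneg _) ?_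
    (tendsto_norm_sub_mul_nhdsWithin w (2 * ‖R w‖ * ‖R w‖))
  filter_upwards [eventually_norm_le_of_resolvent h hw, self_mem_nhdsWithin] with z hz hzD
  rw [h z hzD w hw, norm_smul]
  gcongr
  exact (norm_mul_le _ _).trans (by gcongr)

lemma hasDerivWithinAt_of_resolvent
    (h : ∀ z ∈ D, ∀ w ∈ D, R z - R w = (w - z) • (R z * R w)) {w : 𝕜} (hw : w ∈ D) :
    HasDerivWithinAt R (-(R w * R w)) D w := by
  rw [hasDerivWithinAt_iff_tendsto_slope]
  have hlim : Tendsto (fun z => -(R z * R w)) (𝓝[D \ {w}] w) (𝓝 (-(R w * R w))) :=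
    (((continuousOn_of_resolvent h w hw).mono sdiff_subset).tendsto.mul_const (R w)).neg
  refine hlim.congr' ?_
  filter_upwards [self_mem_nhdsWithin] with z hz
  rw [slope_def_module, h z hz.1 w hw, ← neg_sub z w, neg_smul, smul_neg,
    inv_smul_smul₀ (sub_ne_zero.2 hz.2)]

lemma differentiableOn_of_resolvent
    (h : ∀ z ∈ D, ∀ w ∈ D, R z - R w = (w - z) • (R z * R w)) : DifferentiableOn 𝕜 R D :=
  fun _ hw => (hasDerivWithinAt_of_resolvent h hw).differentiableWithinAt

lemma commute_of_resolvent
    (h : ∀ z ∈ D, ∀ w ∈ D, R z - R w = (w - z) • (R z * R w)) {z w : 𝕜} (hz : z ∈ D)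
    (hw : w ∈ D) : Commute (R z) (R w) := by
  rcases eq_or_ne z w with rfl | hne
  · exact Commute.refl _
  · refine smul_right_injective _ (sub_ne_zero.2 hne.symm) ?_
    change (w - z) • (R z * R w) = (w - z) • (R w * R z)
    rw [← h z hz w hw, ← neg_sub (R w), h w hw z hz, ← neg_smul, neg_sub]

end ResolventFamily

section SquareRoot

lemma hasDerivAt_arctan_sqrt {x s : ℝ} (hx : 0 < x) (hs : 0 < s) :
    HasDerivAt (fun s : ℝ => 2 / √x * Real.arctan (√s / √x))
      (s ^ (-(1 / 2 : ℝ)) * (x + s)⁻¹) s := by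
  refine (((Real.hasDerivAt_sqrt hs.ne').div_const (√x)).arctan.const_mul (2 / √x)).congr_deriv
    (Eq.symm ?_)
  rw [Real.rpow_neg hs.le, ← Real.sqrt_eq_rpow, div_pow, Real.sq_sqrt hx.le, Real.sq_sqrt hs.le]
  field_simp
  rw [Real.sq_sqrt hx.le]

lemma tendsto_arctan_sqrt {x : ℝ} (hx : 0 < x) :
    Tendsto (fun s : ℝ => 2 / √x * Real.arctan (√s / √x)) atTop (𝓝 (Real.pi / √x)) := by
  have hdiv : Tendsto (fun s : ℝ => √s / √x) atTop atTop :=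
    Real.tendsto_sqrt_atTop.atTop_div_const (Real.sqrt_pos.2 hx)
  rw [show Real.pi / √x = 2 / √x * (Real.pi / 2) by ring]
  exact ((tendsto_nhds_of_tendsto_nhdsWithin Real.tendsto_arctan_atTop).comp hdiv).const_mul _

lemma continuousWithinAt_arctan_sqrt (x : ℝ) :
    ContinuousWithinAt (fun s : ℝ => 2 / √x * Real.arctan (√s / √x)) (Ici 0) 0 :=
  Continuous.continuousWithinAt (by fun_prop)

lemma rpow_mul_inv_nonneg {x s : ℝ} (hx : 0 < x) (hs : s ∈ Ioi (0 : ℝ)) :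
    0 ≤ s ^ (-(1 / 2 : ℝ)) * (x + s)⁻¹ := by
  have hs' : 0 < s := hs
  positivity

lemma integrableOn_rpow_mul_inv {x : ℝ} (hx : 0 < x) :
    IntegrableOn (fun s : ℝ => s ^ (-(1 / 2 : ℝ)) * (x + s)⁻¹) (Ioi 0) :=
  integrableOn_Ioi_deriv_of_nonneg (continuousWithinAt_arctan_sqrt x)
    (fun _ => hasDerivAt_arctan_sqrt hx) (fun _ => rpow_mul_inv_nonneg hx) (tendsto_arctan_sqrt hx)

lemma integral_rpow_mul_inv {x : ℝ} (hx : 0 < x) :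
    ∫ s in Ioi (0 : ℝ), s ^ (-(1 / 2 : ℝ)) * (x + s)⁻¹ = Real.pi / √x := by
  rw [integral_Ioi_of_hasDerivAt_of_nonneg (continuousWithinAt_arctan_sqrt x)
    (fun _ => hasDerivAt_arctan_sqrt hx) (fun _ => rpow_mul_inv_nonneg hx) (tendsto_arctan_sqrt hx)]
  simp

lemma rpow_neg_half_mul_self {s : ℝ} (hs : 0 < s) : s ^ (-(1 / 2 : ℝ)) * s = √s := by
  rw [Real.rpow_neg hs.le, ← Real.sqrt_eq_rpow, inv_mul_eq_div, Real.div_sqrt]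

variable {𝒜 : Type*} [NormedRing 𝒜] [NormedAlgebra ℝ 𝒜]

/-- A family `S` of elements of a normed algebra that behaves like the resolvent
`S x = (A + x)⁻¹`, `0 ≤ x`, of an operator with `‖(A + x)⁻¹‖ ≤ K / (1 + x)`. -/
structure RealResolvent (S : ℝ → 𝒜) (K : ℝ) : Prop where
  nonneg : 0 ≤ K
  resolvent : ∀ x ∈ Ici (0 : ℝ), ∀ y ∈ Ici (0 : ℝ), S x - S y = (y - x) • (S x * S y)
  bound : ∀ x : ℝ, 0 ≤ x → ‖S x‖ ≤ K * (1 + x)⁻¹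

/-- The integral `∫_0^∞ s^{-1/2} S(x + s) ds`, which is `π (A + x)^{-1/2}` for
`S x = (A + x)⁻¹`. -/
def sqrtIntegral (S : ℝ → 𝒜) (x : ℝ) : 𝒜 :=
  ∫ s in Ioi (0 : ℝ), (s ^ (-(1 / 2 : ℝ))) • S (x + s)

lemma integrableOn_rpow_smul {f : ℝ → 𝒜} {M : ℝ} (hf : ContinuousOn f (Ici 0))
    (hM : ∀ s, 0 ≤ s → ‖f s‖ ≤ M * (1 + s)⁻¹) :
    IntegrableOn (fun s : ℝ => (s ^ (-(1 / 2 : ℝ))) • f s) (Ioi 0) := by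
  have hcont : ContinuousOn (fun s : ℝ => (s ^ (-(1 / 2 : ℝ))) • f s) (Ioi 0) :=
    ContinuousOn.smul
      (fun s hs => (Real.continuousAt_rpow_const s _ (Or.inl (ne_of_gt hs))).continuousWithinAt)
      (hf.mono Ioi_subset_Ici_self)
  refine ((integrableOn_rpow_mul_inv one_pos).const_mul M).mono'
    (hcont.aestronglyMeasurable measurableSet_Ioi) ?_
  filter_upwards [ae_restrict_mem measurableSet_Ioi] with s (hs : 0 < s)
  rw [norm_smul, Real.norm_of_nonneg (by positivity), mul_left_comm]
  gcongr
  exact hM s hs.le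

namespace RealResolvent

variable {S : ℝ → 𝒜} {K : ℝ} (h : RealResolvent S K)
include h

lemma norm_le {x : ℝ} (hx : 0 ≤ x) : ‖S x‖ ≤ K :=
  (h.bound x hx).trans
    (mul_le_of_le_one_right h.nonneg (inv_le_one_of_one_le₀ (by linarith)))

lemma norm_add_le {x s : ℝ} (hx : 0 ≤ x) (hs : 0 ≤ s) : ‖S (x + s)‖ ≤ K * (1 + s)⁻¹ := by
  refine (h.bound _ (by positivity)).trans ?_
  have hK := h.nonneg
  gcongr
  linarith

lemma norm_mul_add_le {T : 𝒜} (hT : ‖T‖ ≤ K) {x s : ℝ} (hx : 0 ≤ x) (hs : 0 ≤ s) :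
    ‖T * S (x + s)‖ ≤ K * K * (1 + s)⁻¹ := by
  rw [mul_assoc]
  exact (norm_mul_le _ _).trans
    (mul_le_mul hT (h.norm_add_le hx hs) (norm_nonneg _) h.nonneg)

lemma hasDerivAt {x : ℝ} (hx : 0 < x) : HasDerivAt S (-(S x * S x)) x :=
  (hasDerivWithinAt_of_resolvent h.resolvent hx.le).hasDerivAt (Ici_mem_nhds hx)

lemma continuousOn_add {x : ℝ} (hx : 0 ≤ x) : ContinuousOn (fun s => S (x + s)) (Ici 0) :=
  (continuousOn_of_resolvent h.resolvent).comp (by fun_prop)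
    fun s (hs : 0 ≤ s) => add_nonneg hx hs

lemma integrableOn_rpow_smul {x : ℝ} (hx : 0 ≤ x) :
    IntegrableOn (fun s : ℝ => (s ^ (-(1 / 2 : ℝ))) • S (x + s)) (Ioi 0) :=
  _root_.integrableOn_rpow_smul (h.continuousOn_add hx) fun _ hs => h.norm_add_le hx hs

lemma integrableOn_rpow_smul_mul {x y : ℝ} (hx : 0 ≤ x) (hy : 0 ≤ y) :
    IntegrableOn (fun s : ℝ => (s ^ (-(1 / 2 : ℝ))) • (S x * S (y + s))) (Ioi 0) :=
  _root_.integrableOn_rpow_smul ((h.continuousOn_add hy).const_mul (S x))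
    fun _ hs => h.norm_mul_add_le (h.norm_le hx) hy hs

lemma integrableOn_rpow_smul_mul_add {x y : ℝ} (hx : 0 ≤ x) (hy : 0 ≤ y) :
    IntegrableOn (fun s : ℝ => (s ^ (-(1 / 2 : ℝ))) • (S (x + s) * S (y + s))) (Ioi 0) :=
  _root_.integrableOn_rpow_smul ((h.continuousOn_add hx).mul (h.continuousOn_add hy))
    fun _ hs => h.norm_mul_add_le (h.norm_le (add_nonneg hx hs)) hy hs

lemma mul_mul_add {x s : ℝ} (hx : 0 ≤ x) (hs : 0 < s) :
    S x * (√s • (S (x + s) * S (x + s))) =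
      s ^ (-(1 / 2 : ℝ)) • (S x * S (x + s)) - s ^ (-(1 / 2 : ℝ)) • (S (x + s) * S (x + s)) := by
  have hres := h.resolvent x hx (x + s) (add_nonneg hx hs.le)
  rw [add_sub_cancel_left] at hres
  rw [← smul_sub, ← sub_mul, hres, smul_mul_assoc, smul_smul, rpow_neg_half_mul_self hs,
    mul_smul_comm, mul_assoc]

lemma hasDerivAt_mul_sqrt_smul {x s : ℝ} (hx : 0 ≤ x) (hs : 0 < s) :
    HasDerivAt (fun s : ℝ => S x * (√s • S (x + s)))
      (s ^ (-(1 / 2 : ℝ)) • (S (x + s) * S (x + s)) -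
        (1 / 2 : ℝ) • s ^ (-(1 / 2 : ℝ)) • (S x * S (x + s))) s := by
  have hS : HasDerivAt (fun s => S (x + s)) (-(S (x + s) * S (x + s))) s :=
    (h.hasDerivAt (add_pos_of_nonneg_of_pos hx hs)).comp_const_add x s
  refine (((Real.hasDerivAt_sqrt hs.ne').smul hS).const_mul (S x)).congr_deriv ?_
  have hsqrt : 1 / (2 * √s) = 1 / 2 * s ^ (-(1 / 2 : ℝ)) := by
    rw [Real.rpow_neg hs.le, ← Real.sqrt_eq_rpow, one_div, mul_inv, one_div]
  rw [mul_add, smul_neg, mul_neg, h.mul_mul_add hx hs, hsqrt, mul_smul_comm]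
  module

lemma tendsto_mul_sqrt_smul {x : ℝ} (hx : 0 ≤ x) :
    Tendsto (fun s : ℝ => S x * (√s • S (x + s))) atTop (𝓝 0) := by
  have hlim : Tendsto (fun s : ℝ => K * K * (√s)⁻¹) atTop (𝓝 0) := by
    simpa using Real.tendsto_sqrt_atTop.inv_tendsto_atTop.const_mul (K * K)
  refine squeeze_zero_norm' ?_ hlim
  filter_upwards [eventually_gt_atTop 0] with s hs
  rw [mul_smul_comm, norm_smul, Real.norm_of_nonneg (by positivity)]
  have hK := h.nonneg
  calc _ ≤ √s * (K * K * (1 + s)⁻¹) := by gcongr; exact h.norm_mul_add_le (h.norm_le hx) hx hs.le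
    _ ≤ √s * (K * K * s⁻¹) := by gcongr; linarith
    _ = K * K * (√s / s) := by ring
    _ = _ := by rw [Real.sqrt_div_self]

variable [CompleteSpace 𝒜]

lemma mul_sqrtIntegral {x : ℝ} (hx : 0 ≤ x) (T : 𝒜) : T * sqrtIntegral S x =
    ∫ s in Ioi (0 : ℝ), (s ^ (-(1 / 2 : ℝ))) • (T * S (x + s)) := by
  have hcomm := (ContinuousLinearMap.mul ℝ 𝒜 T).integral_comp_comm (h.integrableOn_rpow_smul hx)
  simpa [sqrtIntegral] using hcomm.symm

lemma sqrtIntegral_mul {x : ℝ} (hx : 0 ≤ x) (T : 𝒜) : sqrtIntegral S x * T =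
    ∫ s in Ioi (0 : ℝ), (s ^ (-(1 / 2 : ℝ))) • (S (x + s) * T) := by
  have hcomm :=
    ((ContinuousLinearMap.mul ℝ 𝒜).flip T).integral_comp_comm (h.integrableOn_rpow_smul hx)
  simpa [sqrtIntegral] using hcomm.symm

lemma commute_sqrtIntegral {x y : ℝ} (hx : 0 ≤ x) (hy : 0 ≤ y) :
    Commute (S y) (sqrtIntegral S x) := by
  rw [commute_iff_eq, h.mul_sqrtIntegral hx, h.sqrtIntegral_mul hx]
  refine setIntegral_congr_fun measurableSet_Ioi fun s (hs : 0 < s) => ?_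
  rw [(commute_of_resolvent h.resolvent hy (add_nonneg hx hs.le)).eq]

lemma integral_rpow_smul_mul_self {x : ℝ} (hx : 0 ≤ x) :
    ∫ s in Ioi (0 : ℝ), (s ^ (-(1 / 2 : ℝ))) • (S (x + s) * S (x + s)) =
      (1 / 2 : ℝ) • (S x * sqrtIntegral S x) := by
  have hsq := h.integrableOn_rpow_smul_mul_add hx hx
  have hmul : IntegrableOn
      (fun s : ℝ => (1 / 2 : ℝ) • s ^ (-(1 / 2 : ℝ)) • (S x * S (x + s))) (Ioi 0) :=
    (h.integrableOn_rpow_smul_mul hx hx).smul (1 / 2 : ℝ)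
  have hcont : ContinuousWithinAt (fun s : ℝ => S x * (√s • S (x + s))) (Ici 0) 0 :=
    (Real.continuous_sqrt.continuousWithinAt.smul
      (h.continuousOn_add hx 0 self_mem_Ici)).const_mul _
  have hint := integral_Ioi_of_hasDerivAt_of_tendsto hcont
    (fun s hs => h.hasDerivAt_mul_sqrt_smul hx hs) (hsq.sub hmul) (h.tendsto_mul_sqrt_smul hx)
  rw [integral_sub hsq hmul] at hint
  rw [h.mul_sqrtIntegral hx, ← integral_smul, ← sub_eq_zero]
  simpa using hint

omit [CompleteSpace 𝒜] in
lemma sqrtIntegral_sub {x y : ℝ} (hx : 0 ≤ x) (hy : 0 ≤ y) :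
    sqrtIntegral S x - sqrtIntegral S y = (y - x) •
      ∫ s in Ioi (0 : ℝ), (s ^ (-(1 / 2 : ℝ))) • (S (x + s) * S (y + s)) := by
  rw [sqrtIntegral, sqrtIntegral, ← integral_smul,
    ← integral_sub (h.integrableOn_rpow_smul hx) (h.integrableOn_rpow_smul hy)]
  refine setIntegral_congr_fun measurableSet_Ioi fun s (hs : 0 < s) => ?_
  simp only [← smul_sub]
  rw [h.resolvent _ (add_nonneg hx hs.le) _ (add_nonneg hy hs.le), smul_comm,
    add_sub_add_right_eq_sub]

omit [CompleteSpace 𝒜] in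
lemma tendsto_integral_rpow_smul_mul {x : ℝ} (hx : 0 ≤ x) :
    Tendsto (fun y => ∫ s in Ioi (0 : ℝ), (s ^ (-(1 / 2 : ℝ))) • (S (x + s) * S (y + s)))
      (𝓝[Ici 0 \ {x}] x)
      (𝓝 (∫ s in Ioi (0 : ℝ), (s ^ (-(1 / 2 : ℝ))) • (S (x + s) * S (x + s)))) := by
  refine tendsto_integral_filter_of_dominated_convergence
    (fun s => K * K * (s ^ (-(1 / 2 : ℝ)) * (1 + s)⁻¹)) ?_ ?_
    ((integrableOn_rpow_mul_inv one_pos).const_mul _) ?_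
  · filter_upwards [self_mem_nhdsWithin] with y hy
    exact (h.integrableOn_rpow_smul_mul_add hx hy.1).aestronglyMeasurable
  · filter_upwards [self_mem_nhdsWithin] with y hy
    filter_upwards [ae_restrict_mem measurableSet_Ioi] with s (hs : 0 < s)
    rw [norm_smul, Real.norm_of_nonneg (by positivity), mul_left_comm]
    gcongr
    exact h.norm_mul_add_le (h.norm_le (add_nonneg hx hs.le)) hy.1 hs.le
  · filter_upwards [ae_restrict_mem measurableSet_Ioi] with s (hs : 0 < s)
    have hS : Tendsto (fun y => S (y + s)) (𝓝 x) (𝓝 (S (x + s))) :=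
      (h.hasDerivAt (add_pos_of_nonneg_of_pos hx hs)).continuousAt.tendsto.comp
        ((continuous_add_const s).tendsto x)
    exact ((hS.mono_left nhdsWithin_le_nhds).const_mul _).const_smul _

lemma hasDerivWithinAt_sqrtIntegral {x : ℝ} (hx : 0 ≤ x) :
    HasDerivWithinAt (sqrtIntegral S) (-((1 / 2 : ℝ) • (S x * sqrtIntegral S x))) (Ici 0) x := by
  rw [← h.integral_rpow_smul_mul_self hx, hasDerivWithinAt_iff_tendsto_slope]
  refine (h.tendsto_integral_rpow_smul_mul hx).neg.congr' ?_
  filter_upwards [self_mem_nhdsWithin] with y hy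
  rw [slope_def_module, ← neg_sub (sqrtIntegral S x), h.sqrtIntegral_sub hx hy.1, smul_neg,
    inv_smul_smul₀ (sub_ne_zero.2 hy.2)]

lemma hasDerivWithinAt_sqrtIntegral_mul_self {x : ℝ} (hx : 0 ≤ x) :
    HasDerivWithinAt (fun y => sqrtIntegral S y * sqrtIntegral S y)
      (-(S x * (sqrtIntegral S x * sqrtIntegral S x))) (Ici 0) x := by
  have hG := h.hasDerivWithinAt_sqrtIntegral hx
  refine (hG.mul hG).congr_deriv ?_
  rw [neg_mul, mul_neg, smul_mul_assoc, mul_smul_comm, ← mul_assoc (sqrtIntegral S x),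
    ← (h.commute_sqrtIntegral hx hx).eq, mul_assoc]
  module

-- With `G y = π (A + y)^{-1/2}`, the function `y ↦ (1 + y A⁻¹) G(y)²` has derivative zero.
lemma sqrtIntegral_mul_self_add {x : ℝ} (hx : 0 ≤ x) :
    sqrtIntegral S x * sqrtIntegral S x + x • (S 0 * (sqrtIntegral S x * sqrtIntegral S x)) =
      sqrtIntegral S 0 * sqrtIntegral S 0 := by
  set H : ℝ → 𝒜 := fun y => sqrtIntegral S y * sqrtIntegral S y
  have hderiv : ∀ y : ℝ, 0 ≤ y → HasDerivWithinAt (fun y => H y + y • (S 0 * H y)) 0 (Ici 0) y := by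
    intro y hy
    have hH := h.hasDerivWithinAt_sqrtIntegral_mul_self hy
    refine (hH.add ((hasDerivWithinAt_id y (Ici 0)).smul (hH.const_mul (S 0)))).congr_deriv ?_
    have hres := h.resolvent 0 self_mem_Ici y hy
    rw [sub_zero] at hres
    have hmul : S 0 * H y = S y * H y + y • (S 0 * (S y * H y)) := by
      rw [← mul_assoc (S 0) (S y), ← smul_mul_assoc, ← hres]
      noncomm_ring
    change -(S y * H y) + (y • (S 0 * -(S y * H y)) + (1 : ℝ) • (S 0 * H y)) = 0
    rw [one_smul, mul_neg, smul_neg, hmul]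
    abel
  have hconst := constant_of_has_deriv_right_zero (a := 0) (b := x)
    (fun y hy => (hderiv y hy.1).continuousWithinAt.mono Icc_subset_Ici_self)
    (fun y hy => (hderiv y hy.1).mono (Ici_subset_Ici.2 hy.1)) x ⟨hx, le_rfl⟩
  simpa only [zero_smul, add_zero] using hconst

lemma mul_sqrtIntegral_sub {x : ℝ} (hx : 0 < x) :
    S 0 * sqrtIntegral S x - (Real.pi / √x) • S 0 =
      -∫ s in Ioi (0 : ℝ), (s ^ (-(1 / 2 : ℝ)) * (x + s)⁻¹) • S (x + s) := by
  rw [h.mul_sqrtIntegral hx.le, ← integral_rpow_mul_inv hx, ← integral_smul_const,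
    ← integral_sub (h.integrableOn_rpow_smul_mul le_rfl hx.le)
      ((integrableOn_rpow_mul_inv hx).smul_const _), ← integral_neg]
  refine setIntegral_congr_fun measurableSet_Ioi fun s (hs : 0 < s) => ?_
  have hxs : 0 < x + s := add_pos hx hs
  have hres := h.resolvent 0 self_mem_Ici (x + s) hxs.le
  rw [sub_zero] at hres
  simp only [mul_smul, ← smul_sub, ← smul_neg]
  rw [← inv_smul_smul₀ hxs.ne' (S 0 * S (x + s)), ← hres, ← smul_sub, sub_sub_cancel_left]

lemma norm_sqrt_smul_sub_le {x : ℝ} (hx : 0 < x) :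
    ‖√x • (S 0 * sqrtIntegral S x) - Real.pi • S 0‖ ≤ Real.pi * K * (1 + x)⁻¹ := by
  have hint := integrableOn_rpow_mul_inv hx
  have hsqrt := Real.sqrt_pos.2 hx
  have hfactor : √x • (S 0 * sqrtIntegral S x) - Real.pi • S 0 =
      √x • (S 0 * sqrtIntegral S x - (Real.pi / √x) • S 0) := by
    rw [smul_sub, smul_smul, mul_div_cancel₀ _ hsqrt.ne']
  have hbound : ‖∫ s in Ioi (0 : ℝ), (s ^ (-(1 / 2 : ℝ)) * (x + s)⁻¹) • S (x + s)‖ ≤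
      ∫ s in Ioi (0 : ℝ), (s ^ (-(1 / 2 : ℝ)) * (x + s)⁻¹) * (K * (1 + x)⁻¹) := by
    refine norm_integral_le_of_norm_le (hint.mul_const _) ?_
    filter_upwards [ae_restrict_mem measurableSet_Ioi] with s (hs : 0 < s)
    rw [norm_smul, Real.norm_of_nonneg (by positivity), add_comm x s]
    gcongr
    exact h.norm_add_le hs.le hx.le
  rw [integral_mul_const, integral_rpow_mul_inv hx] at hbound
  rw [hfactor, h.mul_sqrtIntegral_sub hx, norm_smul, norm_neg,
    Real.norm_of_nonneg (Real.sqrt_nonneg x)]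
  calc _ ≤ √x * (Real.pi / √x * (K * (1 + x)⁻¹)) := by gcongr
    _ = _ := by field_simp

lemma tendsto_sqrt_smul : Tendsto (fun x => √x • (S 0 * sqrtIntegral S x)) atTop
    (𝓝 (Real.pi • S 0)) := by
  rw [tendsto_iff_norm_sub_tendsto_zero]
  have hlim : Tendsto (fun x : ℝ => Real.pi * K * (1 + x)⁻¹) atTop (𝓝 0) := by
    simpa using (tendsto_atTop_add_const_left _ 1 tendsto_id).inv_tendsto_atTop.const_mul
      (Real.pi * K)
  refine squeeze_zero' (Eventually.of_forall fun x => norm_nonneg _) ?_ hlim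
  filter_upwards [eventually_gt_atTop 0] with x hx using h.norm_sqrt_smul_sub_le hx

/- Multiply the previous identity by `S(0)²` and let `x → ∞`. The factors `S 0` can be cancelled
when `S 0` is injective. -/
lemma mul_mul_sqrtIntegral_mul_self :
    S 0 * (S 0 * (sqrtIntegral S 0 * sqrtIntegral S 0)) =
      (Real.pi ^ 2) • (S 0 * (S 0 * S 0)) := by
  set P : ℝ → 𝒜 := fun x => √x • (S 0 * sqrtIntegral S x) with hP
  have hPP := h.tendsto_sqrt_smul.mul h.tendsto_sqrt_smul
  have hlim := (tendsto_inv_atTop_zero (𝕜 := ℝ).smul hPP).add (hPP.const_mul (S 0))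
  have hconst : Tendsto (fun x : ℝ => x⁻¹ • (P x * P x) + S 0 * (P x * P x)) atTop
      (𝓝 (S 0 * (S 0 * (sqrtIntegral S 0 * sqrtIntegral S 0)))) := by
    refine tendsto_const_nhds.congr' ?_
    filter_upwards [eventually_gt_atTop 0] with x hx
    have hmul : P x * P x = x • (S 0 * (S 0 * (sqrtIntegral S x * sqrtIntegral S x))) := by
      rw [hP, smul_mul_smul_comm, Real.mul_self_sqrt hx.le, mul_assoc (S 0),
        ← mul_assoc (sqrtIntegral S x), ← (h.commute_sqrtIntegral hx.le le_rfl).eq, mul_assoc]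
    rw [← h.sqrtIntegral_mul_self_add hx.le, hmul, inv_smul_smul₀ hx.ne']
    simp only [mul_add, mul_smul_comm]
  rw [tendsto_nhds_unique hconst hlim, zero_smul, zero_add, smul_mul_smul_comm, mul_smul_comm,
    ← sq]

end RealResolvent

end SquareRoot

/-! ### Resolvents of unbounded operators -/

section OperatorResolvents

variable {E : Type*} [NormedAddCommGroup E] [NormedSpace ℂ E] {A : E →ₗ.[ℂ] E} {z w : ℂ}

lemma IsShiftInverse.unique {R R' : E →L[ℂ] E} (h : IsShiftInverse A z R)
    (h' : IsShiftInverse A z R') : R = R' := by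
  ext y
  exact ((h' _ y).2 ((h _ y).1 rfl)).symm

lemma isShiftInverse_shiftInv (hz : z ∈ resolventSetNeg A) :
    IsShiftInverse A z (shiftInv A z) := by
  have hex : ∃ R : E →L[ℂ] E, IsShiftInverse A z R := hz
  rw [shiftInv, dif_pos hex]
  exact hex.choose_spec

lemma IsShiftInverse.shiftInv_eq {R : E →L[ℂ] E} (h : IsShiftInverse A z R) :
    shiftInv A z = R :=
  (isShiftInverse_shiftInv ⟨R, h⟩).unique h

lemma shiftInv_sub_shiftInv (hz : z ∈ resolventSetNeg A) (hw : w ∈ resolventSetNeg A) :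
    shiftInv A z - shiftInv A w = (w - z) • (shiftInv A z * shiftInv A w) := by
  ext y
  obtain ⟨hx, hxy⟩ := (isShiftInverse_shiftInv hw _ y).1 rfl
  set x := shiftInv A w y with hxdef
  have hRx : shiftInv A z (y + (z - w) • x) = x := by
    refine (isShiftInverse_shiftInv hz _ _).2 ⟨hx, ?_⟩
    rw [← hxy]
    module
  rw [map_add, map_smul] at hRx
  simp only [sub_apply, smul_apply, mul_apply_eq_comp, ← hxdef]
  linear_combination (norm := module) hRx

lemma commute_shiftInv (hz : z ∈ resolventSetNeg A) (hw : w ∈ resolventSetNeg A) :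
    Commute (shiftInv A z) (shiftInv A w) :=
  commute_of_resolvent (fun _ hz _ hw => shiftInv_sub_shiftInv hz hw) hz hw

lemma shiftInv_injective (hz : z ∈ resolventSetNeg A) :
    Function.Injective (shiftInv A z) := by
  refine (injective_iff_map_eq_zero _).2 fun y hy => ?_
  obtain ⟨hx, hxy⟩ := (isShiftInverse_shiftInv hz _ y).1 rfl
  have hzero : (⟨shiftInv A z y, hx⟩ : A.domain) = 0 := Subtype.ext hy
  rw [← hxy, hzero, hy, LinearPMap.map_zero, smul_zero, add_zero]

lemma differentiableOn_shiftInv : DifferentiableOn ℂ (shiftInv A) (resolventSetNeg A) :=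
  differentiableOn_of_resolvent fun _ hz _ hw => shiftInv_sub_shiftInv hz hw

lemma ofReal_mem_sector_zero {s : ℝ} (hs : 0 ≤ s) : (s : ℂ) ∈ sector 0 :=
  Or.inl (by simp [Complex.arg_ofReal_of_nonneg hs])

lemma invSqrt_eq : invSqrt A =
    (1 / Real.pi : ℝ) • sqrtIntegral (fun s : ℝ => shiftInv A (s : ℂ)) 0 := by
  simp only [invSqrt, sqrtIntegral, zero_add]

namespace IsSectorial

variable (hA : IsSectorial A 0)
include hA

lemma ofReal_mem {s : ℝ} (hs : 0 ≤ s) : (s : ℂ) ∈ resolventSetNeg A :=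
  hA.2.1 (ofReal_mem_sector_zero hs)

lemma zero_mem : (0 : ℂ) ∈ resolventSetNeg A := by
  simpa using hA.ofReal_mem le_rfl

lemma exists_realResolvent : ∃ K : ℝ, RealResolvent (fun s : ℝ => shiftInv A (s : ℂ)) K := by
  obtain ⟨K, hK, hbound⟩ := hA.2.2
  refine ⟨K, zero_le_one.trans hK, fun x hx y hy => ?_, fun s hs => ?_⟩
  · rw [shiftInv_sub_shiftInv (hA.ofReal_mem hx) (hA.ofReal_mem hy), ← Complex.ofReal_sub,
      Complex.coe_smul]
  · have hs_bound := hbound s (ofReal_mem_sector_zero hs)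
    rw [Complex.norm_real, Real.norm_of_nonneg hs] at hs_bound
    rwa [← div_eq_mul_inv, le_div_iff₀ (by positivity), mul_comm]

variable [CompleteSpace E]

lemma invSqrt_mul_self : invSqrt A * invSqrt A = shiftInv A 0 := by
  obtain ⟨K, hK⟩ := hA.exists_realResolvent
  have hinj := shiftInv_injective hA.zero_mem
  have hsq := hK.mul_mul_sqrtIntegral_mul_self
  rw [invSqrt_eq]
  set G := sqrtIntegral (fun s : ℝ => shiftInv A (s : ℂ)) 0
  simp only [Complex.ofReal_zero] at hsq
  have hGG : G * G = (Real.pi ^ 2) • shiftInv A 0 := by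
    ext y
    refine hinj (hinj ?_)
    simpa using DFunLike.congr_fun hsq y
  have hpi : 1 / Real.pi * (1 / Real.pi) * Real.pi ^ 2 = 1 := by field_simp
  rw [smul_mul_smul_comm, hGG, smul_smul, hpi, one_smul]

lemma invSqrt_injective : Function.Injective (invSqrt A) := by
  have hinj := shiftInv_injective hA.zero_mem
  rw [← hA.invSqrt_mul_self] at hinj
  exact Function.Injective.of_comp (f := invSqrt A) hinj

lemma commute_shiftInv_invSqrt (hz : z ∈ resolventSetNeg A) :
    Commute (shiftInv A z) (invSqrt A) := by
  obtain ⟨K, hK⟩ := hA.exists_realResolvent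
  rw [commute_iff_eq, invSqrt_eq, mul_smul_comm, smul_mul_assoc, hK.mul_sqrtIntegral le_rfl,
    hK.sqrtIntegral_mul le_rfl]
  congr 1
  refine setIntegral_congr_fun measurableSet_Ioi fun s (hs : 0 < s) => ?_
  rw [(commute_shiftInv hz (hA.ofReal_mem (add_nonneg le_rfl hs.le))).eq]

lemma shiftInv_eq_invSqrt (hz : z ∈ resolventSetNeg A) :
    shiftInv A z = invSqrt A * invSqrt A - z • (invSqrt A * (invSqrt A * shiftInv A z)) := by
  have hres := shiftInv_sub_shiftInv hA.zero_mem hz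
  rw [sub_zero] at hres
  rw [← mul_assoc, hA.invSqrt_mul_self, ← hres, sub_sub_cancel]

lemma mem_graph_sqrtOp {x y : E} : (x, y) ∈ (sqrtOp A).graph ↔ invSqrt A y = x := by
  have hker : LinearMap.ker ((invSqrt A : E →ₗ[ℂ] E).toPMap ⊤).toFun = ⊥ := by
    refine (Submodule.eq_bot_iff _).2 fun a ha => Subtype.ext (hA.invSqrt_injective ?_)
    rw [LinearMap.mem_ker] at ha
    exact ha.trans (map_zero _).symm
  rw [sqrtOp, LinearPMap.inverse_graph hker, Submodule.mem_map]
  constructor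
  · rintro ⟨⟨a, a'⟩, ha, hxy⟩
    obtain ⟨a₀, rfl, rfl⟩ := (LinearPMap.mem_graph_iff _).1 ha
    obtain ⟨rfl, rfl⟩ := Prod.mk.inj hxy
    rfl
  · rintro rfl
    exact ⟨(y, invSqrt A y), (LinearPMap.mem_graph_iff _).2 ⟨⟨y, trivial⟩, rfl, rfl⟩, rfl⟩

lemma smul_sqrtOp_sub_smul_eq_iff {ε : ℂ} {x y : E} :
    (∃ hx : x ∈ (ε • sqrtOp A).domain, (ε • sqrtOp A) ⟨x, hx⟩ + -z • x = y) ↔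
      ∃ a, invSqrt A a = x ∧ ε • a - z • x = y := by
  constructor
  · rintro ⟨hx, rfl⟩
    refine ⟨sqrtOp A ⟨x, hx⟩, hA.mem_graph_sqrtOp.1 ((sqrtOp A).mem_graph ⟨x, hx⟩), ?_⟩
    rw [LinearPMap.smul_apply, neg_smul, sub_eq_add_neg]
  · rintro ⟨a, hax, rfl⟩
    obtain ⟨x', rfl, rfl⟩ := (LinearPMap.mem_graph_iff _).1 (hA.mem_graph_sqrtOp.2 hax)
    exact ⟨x'.2, by rw [LinearPMap.smul_apply, neg_smul, sub_eq_add_neg]; rfl⟩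

/- With `x = A^{-1/2} a`, the equation `(ε √A - z) x = y` reads `(ε - z A^{-1/2}) a = y`, and
`ε - z A^{-1/2}` is invertible. -/
lemma isShiftInverse_sqrtOp {ε : ℂ} (hε : ε * ε = -1) (hz : z ^ 2 ∈ resolventSetNeg A) :
    IsShiftInverse (ε • sqrtOp A) (-z)
      (halfResolvent (invSqrt A) (fun z => shiftInv A (z ^ 2)) ε z) := by
  set J := invSqrt A
  set S : ℂ → E →L[ℂ] E := fun z => shiftInv A (z ^ 2)
  have hS : S z = J * J - z ^ 2 • (J * (J * S z)) := hA.shiftInv_eq_invSqrt hz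
  have hc : S z * J = J * S z := hA.commute_shiftInv_invSqrt hz
  have hinv : (ε • 1 - z • J) * (-(ε • (1 - z ^ 2 • S z) + z • (J - z ^ 2 • (J * S z)))) = 1 := by
    simp only [sub_mul, mul_sub, mul_add, mul_neg, smul_mul_assoc, mul_smul_comm, one_mul, mul_one]
    linear_combination (norm := module) (-hε) • (1 - z ^ 2 • S z) - z ^ 2 • hS
  intro x y
  rw [hA.smul_sqrtOp_sub_smul_eq_iff]
  constructor
  · rintro rfl
    have hrange := DFunLike.congr_fun (halfResolvent_eq_mul (ε := ε) hS) y
    exact ⟨_, hrange.symm, hrange ▸ DFunLike.congr_fun hinv y⟩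
  · rintro ⟨a, rfl, rfl⟩
    exact DFunLike.congr_fun (halfResolvent_mul_sub hε hc hS) a

end IsSectorial

end OperatorResolvents

section ParabolicClass

variable {E : Type*} [NormedAddCommGroup E] [NormedSpace ℂ E] {A : E →ₗ.[ℂ] E} {c : ℝ}

lemma sq_mem_parabolicRegion (hc : 0 < c) {z : ℂ} (hz : z ∈ leftHalfPlane c) :
    z ^ 2 ∈ parabolicRegion (c ^ 2) := by
  have hz_re : z.re ≤ -c := hz
  have hre : (z ^ 2).re = z.re ^ 2 - z.im ^ 2 := by simp [sq]
  have him : (z ^ 2).im ^ 2 / (4 * c ^ 2) = z.re ^ 2 / c ^ 2 * z.im ^ 2 := by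
    rw [show (z ^ 2).im = 2 * z.re * z.im by rw [sq, Complex.mul_im]; ring]
    field_simp
    ring
  have hsq : c ^ 2 ≤ z.re ^ 2 := by nlinarith
  have hone : 1 ≤ z.re ^ 2 / c ^ 2 := by rwa [one_le_div (by positivity)]
  change c ^ 2 - (z ^ 2).im ^ 2 / (4 * c ^ 2) ≤ (z ^ 2).re
  rw [hre, him]
  linarith [le_mul_of_one_le_left (sq_nonneg z.im) hone]

lemma tendsto_sq_leftInfty (hc : 0 < c) : Tendsto (fun z : ℂ => z ^ 2) (leftInfty c)
    (Bornology.cobounded ℂ ⊓ 𝓟 (parabolicRegion (c ^ 2))) := by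
  refine tendsto_inf.2 ⟨?_, tendsto_principal.2 ?_⟩
  · rw [← tendsto_norm_atTop_iff_cobounded]
    simp only [norm_pow]
    exact (tendsto_pow_atTop two_ne_zero).comp (tendsto_norm_leftInfty c)
  · filter_upwards [eventually_mem_leftHalfPlane] with z hz using sq_mem_parabolicRegion hc hz

lemma IsSectorial.exists_norm_shiftInv_sq_le (hA : IsSectorial A 0) :
    ∃ K : ℝ, 0 ≤ K ∧ ∀ x : ℝ, 0 < x → ‖shiftInv A ((-(x : ℂ)) ^ 2)‖ ≤ K / x ^ 2 := by
  obtain ⟨K, hK⟩ := hA.exists_realResolvent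
  refine ⟨K, hK.nonneg, fun x hx => ?_⟩
  have hbound := hK.bound (x ^ 2) (sq_nonneg x)
  rw [Complex.ofReal_pow, ← neg_sq] at hbound
  refine hbound.trans ?_
  have hnonneg := hK.nonneg
  rw [div_eq_mul_inv]
  gcongr
  linarith

namespace IsParabolicClass

variable (hA : IsParabolicClass A (c ^ 2)) (hc : 0 < c)
include hA hc

lemma sq_mem {z : ℂ} (hz : z ∈ leftHalfPlane c) : z ^ 2 ∈ resolventSetNeg A :=
  hA.subset_resolventSet (sq_mem_parabolicRegion hc hz)

lemma differentiableOn_sq :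
    DifferentiableOn ℂ (fun z => shiftInv A (z ^ 2)) (leftHalfPlane c) :=
  differentiableOn_shiftInv.comp (by fun_prop) fun _ hz => hA.sq_mem hc hz

lemma decays : DecaysLeft c (fun z => shiftInv A (z ^ 2)) := by
  refine ⟨hA.differentiableOn_sq hc, ?_, ?_⟩
  · rw [tendsto_zero_iff_norm_tendsto_zero]
    exact hA.resolvent_decay.comp (tendsto_sq_leftInfty hc)
  · obtain ⟨K, hK, hbound⟩ := hA.sectorial.exists_norm_shiftInv_sq_le
    refine ⟨K, ?_⟩
    filter_upwards [eventually_ge_atTop 1] with x hx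
    exact (hbound x (by linarith)).trans
      (div_le_div_of_nonneg_left hK (by linarith) (le_self_pow₀ hx two_ne_zero))

lemma weighted_decays : DecaysLeft c (fun z => z • (shiftInv A (z ^ 2) * invSqrt A)) := by
  refine ⟨differentiableOn_id.smul ((hA.differentiableOn_sq hc).mul_const _), ?_, ?_⟩
  · rw [tendsto_zero_iff_norm_tendsto_zero]
    refine (hA.weighted_decay.comp (tendsto_sq_leftInfty hc)).congr fun z => ?_
    rw [Function.comp, norm_smul, norm_pow, ← Real.sqrt_eq_rpow, Real.sqrt_sq (norm_nonneg z)]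
    rfl
  · obtain ⟨K, -, hbound⟩ := hA.sectorial.exists_norm_shiftInv_sq_le
    refine ⟨K * ‖invSqrt A‖, ?_⟩
    filter_upwards [eventually_gt_atTop 0] with x hx
    rw [norm_smul, norm_neg, Complex.norm_real, Real.norm_of_nonneg hx.le]
    calc _ ≤ x * (K / x ^ 2 * ‖invSqrt A‖) := by
          gcongr; exact (norm_mul_le _ _).trans (by gcongr; exact hbound x hx)
      _ = _ := by field_simp

end IsParabolicClass

end ParabolicClass

section TriangleFubini

variable {E : Type*} [NormedAddCommGroup E] [NormedSpace ℂ E]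

lemma integral_smul_primitive [CompleteSpace E] {T : ℝ} (hT : 0 ≤ T) {ψ : ℝ → ℂ}
    (hψ : IntegrableOn ψ (Ioc 0 T)) {g : ℝ → E} (hg : IntegrableOn g (Ioc 0 T)) :
    ∫ s in 0..T, ψ s • ∫ x in 0..s, g x = ∫ x in 0..T, (∫ s in x..T, ψ s) • g x := by
  set triangle : Set (ℝ × ℝ) := {q | q.2 ≤ q.1}
  set f : ℝ → ℝ → E := fun s x => triangle.indicator (fun q => ψ q.1 • g q.2) (s, x)
  have hf : Integrable (Function.uncurry f)
      ((volume.restrict (Ioc 0 T)).prod (volume.restrict (Ioc 0 T))) :=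
    (hψ.smul_prod hg).indicator (measurableSet_le measurable_snd measurable_fst)
  have hx_integral (s : ℝ) (hs : s ∈ Ioc 0 T) :
      ∫ x in Ioc 0 T, f s x = ψ s • ∫ x in 0..s, g x := by
    rw [intervalIntegral.integral_of_le hs.1.le, ← integral_smul, ← inf_of_le_right hs.2,
      ← Ioc_inter_Iic, ← setIntegral_indicator measurableSet_Iic, inf_of_le_right hs.2]
    rfl
  have hs_integral (x : ℝ) (hx : x ∈ Ioc 0 T) :
      ∫ s in Ioc 0 T, f s x = (∫ s in x..T, ψ s) • g x := by
    have hslice : Ioc 0 T ∩ Ici x = Icc x T := by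
      ext s
      exact ⟨fun hs => ⟨hs.2, hs.1.2⟩, fun hs => ⟨⟨hx.1.trans_le hs.1, hs.2⟩, hs.1⟩⟩
    rw [intervalIntegral.integral_of_le hx.2, ← integral_smul_const,
      ← integral_Icc_eq_integral_Ioc (x := x), ← hslice, ← setIntegral_indicator measurableSet_Ici]
    rfl
  rw [intervalIntegral.integral_of_le hT, intervalIntegral.integral_of_le hT]
  calc _ = ∫ s in Ioc 0 T, ∫ x in Ioc 0 T, f s x :=
        (setIntegral_congr_fun measurableSet_Ioc hx_integral).symm
    _ = ∫ x in Ioc 0 T, ∫ s in Ioc 0 T, f s x := integral_integral_swap hf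
    _ = _ := setIntegral_congr_fun measurableSet_Ioc hs_integral

end TriangleFubini

/-! ### The resolvent of the time derivative -/

section Duhamel

variable {E : Type*} [NormedAddCommGroup E] [NormedSpace ℂ E] {T t : ℝ} {f g : ℝ → E}

/-- The Duhamel integral `((∂_t + z)⁻¹ g)(t)` of a locally integrable function. -/
def duhamel (z : ℂ) (g : ℝ → E) (t : ℝ) : E :=
  ∫ x in (0 : ℝ)..t, Complex.exp (z * ((x : ℂ) - t)) • g x

lemma duhamel_eq_exp_smul_integral (z : ℂ) (g : ℝ → E) (t : ℝ) :
    duhamel z g t = Complex.exp (-(z * t)) • ∫ x in 0..t, Complex.exp (z * x) • g x := by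
  rw [duhamel, ← intervalIntegral.integral_smul]
  simp only [smul_smul, ← Complex.exp_add]
  congr! 4
  ring

lemma duhamel_congr (h : f =ᵐ[timeMeasure T] g) (z : ℂ) (ht : t ∈ Icc 0 T) :
    duhamel z f t = duhamel z g t := by
  refine intervalIntegral.integral_congr_ae_restrict ?_
  rw [uIoc_of_le ht.1, ← restrict_Ioo_eq_restrict_Ioc]
  filter_upwards [ae_restrict_of_ae_restrict_of_subset (Ioo_subset_Ioo_right ht.2) h] with x hx
  rw [hx]

lemma integrableOn_exp_smul (z : ℂ) (hg : IntegrableOn g (Ioc 0 t)) :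
    IntegrableOn (fun x : ℝ => Complex.exp (z * x) • g x) (Icc 0 t) :=
  ((integrableOn_Icc_iff_integrableOn_Ioc).2 hg).continuousOn_smul (by fun_prop) isCompact_Icc

lemma continuousOn_duhamel (z : ℂ) (hg : IntegrableOn g (Ioc 0 T)) :
    ContinuousOn (duhamel z g) (Icc 0 T) := by
  have hexp : Continuous fun t : ℝ => Complex.exp (-(z * t)) := by fun_prop
  refine (hexp.continuousOn.smul
    (intervalIntegral.continuousOn_primitive (integrableOn_exp_smul z hg))).congr fun t ht => ?_
  rw [duhamel_eq_exp_smul_integral, intervalIntegral.integral_of_le ht.1]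
  rfl

lemma intervalIntegrable_duhamel (z : ℂ) (hg : IntegrableOn g (Ioc 0 T)) (ht : t ∈ Icc 0 T) :
    IntervalIntegrable (fun x : ℝ => Complex.exp (z * ((x : ℂ) - t)) • g x) volume 0 t := by
  rw [intervalIntegrable_iff_integrableOn_Icc_of_le ht.1]
  exact ((integrableOn_Icc_iff_integrableOn_Ioc).2
    (hg.mono_set (Ioc_subset_Ioc_right ht.2))).continuousOn_smul (by fun_prop) isCompact_Icc

lemma duhamel_add (z : ℂ) (hf : IntegrableOn f (Ioc 0 T)) (hg : IntegrableOn g (Ioc 0 T))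
    (ht : t ∈ Icc 0 T) : duhamel z (f + g) t = duhamel z f t + duhamel z g t := by
  simp only [duhamel, Pi.add_apply, smul_add]
  exact intervalIntegral.integral_add (intervalIntegrable_duhamel z hf ht)
    (intervalIntegrable_duhamel z hg ht)

lemma duhamel_smul (z a : ℂ) (g : ℝ → E) (t : ℝ) : duhamel z (a • g) t = a • duhamel z g t := by
  simp only [duhamel, Pi.smul_apply, smul_comm _ a]
  exact intervalIntegral.integral_smul a _

lemma norm_exp_mul_sub_le {z : ℂ} {r x : ℝ} (hz : -r ≤ z.re) (hx : x ∈ Ioc 0 t) (ht : t ≤ T) :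
    ‖Complex.exp (z * ((x : ℂ) - t))‖ ≤ Real.exp (|r| * T) := by
  have hre : (z * ((x : ℂ) - t)).re = -z.re * (t - x) := by
    rw [← Complex.ofReal_sub, Complex.re_mul_ofReal]
    ring
  rw [Complex.norm_exp, hre]
  gcongr
  · linarith [hx.2]
  · linarith [le_abs_self r]
  · linarith [hx.1]

lemma norm_duhamel_le {z : ℂ} {r : ℝ} (hz : -r ≤ z.re) (hg : IntegrableOn g (Ioc 0 T))
    (ht : t ∈ Icc 0 T) :
    ‖duhamel z g t‖ ≤ Real.exp (|r| * T) * ∫ x in Ioo 0 T, ‖g x‖ := by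
  have hgt : IntegrableOn (fun x => ‖g x‖) (Ioc 0 t) :=
    (hg.mono_set (Ioc_subset_Ioc_right ht.2)).norm
  calc ‖duhamel z g t‖ ≤ ∫ x in 0..t, Real.exp (|r| * T) * ‖g x‖ := by
        refine intervalIntegral.norm_integral_le_of_norm_le ht.1
          (Eventually.of_forall fun x hx => ?_)
          ((intervalIntegrable_iff_integrableOn_Ioc_of_le ht.1).2 (hgt.const_mul _))
        rw [norm_smul]
        gcongr
        exact norm_exp_mul_sub_le hz hx ht.2
    _ = Real.exp (|r| * T) * ∫ x in Ioc 0 t, ‖g x‖ := by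
        rw [intervalIntegral.integral_const_mul, intervalIntegral.integral_of_le ht.1]
    _ ≤ Real.exp (|r| * T) * ∫ x in Ioo 0 T, ‖g x‖ := by
        rw [← integral_Ioc_eq_integral_Ioo]
        refine mul_le_mul_of_nonneg_left ?_ (Real.exp_nonneg _)
        exact setIntegral_mono_set hg.norm (Eventually.of_forall fun _ => norm_nonneg _)
          (Ioc_subset_Ioc_right ht.2).eventuallyLE

lemma integral_mul_exp_sub (z w : ℂ) (x t : ℝ) :
    ∫ s in x..t, (w - z) * Complex.exp (z * ((s : ℂ) - t) - w * s) =
      Complex.exp (z * ((x : ℂ) - t) - w * x) - Complex.exp (-(w * t)) := by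
  have hderiv (s : ℝ) :
      HasDerivAt (fun s : ℝ => -Complex.exp (z * ((s : ℂ) - t) - w * s))
        ((w - z) * Complex.exp (z * ((s : ℂ) - t) - w * s)) s := by
    have hs : HasDerivAt (fun s : ℝ => (s : ℂ)) 1 s := Complex.ofRealCLM.hasDerivAt
    have hexponent : HasDerivAt (fun s : ℝ => z * ((s : ℂ) - t) - w * s) (z * 1 - w * 1) s :=
      ((hs.sub_const (t : ℂ)).const_mul z).sub (hs.const_mul w)
    exact hexponent.cexp.neg.congr_deriv (by ring)
  rw [intervalIntegral.integral_eq_sub_of_hasDerivAt (fun s _ => hderiv s)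
    (Continuous.intervalIntegrable (by fun_prop) _ _), sub_self, mul_zero, zero_sub]
  ring

lemma duhamel_sub_duhamel [CompleteSpace E] (z w : ℂ) (hg : IntegrableOn g (Ioc 0 T))
    (ht : t ∈ Icc 0 T) :
    duhamel z g t - duhamel w g t = (w - z) • duhamel z (duhamel w g) t := by
  have hgt : IntegrableOn g (Ioc 0 t) := hg.mono_set (Ioc_subset_Ioc_right ht.2)
  have hfactor (x : ℝ) : Complex.exp (z * ((x : ℂ) - t)) - Complex.exp (w * ((x : ℂ) - t)) =
      (Complex.exp (z * ((x : ℂ) - t) - w * x) - Complex.exp (-(w * t))) * Complex.exp (w * x) := by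
    rw [sub_mul, ← Complex.exp_add, ← Complex.exp_add]
    ring_nf
  calc duhamel z g t - duhamel w g t
      = ∫ x in 0..t, (Complex.exp (z * ((x : ℂ) - t) - w * x) - Complex.exp (-(w * t))) •
          Complex.exp (w * x) • g x := by
        rw [duhamel, duhamel, ← intervalIntegral.integral_sub (intervalIntegrable_duhamel z hg ht)
          (intervalIntegrable_duhamel w hg ht)]
        simp only [← sub_smul, hfactor, mul_smul]
    _ = ∫ x in 0..t, (∫ s in x..t, (w - z) * Complex.exp (z * ((s : ℂ) - t) - w * s)) •
          Complex.exp (w * x) • g x := by simp only [integral_mul_exp_sub]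
    _ = ∫ s in 0..t, ((w - z) * Complex.exp (z * ((s : ℂ) - t) - w * s)) •
          ∫ x in 0..s, Complex.exp (w * x) • g x :=
        (integral_smul_primitive ht.1 (Continuous.integrableOn_Ioc (by fun_prop))
          ((integrableOn_exp_smul w hgt).mono_set Ioc_subset_Icc_self)).symm
    _ = (w - z) • duhamel z (duhamel w g) t := by
        rw [duhamel, ← intervalIntegral.integral_smul]
        simp only [duhamel_eq_exp_smul_integral w, sub_eq_add_neg (z * _), Complex.exp_add,
          mul_smul]

end Duhamel

section LpEmbedding

variable (E : Type*) [NormedAddCommGroup E] {p : ℝ≥0∞}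

lemma exists_integral_norm_le {α : Type*} [MeasurableSpace α] (μ : Measure α) [IsFiniteMeasure μ]
    (hp : 1 ≤ p) : ∃ C : ℝ, 0 ≤ C ∧ ∀ g : Lp E p μ, ∫ x, ‖g x‖ ∂μ ≤ C * ‖g‖ := by
  set κ : ℝ≥0∞ := μ univ ^ (1 / (1 : ℝ≥0∞).toReal - 1 / p.toReal)
  have hexponent : 0 ≤ 1 / (1 : ℝ≥0∞).toReal - 1 / p.toReal := by
    rw [ENNReal.toReal_one, div_one, sub_nonneg]
    rcases eq_or_ne p ⊤ with rfl | hp_top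
    · simp
    · exact div_le_one_of_le₀ (ENNReal.toReal_mono hp_top hp) ENNReal.toReal_nonneg
  have hκ : κ ≠ ⊤ := ENNReal.rpow_ne_top_of_nonneg hexponent (measure_ne_top _ _)
  refine ⟨κ.toReal, ENNReal.toReal_nonneg, fun g => ?_⟩
  rw [integral_norm_eq_lintegral_enorm (Lp.aestronglyMeasurable g),
    ← eLpNorm_one_eq_lintegral_enorm, Lp.norm_def, mul_comm, ← ENNReal.toReal_mul]
  exact ENNReal.toReal_mono (ENNReal.mul_ne_top (Lp.eLpNorm_ne_top g) hκ)
    (eLpNorm_le_eLpNorm_mul_rpow_measure_univ hp (Lp.aestronglyMeasurable g))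

end LpEmbedding

section ContinuousDuhamel

variable {E : Type*} [NormedAddCommGroup E] {p : ℝ≥0∞} {T : ℝ}

lemma integrableOn_LpT [hp : Fact (1 ≤ p)] (g : LpT E p T) : IntegrableOn g (Ioc 0 T) :=
  (integrableOn_Ioc_iff_integrableOn_Ioo).2 ((Lp.memLp g).integrable hp.out)

lemma memLp_IccExtend (hT : 0 ≤ T) (F : C(Icc (0 : ℝ) T, E)) :
    MemLp (IccExtend hT F) p (timeMeasure T) :=
  MemLp.of_bound F.continuous.Icc_extend'.aestronglyMeasurable ‖F‖
    (Eventually.of_forall fun _ => F.norm_coe_le_norm _)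

variable [NormedSpace ℂ E] [Fact (1 ≤ p)]

/-- The inclusion of `C([0,T];E)` into `L^p(0,T;E)`. -/
def toLpT (hT : 0 ≤ T) : C(Icc (0 : ℝ) T, E) →L[ℂ] LpT E p T :=
  LinearMap.mkContinuous
    { toFun := fun F => (memLp_IccExtend hT F).toLp _
      map_add' := fun _ _ => rfl
      map_smul' := fun _ _ => rfl }
    (measureUnivNNReal (timeMeasure T) ^ p.toReal⁻¹) fun F => by
      refine Lp.norm_le_of_ae_bound (norm_nonneg F) ?_
      filter_upwards [(memLp_IccExtend hT F).coeFn_toLp] with t ht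
      exact (congrArg norm ht).trans_le (F.norm_coe_le_norm _)

lemma coeFn_toLpT (hT : 0 ≤ T) (F : C(Icc (0 : ℝ) T, E)) :
    (toLpT hT F : LpT E p T) =ᵐ[timeMeasure T] IccExtend hT F :=
  (memLp_IccExtend hT F).coeFn_toLp

lemma exists_norm_duhamel_le (E : Type*) [NormedAddCommGroup E] [NormedSpace ℂ E] (p : ℝ≥0∞)
    [Fact (1 ≤ p)] (T r : ℝ) : ∃ M : ℝ, 0 ≤ M ∧ ∀ z : ℂ, -r ≤ z.re →
      ∀ (g : LpT E p T), ∀ t ∈ Icc 0 T, ‖duhamel z g t‖ ≤ M * ‖g‖ := by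
  obtain ⟨C, hC, hbound⟩ := exists_integral_norm_le E (timeMeasure T) (Fact.out : 1 ≤ p)
  refine ⟨Real.exp (|r| * T) * C, by positivity, fun z hz g t ht => ?_⟩
  rw [mul_assoc]
  exact (norm_duhamel_le hz (integrableOn_LpT g) ht).trans (by gcongr; exact hbound g)

/-- The operator `(B + z)⁻¹`, `B = ∂_t`, with values in the continuous functions. -/
def duhamelC (z : ℂ) : LpT E p T →L[ℂ] C(Icc (0 : ℝ) T, E) :=
  LinearMap.mkContinuousOfExistsBound
    { toFun := fun g =>
        ⟨fun t => duhamel z g t, (continuousOn_duhamel z (integrableOn_LpT g)).domRestrict⟩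
      map_add' := fun f g => ContinuousMap.ext fun t =>
        (duhamel_congr (Lp.coeFn_add f g) z t.2).trans
          (duhamel_add z (integrableOn_LpT f) (integrableOn_LpT g) t.2)
      map_smul' := fun a g => ContinuousMap.ext fun t =>
        (duhamel_congr (Lp.coeFn_smul a g) z t.2).trans (duhamel_smul z a g t) } <| by
    obtain ⟨M, hM, hbound⟩ := exists_norm_duhamel_le E p T (-z.re)
    exact ⟨M, fun g => (ContinuousMap.norm_le _ (by positivity)).2 fun t =>
      hbound z (neg_neg z.re).le g t t.2⟩

lemma duhamelC_apply (z : ℂ) (g : LpT E p T) (t : Icc (0 : ℝ) T) :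
    duhamelC z g t = duhamel z g t := rfl

lemma exists_norm_duhamelC_le (E : Type*) [NormedAddCommGroup E] [NormedSpace ℂ E] (p : ℝ≥0∞)
    [Fact (1 ≤ p)] (T r : ℝ) : ∃ M : ℝ, 0 ≤ M ∧ ∀ z : ℂ, -r ≤ z.re →
      ‖(duhamelC z : LpT E p T →L[ℂ] C(Icc (0 : ℝ) T, E))‖ ≤ M := by
  obtain ⟨M, hM, hbound⟩ := exists_norm_duhamel_le E p T r
  exact ⟨M, hM, fun z hz => ContinuousLinearMap.opNorm_le_bound _ hM fun g =>
    (ContinuousMap.norm_le _ (by positivity)).2 fun t => hbound z hz g t t.2⟩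

lemma coeFn_derivInv (z : ℂ) (g : LpT E p T) :
    derivInv z g =ᵐ[timeMeasure T] duhamel z g := (memLp_duhamel z g).coeFn_toLp

lemma coeFn_toLpT_duhamelC (hT : 0 ≤ T) (z : ℂ) (g : LpT E p T) :
    (toLpT hT (duhamelC z g) : LpT E p T) =ᵐ[timeMeasure T] duhamel z g := by
  filter_upwards [coeFn_toLpT (p := p) hT (duhamelC z g), ae_restrict_mem measurableSet_Ioo]
    with t hcoe ht
  rw [hcoe, IccExtend_of_mem _ _ (Ioo_subset_Icc_self ht), duhamelC_apply]

lemma toLpT_duhamelC (hT : 0 ≤ T) (z : ℂ) (g : LpT E p T) :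
    toLpT hT (duhamelC z g) = derivInv z g :=
  Lp.ext ((coeFn_toLpT_duhamelC hT z g).trans (coeFn_derivInv z g).symm)

lemma duhamelC_sub_duhamelC [CompleteSpace E] (hT : 0 ≤ T) (z w : ℂ) (g : LpT E p T) :
    duhamelC z g - duhamelC w g =
      (w - z) • duhamelC z (toLpT hT (duhamelC w g) : LpT E p T) := by
  ext t
  simp only [ContinuousMap.sub_apply, ContinuousMap.smul_apply, duhamelC_apply]
  rw [duhamel_congr (coeFn_toLpT_duhamelC hT w g) z t.2]
  exact duhamel_sub_duhamel z w (integrableOn_LpT g) t.2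

end ContinuousDuhamel

/-! ### The wave resolvents on `L^p(0,T;E)` -/

section PointwiseAction

variable {E : Type*} [NormedAddCommGroup E] [NormedSpace ℂ E] {p : ℝ≥0∞} [Fact (1 ≤ p)] {T : ℝ}

/-- The pointwise action of bounded operators of `E` on `L^p(0,T;E)`, as a bounded linear map. -/
def liftL (E : Type*) [NormedAddCommGroup E] [NormedSpace ℂ E] (p : ℝ≥0∞) [Fact (1 ≤ p)] (T : ℝ) :
    (E →L[ℂ] E) →L[ℂ] (LpT E p T →L[ℂ] LpT E p T) :=
  ContinuousLinearMap.compLpL₂ p (timeMeasure T) (ContinuousLinearMap.id ℂ (E →L[ℂ] E))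

lemma liftL_apply (S : E →L[ℂ] E) (f : LpT E p T) : liftL E p T S f = liftOp S f := rfl

lemma coeFn_liftOp (S : E →L[ℂ] E) (f : LpT E p T) :
    liftOp S f =ᵐ[timeMeasure T] fun t => S (f t) := S.coeFn_compLp' f

lemma liftL_mul (S R : E →L[ℂ] E) : liftL E p T (S * R) = liftL E p T S * liftL E p T R := by
  ext1 f
  rw [mul_apply_eq_comp]
  simp only [liftL_apply]
  refine Lp.ext ?_
  filter_upwards [coeFn_liftOp (S * R) f, coeFn_liftOp S (liftOp R f), coeFn_liftOp R f]
    with t hSR hS hR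
  rw [hSR, hS, hR, mul_apply_eq_comp]

lemma liftOp_injective {S : E →L[ℂ] E} (hS : Function.Injective S) :
    Function.Injective (liftOp S : LpT E p T → LpT E p T) := by
  intro f g hfg
  refine Lp.ext ?_
  have hae : (liftOp S f : LpT E p T) =ᵐ[timeMeasure T] liftOp S g := by rw [hfg]
  filter_upwards [coeFn_liftOp S f, coeFn_liftOp S g, hae] with t hf hg hfg
  rw [hf, hg] at hfg
  exact hS hfg

lemma isPointwiseApply_iff {A : E →ₗ.[ℂ] E} (hA : (0 : ℂ) ∈ resolventSetNeg A)
    {u v : LpT E p T} : IsPointwiseApply A u v ↔ u = liftOp (shiftInv A 0) v := by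
  have hgraph : ∀ x y : E, (∃ hx : x ∈ A.domain, A ⟨x, hx⟩ = y) ↔ shiftInv A 0 y = x :=
    fun x y => by rw [isShiftInverse_shiftInv hA]; simp only [zero_smul, add_zero]
  simp only [IsPointwiseApply, hgraph]
  constructor
  · intro h
    refine Lp.ext ?_
    filter_upwards [h, coeFn_liftOp (shiftInv A 0) v] with t ht hlift
    rw [hlift, ht]
  · rintro rfl
    filter_upwards [coeFn_liftOp (shiftInv A 0) v] with t hlift
    rw [hlift]

lemma integral_clm_exp_smul [CompleteSpace E] (S : E →L[ℂ] E) (z : ℂ) (g : LpT E p T) {t : ℝ}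
    (ht : t ∈ Icc 0 T) :
    ∫ x in (0 : ℝ)..t, S (Complex.exp (z * ((x : ℂ) - t)) • g x) = S (duhamel z g t) :=
  S.intervalIntegral_comp_comm (intervalIntegrable_duhamel z (integrableOn_LpT g) ht)

lemma duhamelC_liftOp [CompleteSpace E] (S : E →L[ℂ] E) (z : ℂ) (g : LpT E p T) :
    duhamelC z (liftOp S g : LpT E p T) =
      S.compLeftContinuous ℂ (Icc (0 : ℝ) T) (duhamelC z g) := by
  ext t
  change duhamel z (liftOp S g : LpT E p T) t = S (duhamel z g t)
  rw [duhamel_congr (coeFn_liftOp S g) z t.2, ← integral_clm_exp_smul S z g t.2]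
  simp only [map_smul]
  rfl

lemma toLpT_compLeftContinuous (hT : 0 ≤ T) (S : E →L[ℂ] E) (F : C(Icc (0 : ℝ) T, E)) :
    toLpT hT (S.compLeftContinuous ℂ (Icc (0 : ℝ) T) F) = (liftOp S (toLpT hT F) : LpT E p T) := by
  refine Lp.ext ?_
  filter_upwards [coeFn_toLpT (p := p) hT (S.compLeftContinuous ℂ (Icc (0 : ℝ) T) F),
    coeFn_toLpT (p := p) hT F, coeFn_liftOp S (toLpT (p := p) hT F)] with t hSF hF hlift
  rw [hSF, hlift, hF]
  rfl

/-- `(B + z)⁻¹` as a bounded operator on `L^p(0,T;E)`. -/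
def timeResolvent (E : Type*) [NormedAddCommGroup E] [NormedSpace ℂ E] (p : ℝ≥0∞) [Fact (1 ≤ p)]
    (hT : 0 ≤ T) (z : ℂ) : LpT E p T →L[ℂ] LpT E p T :=
  (toLpT hT).comp (duhamelC z)

lemma timeResolvent_apply (hT : 0 ≤ T) (z : ℂ) (g : LpT E p T) :
    timeResolvent E p hT z g = derivInv z g := toLpT_duhamelC hT z g

lemma timeResolvent_sub_timeResolvent [CompleteSpace E] (hT : 0 ≤ T) (z w : ℂ) :
    timeResolvent E p hT z - timeResolvent E p hT w =
      (w - z) • (timeResolvent E p hT z * timeResolvent E p hT w) := by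
  ext1 g
  have hres := congrArg (toLpT (p := p) hT) (duhamelC_sub_duhamelC hT z w g)
  rw [map_sub, map_smul] at hres
  exact hres

lemma differentiable_timeResolvent [CompleteSpace E] (hT : 0 ≤ T) :
    Differentiable ℂ (timeResolvent E p hT) :=
  differentiableOn_univ.1
    (differentiableOn_of_resolvent fun z _ w _ => timeResolvent_sub_timeResolvent hT z w)

lemma timeResolvent_mul_liftL [CompleteSpace E] (hT : 0 ≤ T) (z : ℂ) (S : E →L[ℂ] E) :
    timeResolvent E p hT z * liftL E p T S = liftL E p T S * timeResolvent E p hT z := by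
  ext1 g
  change toLpT hT (duhamelC z (liftOp S g : LpT E p T)) =
    (liftOp S (toLpT hT (duhamelC z g)) : LpT E p T)
  rw [duhamelC_liftOp, toLpT_compLeftContinuous]

lemma exists_norm_timeResolvent_le (hT : 0 ≤ T) (r : ℝ) : ∃ M : ℝ, 0 ≤ M ∧
    ∀ z : ℂ, -r ≤ z.re → ‖timeResolvent E p hT z‖ ≤ M := by
  obtain ⟨M, hM, hbound⟩ := exists_norm_duhamelC_le E p T r
  refine ⟨‖(toLpT hT : C(Icc (0 : ℝ) T, E) →L[ℂ] LpT E p T)‖ * M, by positivity, fun z hz => ?_⟩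
  refine (ContinuousLinearMap.opNorm_comp_le _ _).trans ?_
  gcongr
  exact hbound z hz

end PointwiseAction

section LiftedResolvents

variable {E : Type*} [NormedAddCommGroup E] [NormedSpace ℂ E] {p : ℝ≥0∞} [Fact (1 ≤ p)] {T : ℝ}
  {A : E →ₗ.[ℂ] E} {c : ℝ}

lemma halfResolvent_liftL (A : E →ₗ.[ℂ] E) (ε z : ℂ) :
    halfResolvent (liftL E p T (invSqrt A)) (fun z => liftL E p T (shiftInv A (z ^ 2))) ε z =
      liftL E p T (halfResolvent (invSqrt A) (fun z => shiftInv A (z ^ 2)) ε z) := by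
  simp only [halfResolvent, map_neg, map_add, map_sub, map_smul, liftL_mul]

variable [CompleteSpace E] (hA : IsParabolicClass A (c ^ 2)) (hc : 0 < c) (hT : 0 ≤ T)
include hA hc

lemma IsParabolicClass.waveResolvents :
    WaveResolvents c (liftL E p T (invSqrt A)) (fun z => liftL E p T (shiftInv A (z ^ 2)))
      (timeResolvent E p hT) where
  pos := hc
  J_injective := liftOp_injective hA.sectorial.invSqrt_injective
  S_eq z hz := by
    have h := congrArg (liftL E p T) (hA.sectorial.shiftInv_eq_invSqrt (hA.sq_mem hc hz))
    simpa only [map_sub, map_smul, liftL_mul] using h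
  S_mul_J z hz := by
    rw [← liftL_mul, ← liftL_mul, (hA.sectorial.commute_shiftInv_invSqrt (hA.sq_mem hc hz)).eq]
  S_comm z hz w hw := by
    rw [← liftL_mul, ← liftL_mul, (commute_shiftInv (hA.sq_mem hc hz) (hA.sq_mem hc hw)).eq]
  S_decays := (hA.decays hc).map (liftL E p T)
  SJ_decays := ((hA.weighted_decays hc).map (liftL E p T)).congr fun z _ => by
    rw [map_smul, liftL_mul]
  b_mul_J z := timeResolvent_mul_liftL hT z _
  b_mul_S z w _ := timeResolvent_mul_liftL hT z _
  b_resolvent := timeResolvent_sub_timeResolvent hT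
  b_differentiable := differentiable_timeResolvent hT
  b_bound := exists_norm_timeResolvent_le hT

lemma IsParabolicClass.doubleKernel_eq (h : LpT E p T) {l z : ℂ}
    (hl : l ∈ leftHalfPlane c) (hz : z ∈ leftHalfPlane c) :
    doubleKernel A h l z =
      halfResolvent (liftL E p T (invSqrt A)) (fun z => liftL E p T (shiftInv A (z ^ 2))) I z
        (halfResolvent (liftL E p T (invSqrt A)) (fun z => liftL E p T (shiftInv A (z ^ 2))) (-I) l
          (timeResolvent E p hT z (timeResolvent E p hT l h))) := by
  rw [doubleKernel,
    (hA.sectorial.isShiftInverse_sqrtOp Complex.I_mul_I (hA.sq_mem hc hz)).shiftInv_eq,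
    (hA.sectorial.isShiftInverse_sqrtOp (by simp) (hA.sq_mem hc hl)).shiftInv_eq,
    halfResolvent_liftL, halfResolvent_liftL]
  simp only [timeResolvent_apply, liftL_apply]

lemma IsParabolicClass.hasDoubleContourIntegral_doubleKernel {c' : ℝ} (hc' : c < c')
    {h v : LpT E p T}
    (hv : HasDoubleContourIntegral c' c (fun l z =>
      halfResolvent (liftL E p T (invSqrt A)) (fun z => liftL E p T (shiftInv A (z ^ 2))) I z
        (halfResolvent (liftL E p T (invSqrt A)) (fun z => liftL E p T (shiftInv A (z ^ 2))) (-I) l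
          (timeResolvent E p hT z (timeResolvent E p hT l h)))) v) :
    HasDoubleContourIntegral c' c (doubleKernel A h) v := by
  obtain ⟨G, hG, hGv⟩ := hv
  refine ⟨G, fun z hz => (hG z hz).congr fun l hl => ?_, hGv⟩
  refine (hA.doubleKernel_eq hc hT h hl.le ?_).symm
  change z.re ≤ -c
  linarith

end LiftedResolvents

/-! ### The weak derivative -/

section TestFunction

/-- Test functions on `(0,T)`: the functions against which `HasWeakDeriv` is tested. -/
structure IsTestFunction (T : ℝ) (φ : ℝ → ℝ) : Prop where
  contDiff : ContDiff ℝ ∞ φ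
  hasCompactSupport : HasCompactSupport φ
  tsupport_subset : tsupport φ ⊆ Ioo 0 T

variable {T : ℝ} {φ ψ : ℝ → ℝ}

namespace IsTestFunction

lemma integrable (hφ : IsTestFunction T φ) : Integrable φ :=
  hφ.contDiff.continuous.integrable_of_hasCompactSupport hφ.hasCompactSupport

lemma continuous_deriv (hφ : IsTestFunction T φ) : Continuous (deriv φ) :=
  hφ.contDiff.continuous_deriv (by simp)

lemma eq_zero_of_notMem (hφ : IsTestFunction T φ) {t : ℝ} (ht : t ∉ Ioo 0 T) : φ t = 0 :=
  image_eq_zero_of_notMem_tsupport fun h => ht (hφ.tsupport_subset h)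

lemma setIntegral_Ioo (hφ : IsTestFunction T φ) : ∫ t in Ioo 0 T, φ t = ∫ t, φ t :=
  setIntegral_eq_integral_of_forall_compl_eq_zero fun _ ht => hφ.eq_zero_of_notMem ht

lemma sub_const_mul (hφ : IsTestFunction T φ) (hψ : IsTestFunction T ψ) (r : ℝ) :
    IsTestFunction T fun t => φ t - r * ψ t where
  contDiff := hφ.contDiff.sub (contDiff_const.mul hψ.contDiff)
  hasCompactSupport := hφ.hasCompactSupport.sub hψ.hasCompactSupport.mul_left
  tsupport_subset := (tsupport_sub _ _).trans <|
    union_subset hφ.tsupport_subset (tsupport_mul_subset_right.trans hψ.tsupport_subset)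

end IsTestFunction

lemma exists_isTestFunction_integral_eq_one (hT : 0 < T) :
    ∃ φ : ℝ → ℝ, IsTestFunction T φ ∧ ∫ t, φ t = 1 := by
  set f : ContDiffBump (T / 2) := ⟨T / 8, T / 4, by positivity, by linarith⟩ with hf
  refine ⟨f.normed volume, ⟨f.contDiff_normed, f.hasCompactSupport_normed, ?_⟩, f.integral_normed⟩
  rw [f.tsupport_normed_eq, Real.closedBall_eq_Icc]
  refine Icc_subset_Ioo ?_ ?_ <;> simp only [hf] <;> linarith

lemma integral_eq_zero_of_notMem_Icc {a b : ℝ} (hφ : ∀ t ∉ Icc a b, φ t = 0) (h0 : ∫ t, φ t = 0)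
    {t : ℝ} (ht : t ∉ Icc a b) : ∫ s in a..t, φ s = 0 := by
  rcases lt_or_ge t a with hta | hta
  · refine intervalIntegral.integral_zero_ae ?_
    filter_upwards [compl_mem_ae_iff.2 (measure_singleton (μ := volume) a)] with x hx hxt
    rw [uIoc_of_ge hta.le] at hxt
    exact hφ x fun h => hx (le_antisymm hxt.2 h.1)
  · have hbt : b < t := not_le.1 fun h => ht ⟨hta, h⟩
    rw [intervalIntegral.integral_of_le hta, ← h0, ← integral_Icc_eq_integral_Ioc]
    exact setIntegral_eq_integral_of_forall_compl_eq_zero fun x hx =>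
      hφ x fun h => hx ⟨h.1, h.2.trans hbt.le⟩

lemma IsTestFunction.exists_deriv_eq (hψ : IsTestFunction T ψ) (h0 : ∫ t, ψ t = 0) :
    ∃ φ : ℝ → ℝ, IsTestFunction T φ ∧ deriv φ = ψ := by
  rcases (tsupport ψ).eq_empty_or_nonempty with hempty | hne
  · rw [tsupport_eq_empty_iff] at hempty
    exact ⟨0, ⟨contDiff_const, HasCompactSupport.zero, by simp⟩, by simp [hempty]⟩
  obtain ⟨a, ha, ha_least⟩ := hψ.hasCompactSupport.isCompact.exists_isLeast hne
  obtain ⟨b, hb, hb_greatest⟩ := hψ.hasCompactSupport.isCompact.exists_isGreatest hne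
  have hψ_zero : ∀ t ∉ Icc a b, ψ t = 0 := fun t ht =>
    image_eq_zero_of_notMem_tsupport fun h => ht ⟨ha_least h, hb_greatest h⟩
  have hψ_cont := hψ.contDiff.continuous
  have hprim : ∀ t, HasDerivAt (fun t => ∫ s in a..t, ψ s) (ψ t) t := fun t =>
    intervalIntegral.integral_hasDerivAt_right (hψ_cont.intervalIntegrable _ _)
      (hψ_cont.stronglyMeasurableAtFilter _ _) hψ_cont.continuousAt
  have hderiv : deriv (fun t => ∫ s in a..t, ψ s) = ψ := funext fun t => (hprim t).deriv
  have hsupp : tsupport (fun t => ∫ s in a..t, ψ s) ⊆ Icc a b :=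
    closure_minimal (fun t ht => not_not.1 fun h =>
      ht (integral_eq_zero_of_notMem_Icc hψ_zero h0 h)) isClosed_Icc
  refine ⟨_, ⟨?_, isCompact_Icc.of_isClosed_subset (isClosed_tsupport _) hsupp, hsupp.trans
    (Icc_subset_Ioo (hψ.tsupport_subset ha).1 (hψ.tsupport_subset hb).2)⟩, hderiv⟩
  rw [contDiff_infty_iff_deriv, hderiv]
  exact ⟨fun t => (hprim t).differentiableAt, hψ.contDiff⟩

end TestFunction

section WeakDerivative

variable {E : Type*} [NormedAddCommGroup E] [NormedSpace ℂ E] {T : ℝ}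

lemma integrableOn_Ioo_smul {φ : ℝ → ℝ} (hφ : Continuous φ) {g : ℝ → E}
    (hg : IntegrableOn g (Ioo 0 T)) : IntegrableOn (fun t => φ t • g t) (Ioo 0 T) := by
  rw [← integrableOn_Icc_iff_integrableOn_Ioo] at hg ⊢
  exact hg.continuousOn_smul hφ.continuousOn isCompact_Icc

lemma ae_eq_of_forall_isTestFunction [CompleteSpace E] {f g : ℝ → E}
    (hf : IntegrableOn f (Ioo 0 T)) (hg : IntegrableOn g (Ioo 0 T))
    (h : ∀ φ, IsTestFunction T φ → ∫ t in Ioo 0 T, φ t • f t = ∫ t in Ioo 0 T, φ t • g t) :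
    f =ᵐ[timeMeasure T] g := by
  have hzero := isOpen_Ioo.ae_eq_zero_of_integral_contDiff_smul_eq_zero (μ := volume)
    (hf.sub hg).locallyIntegrableOn fun φ hφ hφc hφs => ?_
  · refine (ae_restrict_iff' measurableSet_Ioo).2 ?_
    filter_upwards [hzero] with t ht htm using sub_eq_zero.1 (ht htm)
  · have htest : IsTestFunction T φ := ⟨hφ, hφc, hφs⟩
    rw [← setIntegral_eq_integral_of_forall_compl_eq_zero (s := Ioo 0 T)
      fun t ht => by rw [htest.eq_zero_of_notMem ht, zero_smul]]
    simp only [Pi.sub_apply, smul_sub]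
    rw [integral_sub (integrableOn_Ioo_smul hφ.continuous hf)
      (integrableOn_Ioo_smul hφ.continuous hg), h φ htest, sub_self]

namespace HasWeakDeriv

variable {f f' g h k : ℝ → E}

lemma congr_left (hf : HasWeakDeriv T f h) (hff : f' =ᵐ[timeMeasure T] f) :
    HasWeakDeriv T f' h := by
  intro φ hφ hφc hφs
  rw [← hf φ hφ hφc hφs]
  refine integral_congr_ae ?_
  filter_upwards [hff] with t ht
  rw [ht]

lemma sub (hf : HasWeakDeriv T f h) (hg : HasWeakDeriv T g k)
    (hf_int : IntegrableOn f (Ioo 0 T)) (hg_int : IntegrableOn g (Ioo 0 T))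
    (hh_int : IntegrableOn h (Ioo 0 T)) (hk_int : IntegrableOn k (Ioo 0 T)) :
    HasWeakDeriv T (fun t => f t - g t) (fun t => h t - k t) := by
  intro φ hφ hφc hφs
  have hderiv : Continuous (deriv φ) := hφ.continuous_deriv (by simp)
  simp only [smul_sub]
  rw [integral_sub (integrableOn_Ioo_smul hderiv hf_int) (integrableOn_Ioo_smul hderiv hg_int),
    integral_sub (integrableOn_Ioo_smul hφ.continuous hh_int)
      (integrableOn_Ioo_smul hφ.continuous hk_int), hf φ hφ hφc hφs, hg φ hφ hφc hφs]
  abel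

/-- `ψ - (∫ ψ) φ` has integral zero, so it is the derivative of a test function. -/
lemma integral_smul_eq {φ ψ : ℝ → ℝ} (hf : HasWeakDeriv T f fun _ => 0)
    (hf_int : IntegrableOn f (Ioo 0 T)) (hφ : IsTestFunction T φ) (hφ_one : ∫ t, φ t = 1)
    (hψ : IsTestFunction T ψ) :
    ∫ t in Ioo 0 T, ψ t • f t = (∫ t, ψ t) • ∫ t in Ioo 0 T, φ t • f t := by
  obtain ⟨χ, hχ, hχ_deriv⟩ := (hψ.sub_const_mul hφ (∫ t, ψ t)).exists_deriv_eq (by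
    rw [integral_sub hψ.integrable (hφ.integrable.const_mul _), integral_const_mul, hφ_one,
      mul_one, sub_self])
  have hweak := hf χ hχ.contDiff hχ.hasCompactSupport hχ.tsupport_subset
  simp only [hχ_deriv, smul_zero, integral_zero, neg_zero, sub_smul, mul_smul] at hweak
  rwa [integral_sub (integrableOn_Ioo_smul hψ.contDiff.continuous hf_int)
    (g := fun t => (∫ t, ψ t) • φ t • f t)
    ((integrableOn_Ioo_smul hφ.contDiff.continuous hf_int).smul _), integral_smul,
    sub_eq_zero] at hweak

lemma ae_eq_const [CompleteSpace E] (hT : 0 < T) (hf : HasWeakDeriv T f fun _ => 0)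
    (hf_int : IntegrableOn f (Ioo 0 T)) : ∃ a : E, f =ᵐ[timeMeasure T] fun _ => a := by
  obtain ⟨φ, hφ, hφ_one⟩ := exists_isTestFunction_integral_eq_one hT
  refine ⟨∫ t in Ioo 0 T, φ t • f t, ae_eq_of_forall_isTestFunction hf_int
    (integrableOn_const (by simp)) fun ψ hψ => ?_⟩
  rw [hf.integral_smul_eq hf_int hφ hφ_one hψ, integral_smul_const, hψ.setIntegral_Ioo]

end HasWeakDeriv

lemma hasWeakDeriv_duhamel [CompleteSpace E] (hT : 0 ≤ T) {g : ℝ → E}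
    (hg : IntegrableOn g (Ioc 0 T)) : HasWeakDeriv T (duhamel 0 g) g := by
  intro φ hφ hφc hφs
  have htest : IsTestFunction T φ := ⟨hφ, hφc, hφs⟩
  have hφT : φ T = 0 := htest.eq_zero_of_notMem right_notMem_Ioo
  have hduhamel : ∀ t, duhamel 0 g t = ∫ x in (0 : ℝ)..t, g x := by simp [duhamel]
  have hprim : ∀ x, ∫ s in x..T, ((deriv φ s : ℝ) : ℂ) = ((-φ x : ℝ) : ℂ) := fun x => by
    rw [intervalIntegral.integral_ofReal, intervalIntegral.integral_deriv_eq_sub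
      (fun y _ => (hφ.differentiable (by simp)).differentiableAt)
      (htest.continuous_deriv.intervalIntegrable _ _), hφT, zero_sub]
  have hfubini := integral_smul_primitive hT (ψ := fun s => ((deriv φ s : ℝ) : ℂ))
    (Complex.continuous_ofReal.comp htest.continuous_deriv).integrableOn_Ioc hg
  rw [intervalIntegral.integral_of_le hT, intervalIntegral.integral_of_le hT,
    integral_Ioc_eq_integral_Ioo, integral_Ioc_eq_integral_Ioo] at hfubini
  simpa only [hduhamel, hprim, Complex.coe_smul, neg_smul, integral_neg] using hfubini

variable {p : ℝ≥0∞} [Fact (1 ≤ p)] [CompleteSpace E] {f h : LpT E p T}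

lemma isTimeDeriv_derivInv (hT : 0 ≤ T) (h : LpT E p T) : IsTimeDeriv (derivInv 0 h) h :=
  ⟨(hasWeakDeriv_duhamel hT (integrableOn_LpT h)).congr_left (coeFn_derivInv 0 h),
    duhamel 0 h, continuousOn_duhamel 0 (integrableOn_LpT h), (coeFn_derivInv 0 h).symm,
    by simp [duhamel]⟩

lemma IsTimeDeriv.eq_derivInv (hT : 0 < T) (hf : IsTimeDeriv f h) : f = derivInv 0 h := by
  obtain ⟨hweak, F, hF_cont, hF_ae, hF_zero⟩ := hf
  have hint (g : LpT E p T) : IntegrableOn g (Ioo 0 T) :=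
    (integrableOn_LpT g).mono_set Ioo_subset_Ioc_self
  have hduhamel_int : IntegrableOn (duhamel 0 h) (Ioo 0 T) :=
    (memLp_duhamel (p := p) 0 h).integrable Fact.out
  have hdiff := hweak.sub (hasWeakDeriv_duhamel hT.le (integrableOn_LpT h)) (hint f) hduhamel_int
    (hint h) (hint h)
  simp only [sub_self] at hdiff
  obtain ⟨a, ha⟩ := hdiff.ae_eq_const hT ((hint f).sub hduhamel_int)
  have hF_sub : (fun t => F t - duhamel 0 h t) =ᵐ[volume.restrict (Icc 0 T)] fun _ => a := by
    rw [← restrict_Ioo_eq_restrict_Icc]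
    filter_upwards [ha, hF_ae] with t hat hFt
    rw [hFt, hat]
  have ha_zero : a = 0 := by
    have hleft := Measure.eqOn_Icc_of_ae_eq volume hT.ne hF_sub
      (hF_cont.sub (continuousOn_duhamel 0 (integrableOn_LpT h))) continuousOn_const
      (left_mem_Icc.2 hT.le)
    simpa [hF_zero, duhamel] using hleft.symm
  refine Lp.ext ?_
  filter_upwards [ha, coeFn_derivInv 0 h] with t hat hderivInv
  rw [hderivInv, ← sub_eq_zero, hat, ha_zero]

lemma isTimeDeriv_iff (hT : 0 < T) : IsTimeDeriv f h ↔ f = derivInv 0 h :=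
  ⟨fun hf => hf.eq_derivInv hT, fun hf => hf ▸ isTimeDeriv_derivInv hT.le h⟩

lemma isHyperbolicApply_iff (hT : 0 < T) {A : E →ₗ.[ℂ] E} (hA : (0 : ℂ) ∈ resolventSetNeg A)
    {u h : LpT E p T} :
    IsHyperbolicApply A u h ↔ ∃ u₂ v : LpT E p T, u = derivInv 0 (derivInv 0 u₂) ∧
      u = liftOp (shiftInv A 0) v ∧ u₂ + v = h := by
  simp only [IsHyperbolicApply, isTimeDeriv_iff hT, isPointwiseApply_iff hA]
  constructor
  · rintro ⟨_, u₂, v, rfl, rfl, hv, hsum⟩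
    exact ⟨u₂, v, rfl, hv, hsum⟩
  · rintro ⟨u₂, v, hu, hv, hsum⟩
    exact ⟨_, u₂, v, hu, rfl, hv, hsum⟩

end WeakDerivative

/-! ### Uniform convergence of the contour integral -/

section ContinuousContour

variable {E : Type*} [NormedAddCommGroup E] [NormedSpace ℂ E] {p : ℝ≥0∞} [Fact (1 ≤ p)]
  {T : ℝ}

/-- The continuous representative of `(A + z²)⁻¹ (B + z)⁻¹ w`. -/
def waveKernelC (A : E →ₗ.[ℂ] E) (w : LpT E p T) (z : ℂ) : C(Icc (0 : ℝ) T, E) :=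
  (shiftInv A (z ^ 2)).compLeftContinuous ℂ (Icc (0 : ℝ) T) (duhamelC z w)

lemma waveKernelC_apply (A : E →ₗ.[ℂ] E) (w : LpT E p T) (z : ℂ) (t : Icc (0 : ℝ) T) :
    waveKernelC A w z t = shiftInv A (z ^ 2) (duhamel z w t) := rfl

lemma toLpT_waveKernelC (hT : 0 ≤ T) (A : E →ₗ.[ℂ] E) (w : LpT E p T) (z : ℂ) :
    toLpT hT (waveKernelC A w z) = liftOp (shiftInv A (z ^ 2)) (derivInv z w) := by
  rw [waveKernelC, toLpT_compLeftContinuous, toLpT_duhamelC]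

variable [CompleteSpace E]

lemma W0_succ_subset (hT : 0 ≤ T) (S : E →L[ℂ] E) (n : ℕ) : W0 (n + 1) p T S ⊆ W0 n p T S := by
  rintro _ ⟨k, rfl⟩
  refine ⟨timeResolvent E p hT 0 k, ?_⟩
  have hcomm := DFunLike.congr_fun (timeResolvent_mul_liftL (p := p) hT 0 S) k
  simp only [mul_apply_eq_comp, timeResolvent_apply, liftL_apply] at hcomm
  rw [Function.iterate_succ_apply, hcomm, timeResolvent_apply]

lemma continuous_duhamelC (hT : 0 ≤ T) (g : LpT E p T) : Continuous fun z => duhamelC z g := by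
  have hres : ∀ z, duhamelC z g = duhamelC 0 g - z • duhamelC 0 (timeResolvent E p hT z g) :=
    fun z => by
      have hsub := duhamelC_sub_duhamelC hT 0 z g
      rw [sub_zero] at hsub
      rw [timeResolvent, ContinuousLinearMap.comp_apply, ← hsub, sub_sub_cancel]
  have hcont : Continuous fun z => timeResolvent E p hT z g :=
    (differentiable_timeResolvent (E := E) (p := p) hT).continuous.clm_apply continuous_const
  rw [funext hres]
  exact continuous_const.sub (continuous_id.smul ((duhamelC 0).continuous.comp hcont))

lemma smul_duhamelC_derivInv_zero (hT : 0 ≤ T) (S : E →L[ℂ] E) (z : ℂ) (k : LpT E p T) :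
    z • duhamelC z (derivInv 0 (liftOp S k)) =
      S.compLeftContinuous ℂ (Icc (0 : ℝ) T) (duhamelC 0 k - duhamelC z k) := by
  have hres := duhamelC_sub_duhamelC hT z 0 (liftOp S k : LpT E p T)
  rw [toLpT_duhamelC, duhamelC_liftOp, duhamelC_liftOp] at hres
  rw [map_sub]
  linear_combination (norm := module) hres

variable {A : E →ₗ.[ℂ] E} {c : ℝ} (hA : IsParabolicClass A (c ^ 2)) (hc : 0 < c) (hT : 0 ≤ T)
include hA hc hT

namespace IsParabolicClass

lemma continuous_vertical_waveKernelC (w : LpT E p T) :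
    Continuous fun s : ℝ => waveKernelC A w (-(c : ℂ) + s * I) := by
  refine ContinuousMap.continuous_of_continuous_uncurry _ ?_
  have hresolvent : Continuous fun q : ℝ × Icc (0 : ℝ) T =>
      shiftInv A ((-(c : ℂ) + q.1 * I) ^ 2) :=
    (continuous_vertical (hA.differentiableOn_sq hc).continuousOn).comp continuous_fst
  have hduhamel : Continuous fun q : ℝ × Icc (0 : ℝ) T => duhamelC (-(c : ℂ) + q.1 * I) w q.2 :=
    ((continuous_duhamelC hT w).comp (by fun_prop :
      Continuous fun q : ℝ × Icc (0 : ℝ) T => -(c : ℂ) + q.1 * I)).eval continuous_snd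
  exact hresolvent.clm_apply hduhamel

lemma exists_norm_waveKernelC_le (k : LpT E p T) :
    ∃ C : ℝ, 0 ≤ C ∧ ∀ z : ℂ, z.re = -c →
      ‖waveKernelC A (derivInv 0 (liftOp (invSqrt A) k)) z‖ ≤ C * (‖z‖⁻¹ * ‖z‖⁻¹) := by
  obtain ⟨M, hM, hduhamel⟩ := exists_norm_duhamelC_le E p T c
  obtain ⟨N, hN, hresolvent⟩ := (hA.weighted_decays hc).exists_bound
  refine ⟨N * (M * ‖k‖ + M * ‖k‖), by positivity, fun z hz => ?_⟩
  have hz_pos : 0 < ‖z‖ := norm_pos_iff.2 fun h => hc.ne' (by simpa [h] using hz)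
  have hduhamel_k : ∀ y, -c ≤ y.re → ‖duhamelC y k‖ ≤ M * ‖k‖ := fun y hy =>
    ((duhamelC y).le_opNorm k).trans (by gcongr; exact hduhamel y hy)
  refine (ContinuousMap.norm_le _ (by positivity)).2 fun t => ?_
  have hsmul : (z * z) • waveKernelC A (derivInv 0 (liftOp (invSqrt A) k)) z t =
      (z • (shiftInv A (z ^ 2) * invSqrt A)) ((duhamelC 0 k - duhamelC z k) t) := by
    have ht : z • duhamelC z (derivInv 0 (liftOp (invSqrt A) k)) t =
        invSqrt A ((duhamelC 0 k - duhamelC z k) t) :=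
      DFunLike.congr_fun (smul_duhamelC_derivInv_zero hT (invSqrt A) z k) t
    rw [mul_smul, smul_apply, mul_apply_eq_comp, ← ht, map_smul]
    rfl
  have hbound : ‖z‖ * ‖z‖ * ‖waveKernelC A (derivInv 0 (liftOp (invSqrt A) k)) z t‖ ≤
      N * (M * ‖k‖ + M * ‖k‖) := by
    rw [← norm_mul, ← norm_smul, hsmul]
    refine (ContinuousLinearMap.le_opNorm _ _).trans ?_
    refine mul_le_mul (hresolvent z hz.le) ?_ (norm_nonneg _) hN
    refine (ContinuousMap.norm_coe_le_norm _ t).trans ((norm_sub_le _ _).trans ?_)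
    exact add_le_add (hduhamel_k 0 (by simpa using hc.le)) (hduhamel_k z hz.ge)
  rwa [← mul_inv, ← div_eq_mul_inv, le_div_iff₀ (by positivity), mul_comm]

lemma exists_hasContourIntegral_waveKernelC {w : LpT E p T} (hw : w ∈ W0 1 p T (invSqrt A)) :
    ∃ F : C(Icc (0 : ℝ) T, E), HasContourIntegral c (waveKernelC A w) F := by
  obtain ⟨k, rfl⟩ := hw
  obtain ⟨C, hC, hbound⟩ := hA.exists_norm_waveKernelC_le hc hT k
  exact ⟨_, hasContourIntegral_of_integrable (integrable_vertical_of_norm_le_inv_sq hc hC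
    (hA.continuous_vertical_waveKernelC hc hT _) hbound)⟩

end IsParabolicClass

end ContinuousContour

/-! ### The Cauchy problem -/

section CauchyProblem

variable {E : Type*} [NormedAddCommGroup E] [NormedSpace ℂ E] {p : ℝ≥0∞} [Fact (1 ≤ p)]
  {T : ℝ} {A : E →ₗ.[ℂ] E} {c : ℝ}

lemma HasDoubleContourIntegral.unique {c' : ℝ} {F : ℂ → ℂ → E} {v w : E}
    (hv : HasDoubleContourIntegral c' c F v) (hw : HasDoubleContourIntegral c' c F w) : v = w := by
  obtain ⟨G, hG, hGv⟩ := hv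
  obtain ⟨G', hG', hGw⟩ := hw
  exact hGv.unique (hGw.congr fun z hz => (hG' z hz).unique (hG z hz))

lemma HasDoubleContourIntegral.eq_zero_of_forall {c' : ℝ} {F : ℂ → ℂ → E} {v : E}
    (hv : HasDoubleContourIntegral c' c F v) (hF : ∀ l z, F l z = 0) : v = 0 := by
  obtain ⟨G, hG, hGv⟩ := hv
  have hG_zero : ∀ z : ℂ, z.re = -c' → G z = 0 := fun z hz =>
    (hG z hz).eq_zero_of_forall fun l => hF l z
  exact (hGv.congr hG_zero).eq_zero_of_forall fun _ => rfl

lemma startsAtZero_toLpT (hT : 0 ≤ T) {F : C(Icc (0 : ℝ) T, E)}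
    (hF : F ⟨0, left_mem_Icc.2 hT⟩ = 0) : StartsAtZero (toLpT hT F : LpT E p T) :=
  ⟨IccExtend hT F, F.continuous.Icc_extend'.continuousOn, (coeFn_toLpT hT F).symm, by
    rw [IccExtend_of_mem _ _ (left_mem_Icc.2 hT), hF]⟩

variable [CompleteSpace E]

lemma HasContourIntegral.eval_waveKernelC {w : LpT E p T} {F : C(Icc (0 : ℝ) T, E)}
    (hF : HasContourIntegral c (waveKernelC A w) F) {t : ℝ} (ht : t ∈ Icc 0 T) :
    HasContourIntegral c
      (fun z => ∫ x in (0 : ℝ)..t, shiftInv A (z ^ 2) (Complex.exp (z * ((x : ℂ) - t)) • w x))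
      (F ⟨t, ht⟩) :=
  (hF.map (ContinuousMap.evalCLM ℂ ⟨t, ht⟩)).congr fun z _ => by
    rw [integral_clm_exp_smul _ z w ht, ContinuousMap.evalCLM_apply, waveKernelC_apply]

lemma HasContourIntegral.waveKernelC_zero (hT : 0 ≤ T) {w : LpT E p T} {F : C(Icc (0 : ℝ) T, E)}
    (hF : HasContourIntegral c (waveKernelC A w) F) : F ⟨0, left_mem_Icc.2 hT⟩ = 0 :=
  (hF.eval_waveKernelC (left_mem_Icc.2 hT)).eq_zero_of_forall fun _ =>
    intervalIntegral.integral_same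

lemma HasContourIntegral.toLpT_waveKernelC (hT : 0 ≤ T) {w : LpT E p T} {F : C(Icc (0 : ℝ) T, E)}
    (hF : HasContourIntegral c (waveKernelC A w) F) :
    HasContourIntegral c (fun z => liftOp (shiftInv A (z ^ 2)) (derivInv z w)) (toLpT hT F) :=
  (hF.map (toLpT hT)).congr fun z _ => _root_.toLpT_waveKernelC hT A w z

lemma IsSectorial.liftL_shiftInv_zero (hA : IsSectorial A 0) :
    liftL E p T (shiftInv A 0) = liftL E p T (invSqrt A) * liftL E p T (invSqrt A) := by
  rw [← hA.invSqrt_mul_self, liftL_mul]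

lemma isGeneralizedSolution_iff (hA : (0 : ℂ) ∈ resolventSetNeg A) (hT : 0 < T)
    {g f : LpT E p T} : IsGeneralizedSolution A g f ↔
      liftL E p T (shiftInv A 0) f + timeResolvent E p hT.le 0 (timeResolvent E p hT.le 0 f) =
        timeResolvent E p hT.le 0 (timeResolvent E p hT.le 0 (liftL E p T (shiftInv A 0) g)) := by
  rw [← eq_sub_iff_add_eq, ← map_sub, ← map_sub, IsGeneralizedSolution, isHyperbolicApply_iff hT hA]
  simp only [timeResolvent_apply, liftL_apply]
  constructor
  · rintro ⟨u, v, hu, hv, huv⟩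
    obtain rfl : f = v := liftOp_injective (shiftInv_injective hA) hv
    rw [hu, ← huv, add_sub_cancel_right]
  · exact fun h => ⟨_, f, h, rfl, sub_add_cancel _ _⟩

namespace IsParabolicClass

variable (hA : IsParabolicClass A (c ^ 2)) (hc : 0 < c) (hT : 0 < T)
include hA hc hT

lemma inversionIdentity {u : LpT E p T} (hu : u ∈ dataSpace A p T) : InversionIdentity A c u := by
  set J := liftL E p T (invSqrt A)
  obtain ⟨⟨v, hv⟩, k, hk⟩ := hu
  have hv_inv : u = liftOp (shiftInv A 0) (J v) := by
    rw [hv, ← liftL_apply, invThreeHalves, ← ContinuousLinearMap.mul_def, liftL_mul]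
    rfl
  have hv_sqrt : u = J (J (J v)) := by
    rw [hv_inv, ← liftL_apply, hA.sectorial.liftL_shiftInv_zero, mul_apply_eq_comp]
  have hk_time : u = timeResolvent E p hT.le 0 (timeResolvent E p hT.le 0 (J k)) := by
    rw [hk, timeResolvent_apply, timeResolvent_apply]
    rfl
  refine ⟨J k + J v, (isHyperbolicApply_iff hT hA.sectorial.zero_mem).2 ⟨J k, J v, hk, hv_inv, rfl⟩,
    fun c' hc' => hA.hasDoubleContourIntegral_doubleKernel hc hT.le hc' ?_⟩
  exact (hA.waveResolvents hc hT.le).hasDoubleContourIntegral_inversion hc' hk_time hv_sqrt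

lemma hasDoubleContourIntegral_of_hasContourIntegral {w v : LpT E p T}
    (hw : w ∈ W0 1 p T (invSqrt A))
    (hv : HasContourIntegral c (fun z => liftOp (shiftInv A (z ^ 2)) (derivInv z w)) v)
    {c' : ℝ} (hc' : c < c') : HasDoubleContourIntegral c' c (doubleKernel A w) v := by
  obtain ⟨k, hk⟩ := hw
  have hk_time : w = timeResolvent E p hT.le 0 (liftL E p T (invSqrt A) k) := by
    rw [hk, timeResolvent_apply]
    rfl
  refine hA.hasDoubleContourIntegral_doubleKernel hc hT.le hc' ?_
  rw [hk_time]
  refine (hA.waveResolvents hc hT.le).hasDoubleContourIntegral_of_hasContourIntegral hc' ?_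
  exact hv.congr fun z _ => by rw [← hk_time, timeResolvent_apply, liftL_apply]

lemma reductionIdentity {w : LpT E p T} (hw : w ∈ W0 1 p T (invSqrt A)) :
    ReductionIdentity A c w := by
  obtain ⟨F, hF⟩ := hA.exists_hasContourIntegral_waveKernelC hc hT.le hw
  have hv := hF.toLpT_waveKernelC hT.le
  exact ⟨_, hv, fun c' => hA.hasDoubleContourIntegral_of_hasContourIntegral hc hT hw hv⟩

lemma isGeneralizedSolution_of_hasContourIntegral {g f : LpT E p T}
    (hf : HasContourIntegral c (fun z => liftOp (shiftInv A (z ^ 2)) (derivInv z g)) f) :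
    IsGeneralizedSolution A g f := by
  have W := hA.waveResolvents (p := p) hc hT.le
  rw [isGeneralizedSolution_iff hA.sectorial.zero_mem hT, hA.sectorial.liftL_shiftInv_zero,
    mul_apply_eq_comp, mul_apply_eq_comp, W.generalized_equation_of_hasContourIntegral
      (hf.congr fun z _ => by rw [timeResolvent_apply, liftL_apply])]
  simp only [W.b_J_apply]

/-- Smoothing a homogeneous solution by `A^{-3/2} B⁻²` puts it into the scope of the inversion
formula. -/
lemma eq_zero_of_homogeneous {f : LpT E p T}
    (hf : liftL E p T (shiftInv A 0) f +
      timeResolvent E p hT.le 0 (timeResolvent E p hT.le 0 f) = 0) : f = 0 := by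
  have W := hA.waveResolvents (p := p) hc hT.le
  rw [hA.sectorial.liftL_shiftInv_zero, mul_apply_eq_comp] at hf
  set J := liftL E p T (invSqrt A)
  set b := timeResolvent E p hT.le
  have hJ : ∀ x, J x = 0 → x = 0 := fun x hx => W.J_injective (hx.trans (map_zero J).symm)
  have hsmooth : J (J (J (b 0 (b 0 f)))) = b 0 (b 0 (J (J (J f)))) := by
    simp only [W.b_J_apply]
  have hrhs : J (J (J f)) + J (b 0 (b 0 f)) = 0 := by rw [← map_add, hf, map_zero]
  have hzero : J (J (J (b 0 (b 0 f)))) = 0 :=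
    (W.hasDoubleContourIntegral_inversion (lt_add_one c) hsmooth rfl).eq_zero_of_forall
      fun l z => by simp only [hrhs, map_zero]
  rw [hJ _ (hJ _ (hJ _ hzero)), add_zero] at hf
  exact hJ _ (hJ _ hf)

lemma isGeneralizedSolution_unique {g f f' : LpT E p T} (hf : IsGeneralizedSolution A g f)
    (hf' : IsGeneralizedSolution A g f') : f' = f := by
  rw [isGeneralizedSolution_iff hA.sectorial.zero_mem hT] at hf hf'
  refine sub_eq_zero.1 (hA.eq_zero_of_homogeneous hc hT ?_)
  simp only [map_sub]
  rw [sub_add_sub_comm, hf', hf, sub_self]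

lemma isTimeDeriv_of_hasContourIntegral {g f f₁ : LpT E p T}
    (hf : HasContourIntegral c
      (fun z => liftOp (shiftInv A (z ^ 2)) (derivInv z (derivInv 0 g))) f)
    (hf₁ : HasContourIntegral c (fun z => liftOp (shiftInv A (z ^ 2)) (derivInv z g)) f₁) :
    IsTimeDeriv f f₁ := by
  have W := hA.waveResolvents (p := p) hc hT.le
  refine (isTimeDeriv_iff hT).2 ?_
  simp only [← timeResolvent_apply hT.le, ← liftL_apply] at hf hf₁ ⊢
  refine hf.unique ((hf₁.map (timeResolvent E p hT.le 0)).congr fun z hz => ?_)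
  rw [W.b_S_apply 0 hz.le, W.b_comm_apply 0 z]

lemma exists_continuous_contourIntegral {g : LpT E p T} (hg : g ∈ W0 2 p T (invSqrt A)) :
    ∃ F : C(Icc (0 : ℝ) T, E), HasContourIntegral c (waveKernelC A g) F ∧
      ∃ f₁ : LpT E p T, IsTimeDeriv (toLpT hT.le F) f₁ ∧ StartsAtZero f₁ := by
  obtain ⟨F, hF⟩ := hA.exists_hasContourIntegral_waveKernelC hc hT.le (W0_succ_subset hT.le _ 1 hg)
  obtain ⟨k, rfl⟩ := hg
  obtain ⟨F₁, hF₁⟩ := hA.exists_hasContourIntegral_waveKernelC (p := p) hc hT.le ⟨k, rfl⟩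
  exact ⟨F, hF, toLpT hT.le F₁, hA.isTimeDeriv_of_hasContourIntegral hc hT
    (hF.toLpT_waveKernelC hT.le) (hF₁.toLpT_waveKernelC hT.le),
    startsAtZero_toLpT hT.le (hF₁.waveKernelC_zero hT.le)⟩

end IsParabolicClass

end CauchyProblem

end

theorem theorem4p2_general {E : Type*} [NormedAddCommGroup E] [NormedSpace ℂ E] [CompleteSpace E]
    (A : E →ₗ.[ℂ] E) (c : ℝ) (hc : 0 < c) (hA : IsParabolicClass A (c ^ 2))
    (p : ℝ≥0∞) [Fact (1 ≤ p)] (T : ℝ) (hT : 0 < T) :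
    (∀ u ∈ dataSpace A p T, InversionIdentity A c u) ∧
    (∀ w ∈ W0 1 p T (invSqrt A), ReductionIdentity A c w) ∧
    ∀ g ∈ dataSpace A p T, ∃ f : LpT E p T,
      MemW1p f ∧
      (∃ f₁ : LpT E p T, IsTimeDeriv f f₁ ∧ StartsAtZero f₁) ∧
      IsContourSolution A c g f ∧
      IsGeneralizedSolution A g f ∧
      (∀ f' : LpT E p T, IsContourSolution A c g f' ∨ IsGeneralizedSolution A g f' → f' = f) ∧
      HasContourIntegral c (fun z => liftOp (shiftInv A (z ^ 2)) (derivInv z g)) f ∧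
      ∃ F : ℝ → E, ContinuousOn F (Icc 0 T) ∧ F =ᵐ[timeMeasure T] f ∧
        ∀ t ∈ Icc 0 T, HasContourIntegral c
          (fun z => ∫ x in (0 : ℝ)..t, shiftInv A (z ^ 2) (Complex.exp (z * ((x : ℂ) - t)) • g x))
          (F t) := by
  refine ⟨fun u hu => hA.inversionIdentity hc hT hu, fun w hw => hA.reductionIdentity hc hT hw,
    fun g hg => ?_⟩
  obtain ⟨F, hF, f₁, hderiv, hf₁⟩ := hA.exists_continuous_contourIntegral hc hT hg.2
  have hcontour := hF.toLpT_waveKernelC hT.le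
  have hdouble : ∀ c' : ℝ, c < c' →
      HasDoubleContourIntegral c' c (doubleKernel A g) (toLpT hT.le F) := fun c' hc' =>
    hA.hasDoubleContourIntegral_of_hasContourIntegral hc hT (W0_succ_subset hT.le _ 1 hg.2) hcontour
      hc'
  have hgeneralized := hA.isGeneralizedSolution_of_hasContourIntegral hc hT hcontour
  refine ⟨toLpT hT.le F, ⟨f₁, hderiv.1⟩, ⟨f₁, hderiv, hf₁⟩,
    ⟨hA.inversionIdentity hc hT hg, hdouble⟩, hgeneralized, ?_, hcontour,
    IccExtend hT.le F, F.continuous.Icc_extend'.continuousOn, (coeFn_toLpT hT.le F).symm,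
    fun t ht => ?_⟩
  · rintro f' (hf' | hf')
    · exact (hf'.2 _ (lt_add_one c)).unique (hdouble _ (lt_add_one c))
    · exact hA.isGeneralizedSolution_unique hc hT hgeneralized hf'
  · rw [IccExtend_of_mem _ _ ht]
    exact hF.eval_waveKernelC ht

theorem theorem4p2 {E : Type*} [NormedAddCommGroup E] [NormedSpace ℂ E] [CompleteSpace E]
    (A : E →ₗ.[ℂ] E) (c : ℝ) (hc : 0 < c) (hA : IsParabolicClass A (c ^ 2))
    (p : ℝ≥0∞) [Fact (1 ≤ p)] (hp : 1 < p) (hp' : p ≠ ⊤) (T : ℝ) (hT : 0 < T) :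
    (∀ u ∈ dataSpace A p T, InversionIdentity A c u) ∧
    (∀ w ∈ W0 1 p T (invSqrt A), ReductionIdentity A c w) ∧
    ∀ g ∈ dataSpace A p T, ∃ f : LpT E p T,
      MemW1p f ∧
      (∃ f₁ : LpT E p T, IsTimeDeriv f f₁ ∧ StartsAtZero f₁) ∧
      IsContourSolution A c g f ∧
      IsGeneralizedSolution A g f ∧
      (∀ f' : LpT E p T, IsContourSolution A c g f' ∨ IsGeneralizedSolution A g f' → f' = f) ∧
      HasContourIntegral c (fun z => liftOp (shiftInv A (z ^ 2)) (derivInv z g)) f ∧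
      ∃ F : ℝ → E, ContinuousOn F (Icc 0 T) ∧ F =ᵐ[timeMeasure T] f ∧
        ∀ t ∈ Icc 0 T, HasContourIntegral c
          (fun z => ∫ x in (0 : ℝ)..t, shiftInv A (z ^ 2) (Complex.exp (z * ((x : ℂ) - t)) • g x))
          (F t) :=
  theorem4p2_general A c hc hA p T hT
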